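/- Let $M$ be a real supermanifold of dimension $p|q$, with local coordinates $x^a$ of parity $\tilde a$. Let $\Pi T^*M$ be its odd (parity reversed) cotangent bundle, with fibre coordinates $x^*_a$ of parity $\tilde a+1$ transforming as $x^*_{a'}=\frac{\partial x^a}{\partial x^{a'}}x^*_a$. For $\lambda\in\mathbb R$ let $\mathcal F^\lambda(M)$ be the densities of weight $\lambda$, locally $s(x)|Dx|^\lambda$, where $|Dx'|=|J|\,|Dx|$ and $J=\mathrm{Ber}(\partial x'/\partial x)$. An element of $C^\infty(\Pi T^*M)\otimes\mathcal F^\lambda(M)$ (tensor product over $C^\infty(M)$) is locally $s(x,x^*)|Dx|^\lambda$. Let $\widehat M$ be the space whose function algebra is the algebra of densities $\mathcal F(M)=\bigoplus_\lambda\mathcal F^\lambda(M)$: locally it has the coordinates $(x^a,t)$, where $t>0$ is even and represents $|Dx|$, so that $t'=|J|t$. Let $\Pi T^*\widehat M$ be its odd cotangent bundle, with coordinates $(x^a,t;\widehat x^*_a,t^*)$, and put $w^*=tt^*$. The algebra $C^\infty(\Pi T^*\widehat M)$ consists of the finite sums $\sum_\lambda f_\lambda(x,\widehat x^*,w^*)\,t^\lambda$.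 It is graded by weight: $t$ has weight $1$, $t^*$ has weight $-1$, and $x^a,\widehat x^*_a$ have weight $0$. Let $\mathbf p: C^\infty(\Pi T^*\widehat M)\to C^\infty(\Pi T^*M)\otimes\mathcal F(M)$ be the canonical projection, which is $t^*\mapsto 0$, $\widehat x^*_a\mapsto x^*_a$, $t\mapsto|Dx|$ in coordinates. On an odd cotangent bundle with base coordinates $x^a$ let $\Delta=\sum_a(-1)^{\tilde a}\partial_{x^a}\partial_{x^*_a}$ (left derivatives), written $\Delta_{|Dx|}$ in the coordinates of $M$, and let $$(f,g)=\sum_a(-1)^{\tilde a(\tilde f+1)}\Big(\frac{\partial f}{\partial x^*_a}\frac{\partial g}{\partial x^a}+(-1)^{\tilde f}\frac{\partial f}{\partial x^a}\frac{\partial g}{\partial x^*_a}\Big)$$ be the canonical odd bracket. Let $\delta$ be the operator on functions on $\Pi T^*\widehat M$ that comes from the volume form $\rho_0=t^{-2}|D(x,t)|$, that is, $\delta F=t^{2}\Delta(t^{-2}F)$ with $\Delta$ taken in the coordinates $(x,t;\widehat x^*,t^*)$. **Theorem.** For each $\lambda\neq1$ there is an $\mathbb R$-linear map $s\mapsto\widehat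 s$ from $C^\infty(\Pi T^*M)\otimes\mathcal F^\lambda(M)$ to $C^\infty(\Pi T^*\widehat M)$, independent of coordinates, with the following properties. 1. In every chart, $s(x,x^*)|Dx|^\lambda$ is mapped to $$\widehat s=s(x,\widehat x^*)\,t^\lambda+\frac1{1-\lambda}\,w^*t^\lambda\,\big(\Delta_{|Dx|}s\big)(x,\widehat x^*).$$ 2. The map preserves weight ($\widehat s$ has weight $\lambda$) and parity, and the degree in the fibre coordinates of elements that are polynomial in them. 3. $\mathbf p(\widehat s)=s$ and $\delta\widehat s=0$, and $\widehat s$ is the only element of weight $\lambda$ with these two properties. 4. The maps commute with the odd bracket: $(\widehat s,\widehat u)=\widehat{(s,u)}$ for $s,u\in C^\infty(\Pi T^*M)$ (the case $\lambda=0$). More generally, if $s$ and $u$ have weights $\lambda\ne1$ and $\mu\neq1$ with $\lambda+\mu\neq1$, then $(\widehat s,\widehat u)$ is the lift of the element $\mathbf p\big((\widehat s,\widehat u)\big)$ of weight $\lambda+\mu$, which for $\lambda=\mu=0$ is $(s,u)$. -/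

import Mathlib

set_option linter.unusedSectionVars false

open scoped ContDiff
open Set

noncomputable section

namespace SuperGeom

/-! ## Grassmann algebras -/

/-- The Grassmann algebra on odd generators indexed by `ο`. -/
abbrev Gr (ο : Type*) := ExteriorAlgebra ℝ (ο → ℝ)

/-- A basis of the Grassmann algebra as a real vector space. Smoothness and partial derivatives
of functions with values in the (finite dimensional) Grassmann algebra are taken coordinatewise
with respect to it, and do not depend on the choice. -/
def grBasis (ο : Type*) [Fintype ο] :
    Module.Basis (Finset (Fin (Module.finrank ℝ (ο → ℝ)))) ℝ (Gr ο) :=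
  (Module.finBasis ℝ (ο → ℝ)).ExteriorAlgebra

/-- The odd generator with index `α`. -/
def gen {ο : Type*} [DecidableEq ο] (α : ο) : Gr ο :=
  ExteriorAlgebra.ι ℝ (Pi.single α 1)

/-- The body (the degree zero part, a real number) of an element of the Grassmann algebra. -/
def body {ο : Type*} (a : Gr ο) : ℝ := ExteriorAlgebra.algebraMapInv a

/-- The soul (the nilpotent part) of an element of the Grassmann algebra. -/
def soul {ο : Type*} (a : Gr ο) : Gr ο := a - algebraMap ℝ (Gr ο) (body a)

/-- The even (`ε = 0`) or odd (`ε = 1`) part of the Grassmann algebra. -/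
def parityPart (ο : Type*) (ε : ZMod 2) : Submodule ℝ (Gr ο) :=
  CliffordAlgebra.evenOdd (0 : QuadraticForm ℝ (ο → ℝ)) ε

/-- The parity automorphism: `a` is sent to `(-1)^ã a` for `a` homogeneous of parity `ã`. -/
def parityAut {ο : Type*} (a : Gr ο) : Gr ο :=
  CliffordAlgebra.involute (Q := (0 : QuadraticForm ℝ (ο → ℝ))) a

/-- The algebra homomorphism of Grassmann algebras that relabels the odd generators along an
injective map of index types: the generator `α` is sent to the generator `φ α`. -/
def relabel {ο ο' : Type*} (φ : ο → ο') : Gr ο →ₐ[ℝ] Gr ο' :=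
  ExteriorAlgebra.map (Function.ExtendByZero.linearMap ℝ φ)

/-- The algebra homomorphism of Grassmann algebras that renames the generators in the range of
an injective map `φ` (the generator `φ α` is sent to the generator `α`) and kills the others. -/
def killRest {ο ο' : Type*} (φ : ο → ο') : Gr ο' →ₐ[ℝ] Gr ο :=
  ExteriorAlgebra.map (LinearMap.funLeft ℝ ℝ φ)

open Classical in
/-- Substitution of the elements `y α` for the odd generators: the algebra homomorphism that
sends the generator `α` to `y α`. It exists whenever all `y α` are odd. -/
def substOdd {ο ο' : Type*} [Fintype ο] (y : ο → Gr ο') : Gr ο →ₐ[ℝ] Gr ο' :=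
  if h : ∀ v : ο → ℝ, Fintype.linearCombination ℝ y v * Fintype.linearCombination ℝ y v = 0 then
    ExteriorAlgebra.lift ℝ ⟨Fintype.linearCombination ℝ y, h⟩
  else (Algebra.ofId ℝ (Gr ο')).comp ExteriorAlgebra.algebraMapInv

/-- The even element `|a|^r`, for an even element `a` with nonzero body: the (finite) Taylor
expansion of the function `u ↦ |u|^r` at the body of `a`. -/
def absPow {ο : Type*} [Fintype ο] (a : Gr ο) (r : ℝ) : Gr ο :=
  ∑ k ∈ Finset.range (Fintype.card ο + 1),
    ((k.factorial : ℝ)⁻¹ * iteratedDeriv k (fun u : ℝ => |u| ^ r) (body a)) • soul a ^ k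

/-- The determinant (Leibniz formula) of a square matrix; used for matrices whose entries
commute with each other. -/
def leibnizDet {R : Type*} [Ring R] {n : ℕ} (A : Matrix (Fin n) (Fin n) R) : R :=
  ∑ σ : Equiv.Perm (Fin n),
    ((Equiv.Perm.sign σ : ℤˣ) : ℤ) • (List.ofFn fun i => A i (σ i)).prod

/-- The Berezinian `det (A - B D⁻¹ C) (det D)⁻¹` of an invertible even supermatrix with
blocks `A` (even-even), `B`, `C`, `D` (odd-odd). -/
def berezinian {R : Type*} [Ring R] {p q : ℕ}
    (A : Matrix (Fin p ⊕ Fin q) (Fin p ⊕ Fin q) R) : R :=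
  leibnizDet (A.toBlocks₁₁ - A.toBlocks₁₂ * Ring.inverse A.toBlocks₂₂ * A.toBlocks₂₁) *
    Ring.inverse (leibnizDet A.toBlocks₂₂)

/-! ## Calculus of superfunctions -/

/-- Superfunctions in even coordinates indexed by `ε` and odd coordinates indexed by `ο`:
Grassmann valued functions of the even coordinates. Smoothness on an open domain is a separate
condition, see `SmoothOn`. -/
abbrev SFun (ε ο : Type*) := (ε → ℝ) → Gr ο

section Calculus

variable {ε ο ε' ο' : Type*} [Fintype ε] [Fintype ο] [DecidableEq ε] [DecidableEq ο]
  [Fintype ε'] [Fintype ο']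

/-- Smoothness of a superfunction on a set. -/
def SmoothOn (f : SFun ε ο) (U : Set (ε → ℝ)) : Prop :=
  ∀ k, ContDiffOn ℝ ∞ (fun x => (grBasis ο).repr (f x) k) U

/-- The partial derivative in an even coordinate. -/
def evenDeriv (i : ε) (f : SFun ε ο) : SFun ε ο := fun x =>
  ∑ k, (fderiv ℝ (fun z => (grBasis ο).repr (f z) k) x (Pi.single i 1)) • grBasis ο k

/-- The left partial derivative in an odd coordinate: the left antiderivation of the Grassmann
algebra that sends the generator `β` to `1` if `β = α` and to `0` otherwise. -/
def oddDeriv (α : ο) (f : SFun ε ο) : SFun ε ο := fun x =>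
  CliffordAlgebra.contractLeft (Q := (0 : QuadraticForm ℝ (ο → ℝ))) (LinearMap.proj α) (f x)

/-- The (left) partial derivative in the coordinate `a`, even or odd. -/
def pderiv (a : ε ⊕ ο) (f : SFun ε ο) : SFun ε ο :=
  Sum.elim (fun i => evenDeriv i f) (fun α => oddDeriv α f) a

/-- The coordinate `a`, even or odd, as a superfunction. -/
def coord (a : ε ⊕ ο) : SFun ε ο :=
  Sum.elim (fun i x => algebraMap ℝ (Gr ο) (x i)) (fun α _ => gen α) a

/-- An iterated partial derivative in even coordinates. -/
def iterDeriv (l : List ε) (f : SFun ε ο) : SFun ε ο := l.foldr evenDeriv f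

/-- The body of a substitution `Y`. -/
def bodyPoint (Y : ε ⊕ ο → SFun ε' ο') (x : ε' → ℝ) : ε → ℝ := fun i => body (Y (Sum.inl i) x)

/-- The pullback `f(Y)` of a superfunction `f` under the substitution of the superfunctions
`Y a` (of the same parity as `a`) for the coordinates `a`. Even superfunctions are substituted
by the (finite) Taylor expansion at their bodies. -/
def pull (Y : ε ⊕ ο → SFun ε' ο') (f : SFun ε ο) : SFun ε' ο' := fun x =>
  ∑ k ∈ Finset.range (Fintype.card ο' + 1), ((k.factorial : ℝ)⁻¹) • ∑ i : Fin k → ε,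
    substOdd (fun α => Y (Sum.inr α) x) (iterDeriv (List.ofFn i) f (bodyPoint Y x)) *
      (List.ofFn fun j => soul (Y (Sum.inl (i j)) x)).prod

end Calculus

/-! ## The odd cotangent bundle

For a superdomain with coordinates `x^a`, `a : ε ⊕ ο`, the odd cotangent bundle has the
coordinates `x^a, x*_a`, where `x*_a` has the parity opposite to that of `x^a`. So its even
coordinates are indexed by `ε ⊕ ο` (`x^a` for even `a`, then `x*_a` for odd `a`) and its odd
coordinates by `ο ⊕ ε` (`x^a` for odd `a`, then `x*_a` for even `a`). -/

section Cotangent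

variable {ε ο : Type*}

/-- The index of the coordinate `x^a` on the odd cotangent bundle. -/
def baseIdx : ε ⊕ ο → (ε ⊕ ο) ⊕ (ο ⊕ ε) :=
  Sum.elim (fun i => Sum.inl (Sum.inl i)) (fun α => Sum.inr (Sum.inl α))

/-- The index of the coordinate `x*_a` on the odd cotangent bundle. -/
def starIdx : ε ⊕ ο → (ε ⊕ ο) ⊕ (ο ⊕ ε) :=
  Sum.elim (fun i => Sum.inr (Sum.inr i)) (fun α => Sum.inl (Sum.inr α))

/-- The inverse image in the odd cotangent bundle of a subset of the base. -/
def cotDomain (B : Set (ε → ℝ)) : Set (ε ⊕ ο → ℝ) := {y | (fun i => y (Sum.inl i)) ∈ B}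

/-- A superfunction on the base as a superfunction on the odd cotangent bundle. -/
def fromBase (f : SFun ε ο) : SFun (ε ⊕ ο) (ο ⊕ ε) := fun y =>
  relabel Sum.inl (f fun i => y (Sum.inl i))

variable [Fintype ε] [Fintype ο] [DecidableEq ε] [DecidableEq ο]

/-- The divergence operator `Δ = ∑ (-1)^ã ∂/∂x^a ∂/∂x*_a`. -/
def oddLaplacian (f : SFun (ε ⊕ ο) (ο ⊕ ε)) : SFun (ε ⊕ ο) (ο ⊕ ε) :=
  (∑ i : ε, pderiv (baseIdx (Sum.inl i)) (pderiv (starIdx (Sum.inl i)) f)) -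
    ∑ α : ο, pderiv (baseIdx (Sum.inr α)) (pderiv (starIdx (Sum.inr α)) f)

/-- The canonical odd bracket: for `f` of parity `f̃`,
`(f, g) = ∑ (-1)^(ã (f̃ + 1)) (∂f/∂x*_a ∂g/∂x^a + (-1)^f̃ ∂f/∂x^a ∂g/∂x*_a)`
(left derivatives), which is `(-1)^f̃` times the Batalin-Vilkovisky antibracket. -/
def oddBracket (f g : SFun (ε ⊕ ο) (ο ⊕ ε)) : SFun (ε ⊕ ο) (ο ⊕ ε) :=
  let f' : SFun (ε ⊕ ο) (ο ⊕ ε) := fun y => parityAut (f y)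
  (∑ i : ε, (pderiv (starIdx (Sum.inl i)) f * pderiv (baseIdx (Sum.inl i)) g +
      pderiv (baseIdx (Sum.inl i)) f' * pderiv (starIdx (Sum.inl i)) g)) -
    ∑ α : ο, (pderiv (starIdx (Sum.inr α)) f' * pderiv (baseIdx (Sum.inr α)) g +
      pderiv (baseIdx (Sum.inr α)) f * pderiv (starIdx (Sum.inr α)) g)

/-- The change of coordinates on the odd cotangent bundle induced by a change of coordinates on
the base. Here `T b` are the new coordinates `x^b` in terms of the old ones `x^a`, and `S a` are
the old ones in terms of the new ones. The fibre coordinates change by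
`x*_b = ∑ (∂x^a/∂x^b) x*_a`. -/
def cotLift (T S : ε ⊕ ο → SFun ε ο) : (ε ⊕ ο) ⊕ (ο ⊕ ε) → SFun (ε ⊕ ο) (ο ⊕ ε) :=
  let star : ε ⊕ ο → SFun (ε ⊕ ο) (ο ⊕ ε) := fun b =>
    ∑ a, fromBase (pull T (pderiv b (S a))) * coord (starIdx a)
  Sum.elim
    (Sum.elim (fun i => fromBase (T (Sum.inl i))) (fun α => star (Sum.inr α)))
    (Sum.elim (fun α => fromBase (T (Sum.inr α))) (fun i => star (Sum.inl i)))

/-- `f`, over the base domain `B`, is a polynomial of degree `r` in the fibre coordinates: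
`f = ∑ c_{a₁ … a_r}(x) x*_{a₁} ⋯ x*_{a_r}`. -/
def IsPolyOfDegree (B : Set (ε → ℝ)) (r : ℕ) (f : SFun (ε ⊕ ο) (ο ⊕ ε)) : Prop :=
  ∃ c : (Fin r → ε ⊕ ο) → SFun ε ο, (∀ a, SmoothOn (c a) B) ∧
    ∀ y ∈ cotDomain B, f y =
      ∑ a : Fin r → ε ⊕ ο,
        fromBase (c a) y * (List.ofFn fun j => coord (starIdx (a j)) y).prod

end Cotangent

/-! ## Linearity of pullbacks -/

section Linearity

variable {ε ο ε' ο' : Type*} [Fintype ε] [Fintype ο] [DecidableEq ε] [DecidableEq ο]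
  [Fintype ε'] [Fintype ο']

theorem SmoothOn.add {f g : SFun ε ο} {U : Set (ε → ℝ)} (hf : SmoothOn f U)
    (hg : SmoothOn g U) : SmoothOn (f + g) U := by
  intro k
  simpa using (hf k).add (hg k)

theorem SmoothOn.smul {f : SFun ε ο} {U : Set (ε → ℝ)} (c : ℝ) (hf : SmoothOn f U) :
    SmoothOn (c • f) U := by
  intro k
  simpa using (contDiffOn_const (c := c)).mul (hf k)

theorem smoothOn_zero (U : Set (ε → ℝ)) : SmoothOn (0 : SFun ε ο) U := by
  intro k
  simpa using contDiffOn_const (c := (0 : ℝ))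

theorem repr_evenDeriv (i : ε) (f : SFun ε ο) (x : ε → ℝ) (k) :
    (grBasis ο).repr (evenDeriv i f x) k =
      fderiv ℝ (fun z => (grBasis ο).repr (f z) k) x (Pi.single i 1) := by
  unfold evenDeriv
  rw [Module.Basis.repr_sum_self]

theorem SmoothOn.evenDeriv {f : SFun ε ο} {U : Set (ε → ℝ)} (hU : IsOpen U)
    (hf : SmoothOn f U) (i : ε) : SmoothOn (evenDeriv i f) U := by
  intro k
  simp only [repr_evenDeriv]
  exact ((hf k).fderiv_of_isOpen hU (m := ∞) (by simp)).clm_apply contDiffOn_const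

theorem SmoothOn.differentiableAt {f : SFun ε ο} {U : Set (ε → ℝ)} (hU : IsOpen U)
    (hf : SmoothOn f U) {x : ε → ℝ} (hx : x ∈ U) (k) :
    DifferentiableAt ℝ (fun z => (grBasis ο).repr (f z) k) x :=
  ((hf k).differentiableOn (by simp)).differentiableAt (hU.mem_nhds hx)

theorem evenDeriv_congr {f g : SFun ε ο} {U : Set (ε → ℝ)} (hU : IsOpen U) (h : EqOn f g U)
    (i : ε) : EqOn (evenDeriv i f) (evenDeriv i g) U := by
  intro x hx
  unfold evenDeriv
  refine Finset.sum_congr rfl fun k _ => ?_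
  congr 2
  refine Filter.EventuallyEq.fderiv_eq ?_
  filter_upwards [hU.mem_nhds hx] with z hz
  rw [h hz]

theorem evenDeriv_add {f g : SFun ε ο} {U : Set (ε → ℝ)} (hU : IsOpen U) (hf : SmoothOn f U)
    (hg : SmoothOn g U) (i : ε) :
    EqOn (evenDeriv i (f + g)) (evenDeriv i f + evenDeriv i g) U := by
  intro x hx
  simp only [evenDeriv, Pi.add_apply, map_add, Finsupp.coe_add, ← Finset.sum_add_distrib,
    ← add_smul]
  refine Finset.sum_congr rfl fun k _ => ?_
  rw [fderiv_fun_add (hf.differentiableAt hU hx k) (hg.differentiableAt hU hx k)]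
  rfl

theorem evenDeriv_smul {f : SFun ε ο} {U : Set (ε → ℝ)} (hU : IsOpen U) (hf : SmoothOn f U)
    (c : ℝ) (i : ε) : EqOn (evenDeriv i (c • f)) (c • evenDeriv i f) U := by
  intro x hx
  simp only [evenDeriv, Pi.smul_apply, map_smul, Finsupp.coe_smul, Finset.smul_sum, smul_smul]
  refine Finset.sum_congr rfl fun k _ => ?_
  simp only [smul_eq_mul]
  rw [fderiv_const_mul (hf.differentiableAt hU hx k)]
  rfl

theorem SmoothOn.iterDeriv {f : SFun ε ο} {U : Set (ε → ℝ)} (hU : IsOpen U)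
    (hf : SmoothOn f U) (l : List ε) : SmoothOn (iterDeriv l f) U := by
  induction l with
  | nil => exact hf
  | cons i l ih => exact ih.evenDeriv hU i

theorem iterDeriv_add {f g : SFun ε ο} {U : Set (ε → ℝ)} (hU : IsOpen U) (hf : SmoothOn f U)
    (hg : SmoothOn g U) (l : List ε) :
    EqOn (iterDeriv l (f + g)) (iterDeriv l f + iterDeriv l g) U := by
  induction l with
  | nil => exact fun _ _ => rfl
  | cons i l ih =>
    exact (evenDeriv_congr hU ih i).trans
      (evenDeriv_add hU (hf.iterDeriv hU l) (hg.iterDeriv hU l) i)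

theorem iterDeriv_smul {f : SFun ε ο} {U : Set (ε → ℝ)} (hU : IsOpen U) (hf : SmoothOn f U)
    (c : ℝ) (l : List ε) : EqOn (iterDeriv l (c • f)) (c • iterDeriv l f) U := by
  induction l with
  | nil => exact fun _ _ => rfl
  | cons i l ih =>
    exact (evenDeriv_congr hU ih i).trans (evenDeriv_smul hU (hf.iterDeriv hU l) c i)

theorem pull_add {f g : SFun ε ο} {U : Set (ε → ℝ)} (hU : IsOpen U) (hf : SmoothOn f U)
    (hg : SmoothOn g U) (Y : ε ⊕ ο → SFun ε' ο') {x : ε' → ℝ} (hx : bodyPoint Y x ∈ U) :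
    pull Y (f + g) x = pull Y f x + pull Y g x := by
  simp only [pull]
  simp_rw [fun l => iterDeriv_add hU hf hg l hx, Pi.add_apply, map_add, add_mul,
    Finset.sum_add_distrib, smul_add, Finset.sum_add_distrib]

theorem pull_smul {f : SFun ε ο} {U : Set (ε → ℝ)} (hU : IsOpen U) (hf : SmoothOn f U)
    (c : ℝ) (Y : ε ⊕ ο → SFun ε' ο') {x : ε' → ℝ} (hx : bodyPoint Y x ∈ U) :
    pull Y (c • f) x = c • pull Y f x := by
  simp only [pull]
  simp_rw [fun l => iterDeriv_smul hU hf c l hx, Pi.smul_apply, map_smul, smul_mul_assoc,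
    ← Finset.smul_sum, smul_comm _ c, ← Finset.smul_sum]

theorem evenDeriv_zero (i : ε) : evenDeriv i (0 : SFun ε ο) = 0 := by
  funext x
  simp [evenDeriv]

theorem iterDeriv_zero (l : List ε) : iterDeriv l (0 : SFun ε ο) = 0 := by
  induction l with
  | nil => rfl
  | cons i l ih => exact (congrArg (evenDeriv i) ih).trans (evenDeriv_zero i)

theorem pull_zero (Y : ε ⊕ ο → SFun ε' ο') : pull Y (0 : SFun ε ο) = 0 := by
  funext x
  simp [pull, iterDeriv_zero]

theorem isOpen_cotDomain {B : Set (ε → ℝ)} (hB : IsOpen B) :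
    IsOpen (cotDomain B : Set (ε ⊕ ο → ℝ)) :=
  hB.preimage (by fun_prop)

/-- Functions on the odd cotangent bundle of a space glued from coordinate domains `B i` along
the changes of coordinates `T i j` (the coordinates of chart `j` in terms of those of chart `i`)
over the overlaps `O i j`, twisted by the factors `g i j`: families of smooth superfunctions
`s i` of the coordinates of the odd cotangent bundle over `B i` (continued by `0` outside their
domain, so that a family is determined by its functions on the coordinate domains) such that
`s i = g i j * s j` on overlaps, after the change of coordinates. For an actual change of
coordinates its body maps overlaps into `B j`, so that the second condition on `y` below always
holds. -/
def cotSections {I : Type*} (B : I → Set (ε → ℝ)) (hB : ∀ i, IsOpen (B i))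
    (O : I → I → Set (ε → ℝ)) (T : I → I → ε ⊕ ο → SFun ε ο) (g : I → I → SFun ε ο) :
    Submodule ℝ (I → SFun (ε ⊕ ο) (ο ⊕ ε)) where
  carrier := {s | (∀ i, ∀ y ∉ cotDomain (B i), s i y = 0) ∧
    (∀ i, SmoothOn (s i) (cotDomain (B i))) ∧
    ∀ i j, ∀ y ∈ cotDomain (O i j), bodyPoint (cotLift (T i j) (T j i)) y ∈ cotDomain (B j) →
      s i y = fromBase (g i j) y * pull (cotLift (T i j) (T j i)) (s j) y}
  add_mem' := by
    rintro s u ⟨h1, h2, h3⟩ ⟨k1, k2, k3⟩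
    refine ⟨fun i y hy => ?_, fun i => (h2 i).add (k2 i), fun i j y hy hb => ?_⟩
    · simp [h1 i y hy, k1 i y hy]
    · simp only [Pi.add_apply]
      rw [h3 i j y hy hb, k3 i j y hy hb,
        pull_add (isOpen_cotDomain (hB j)) (h2 j) (k2 j) _ hb, mul_add]
  zero_mem' := by
    refine ⟨fun _ _ _ => rfl, fun _ => smoothOn_zero _, fun i j y _ _ => ?_⟩
    simp only [Pi.zero_apply, pull_zero, mul_zero]
  smul_mem' := by
    rintro c s ⟨h1, h2, h3⟩
    refine ⟨fun i y hy => ?_, fun i => (h2 i).smul c, fun i j y hy hb => ?_⟩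
    · simp [h1 i y hy]
    · simp only [Pi.smul_apply]
      rw [h3 i j y hy hb, pull_smul (isOpen_cotDomain (hB j)) (h2 j) c _ hb, mul_smul_comm]

end Linearity

/-! ## Supermanifolds -/

/-- A supermanifold of dimension `p|q` with body `X`, given by an atlas indexed by `I`: a
supermanifold glued from superdomains. -/
structure Supermanifold (p q : ℕ) (X : Type*) [TopologicalSpace X] (I : Type*) where
  /-- The charts of the body. -/
  chart : I → OpenPartialHomeomorph X (Fin p → ℝ)
  cover : ∀ x : X, ∃ i, x ∈ (chart i).source
  /-- `trans i j b` is the coordinate `b` of chart `j` as a superfunction of the coordinates of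
  chart `i`, on the overlap of the charts. -/
  trans : I → I → Fin p ⊕ Fin q → SFun (Fin p) (Fin q)
  trans_smooth : ∀ i j b, SmoothOn (trans i j b) ((chart i).symm.trans (chart j)).source
  trans_even : ∀ i j a, ∀ x ∈ ((chart i).symm.trans (chart j)).source,
    trans i j (Sum.inl a) x ∈ parityPart (Fin q) 0
  trans_odd : ∀ i j α, ∀ x ∈ ((chart i).symm.trans (chart j)).source,
    trans i j (Sum.inr α) x ∈ parityPart (Fin q) 1
  trans_body : ∀ i j, ∀ x ∈ ((chart i).symm.trans (chart j)).source,
    bodyPoint (trans i j) x = chart j ((chart i).symm x)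
  trans_self : ∀ i b, ∀ x ∈ (chart i).target, trans i i b x = coord b x
  trans_comp : ∀ i j k b, ∀ x ∈ ((chart i).symm.trans (chart j)).source,
    x ∈ ((chart i).symm.trans (chart k)).source →
      trans i k b x = pull (trans i j) (trans j k b) x

namespace Supermanifold

variable {p q : ℕ} {X : Type*} [TopologicalSpace X] {I : Type*}

/-- The overlap of the charts `i` and `j`, in the coordinates of chart `i`. -/
def overlap (M : Supermanifold p q X I) (i j : I) : Set (Fin p → ℝ) :=
  ((M.chart i).symm.trans (M.chart j)).source

/-- The Jacobian `Dx_j / Dx_i = Ber (∂x_j^b / ∂x_i^a)` of the change of coordinates from chart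
`i` to chart `j`. -/
def jacobian (M : Supermanifold p q X I) (i j : I) : SFun (Fin p) (Fin q) := fun x =>
  berezinian (Matrix.of fun a b => pderiv a (M.trans i j b) x)

/-- The space `C^∞(ΠT*M) ⊗ F^w(M)` of functions on the odd cotangent bundle with values in
densities of weight `w`: an element is given in chart `i` by `s_i |Dx_i|^w`, where
`|Dx_j| = |Dx_j / Dx_i| |Dx_i|`. For `w = 0` this is `C^∞(ΠT*M)`. -/
def densFun (M : Supermanifold p q X I) (w : ℝ) :
    Submodule ℝ (I → SFun (Fin p ⊕ Fin q) (Fin q ⊕ Fin p)) :=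
  cotSections (fun i => (M.chart i).target) (fun i => (M.chart i).open_target)
    M.overlap M.trans (fun i j x => absPow (M.jacobian i j x) w)

/-! The space `M̂` of the algebra of densities has, over chart `i`, the even coordinates indexed
by `Option (Fin p)`, where `none` is the index of the coordinate `t_i > 0` that represents
`|Dx_i|`, and the odd coordinates indexed by `Fin q`. -/

/-- The coordinate domain of `M̂` over a domain `B` of `M`: the even coordinate `t` is
positive. -/
def hatSet (B : Set (Fin p → ℝ)) : Set (Option (Fin p) → ℝ) :=
  {z | (fun a => z (some a)) ∈ B ∧ 0 < z none}

theorem isOpen_hatSet {B : Set (Fin p → ℝ)} (hB : IsOpen B) : IsOpen (hatSet B) :=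
  (hB.preimage (f := fun (z : Option (Fin p) → ℝ) a => z (some a)) (by fun_prop)).inter
    (isOpen_lt continuous_const (continuous_apply none))

/-- The changes of coordinates of `M̂`: those of `M`, and `t_j = |Dx_j / Dx_i| t_i`. -/
def hatTrans (M : Supermanifold p q X I) (i j : I) :
    Option (Fin p) ⊕ Fin q → SFun (Option (Fin p)) (Fin q) :=
  Sum.elim
    (fun b z => b.elim (z none • absPow (M.jacobian i j fun a => z (some a)) 1)
      fun b => M.trans i j (Sum.inl b) fun a => z (some a))
    (fun β z => M.trans i j (Sum.inr β) fun a => z (some a))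

/-- The domain of the coordinates `x, t, x̂*, t*` of `ΠT*M̂` over chart `i`. -/
def hatDomain (M : Supermanifold p q X I) (i : I) : Set (Option (Fin p) ⊕ Fin q → ℝ) :=
  cotDomain (hatSet (M.chart i).target)

/-- All smooth functions on `ΠT*M̂`, with arbitrary smooth dependence on `t`. -/
def hatSmooth (M : Supermanifold p q X I) :
    Submodule ℝ (I → SFun (Option (Fin p) ⊕ Fin q) (Fin q ⊕ Option (Fin p))) :=
  cotSections (fun i => hatSet (M.chart i).target)
    (fun i => isOpen_hatSet (M.chart i).open_target)
    (fun i j => hatSet (M.overlap i j)) M.hatTrans (fun _ _ _ => 1)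

/-- The index of the coordinate `t`. -/
def tIdx : Option (Fin p) ⊕ Fin q := Sum.inl none

/-- The weight operator `t ∂/∂t - t* ∂/∂t*` (`t` has weight `1` and `t*` weight `-1`). -/
def weightOp (F : SFun (Option (Fin p) ⊕ Fin q) (Fin q ⊕ Option (Fin p))) :
    SFun (Option (Fin p) ⊕ Fin q) (Fin q ⊕ Option (Fin p)) :=
  coord (baseIdx tIdx) * pderiv (baseIdx tIdx) F - coord (starIdx tIdx) * pderiv (starIdx tIdx) F

/-- The functions of weight `w` on `ΠT*M̂`. -/
def hatWeight (M : Supermanifold p q X I) (w : ℝ) :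
    Submodule ℝ (I → SFun (Option (Fin p) ⊕ Fin q) (Fin q ⊕ Option (Fin p))) where
  carrier := {F | F ∈ M.hatSmooth ∧ ∀ i, ∀ y ∈ M.hatDomain i, weightOp (F i) y = w • F i y}
  add_mem' := by
    rintro F G ⟨hF, hF'⟩ ⟨hG, hG'⟩
    refine ⟨add_mem hF hG, fun i y hy => ?_⟩
    have h := evenDeriv_add
      (isOpen_cotDomain (ο := Fin q) (isOpen_hatSet (M.chart i).open_target)) (hF.2.1 i)
      (hG.2.1 i) (Sum.inl none) hy
    have e : weightOp (F i + G i) y = weightOp (F i) y + weightOp (G i) y := by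
      simp only [weightOp, pderiv, baseIdx, starIdx, tIdx, Sum.elim_inl, Sum.elim_inr,
        Pi.sub_apply, Pi.mul_apply, h, Pi.add_apply, oddDeriv, map_add, mul_add]
      abel
    simp only [Pi.add_apply]
    rw [e, hF' i y hy, hG' i y hy, smul_add]
  zero_mem' := by
    refine ⟨zero_mem _, fun i y _ => ?_⟩
    simp [weightOp, pderiv, baseIdx, starIdx, tIdx, evenDeriv_zero, oddDeriv]
  smul_mem' := by
    rintro c F ⟨hF, hF'⟩
    refine ⟨Submodule.smul_mem _ c hF, fun i y hy => ?_⟩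
    have h := evenDeriv_smul
      (isOpen_cotDomain (ο := Fin q) (isOpen_hatSet (M.chart i).open_target)) (hF.2.1 i)
      c (Sum.inl none) hy
    have e : weightOp (c • F i) y = c • weightOp (F i) y := by
      simp only [weightOp, pderiv, baseIdx, starIdx, tIdx, Sum.elim_inl, Sum.elim_inr,
        Pi.sub_apply, Pi.mul_apply, h, Pi.smul_apply, oddDeriv, map_smul, mul_smul_comm,
        smul_sub]
    simp only [Pi.smul_apply]
    rw [e, hF' i y hy, smul_comm]

/-- The space `C^∞(ΠT*M̂)`: finite sums of functions of (real) weights on `ΠT*M̂`, that is,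
functions of the form `∑ f_w(x, x̂*, w*) t^w` with finitely many terms. -/
def hatFun (M : Supermanifold p q X I) :
    Submodule ℝ (I → SFun (Option (Fin p) ⊕ Fin q) (Fin q ⊕ Option (Fin p))) :=
  ⨆ w : ℝ, M.hatWeight w

/-- The point `(x, x*)` of `ΠT*M` below the point `(x, t, x̂*)` (even coordinates). -/
def below (y : Option (Fin p) ⊕ Fin q → ℝ) : Fin p ⊕ Fin q → ℝ := fun a => y (Sum.map some id a)

/-- The coordinate expression `s(x, x̂*)` on `ΠT*M̂` of a superfunction `s(x, x*)` on `ΠT*M`. -/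
def hatSubst (s : SFun (Fin p ⊕ Fin q) (Fin q ⊕ Fin p)) :
    SFun (Option (Fin p) ⊕ Fin q) (Fin q ⊕ Option (Fin p)) := fun y =>
  relabel (Sum.map id some) (s (below y))

/-- The function `t^w` on `ΠT*M̂`. -/
def tPow (w : ℝ) : SFun (Option (Fin p) ⊕ Fin q) (Fin q ⊕ Option (Fin p)) := fun y =>
  algebraMap ℝ _ (y (Sum.inl none) ^ w)

/-- The odd function `w* = t t*` on `ΠT*M̂`. -/
def wStar : SFun (Option (Fin p) ⊕ Fin q) (Fin q ⊕ Option (Fin p)) :=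
  coord (baseIdx tIdx) * coord (starIdx tIdx)

/-- The superfunction `s(x, x̂*) t^w + (1 - w)⁻¹ w* t^w (Δ s)(x, x̂*)` on `ΠT*M̂`, in
coordinates. -/
def localLift (w : ℝ) (s : SFun (Fin p ⊕ Fin q) (Fin q ⊕ Fin p)) :
    SFun (Option (Fin p) ⊕ Fin q) (Fin q ⊕ Option (Fin p)) :=
  hatSubst s * tPow w + (1 / (1 - w)) • (wStar * tPow w * hatSubst (oddLaplacian s))

/-- `F` lies over the element `s |Dx|^w` of `C^∞(ΠT*M) ⊗ F^w(M)`, that is, the canonical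
projection from `C^∞(ΠT*M̂)` to `C^∞(ΠT*M) ⊗ F(M)`, which is `t* ↦ 0` in coordinates, maps `F`
to it. -/
def LiesOver (M : Supermanifold p q X I) (w : ℝ)
    (F : I → SFun (Option (Fin p) ⊕ Fin q) (Fin q ⊕ Option (Fin p)))
    (s : I → SFun (Fin p ⊕ Fin q) (Fin q ⊕ Fin p)) : Prop :=
  ∀ i, ∀ y ∈ M.hatDomain i,
    killRest (Sum.map id some) (F i y) = y (Sum.inl none) ^ w • s i (below y)

/-- The operator `δ = ρ⁻¹ Δ ρ` of the canonical volume form `ρ = t⁻² |D(x,t)|` of `M̂`, in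
coordinates. -/
def delta (F : SFun (Option (Fin p) ⊕ Fin q) (Fin q ⊕ Option (Fin p))) :
    SFun (Option (Fin p) ⊕ Fin q) (Fin q ⊕ Option (Fin p)) :=
  tPow 2 * oddLaplacian (tPow (-2) * F)

/-- The canonical odd bracket of two functions on `ΠT*M`, given by their coordinate
expressions. -/
def bracket (M : Supermanifold p q X I) (s u : I → SFun (Fin p ⊕ Fin q) (Fin q ⊕ Fin p)) :
    I → SFun (Fin p ⊕ Fin q) (Fin q ⊕ Fin p) := fun i =>
  (cotDomain (M.chart i).target).indicator (oddBracket (s i) (u i))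

/-- The canonical odd bracket of two functions on `ΠT*M̂`, given by their coordinate
expressions. -/
def hatBracket (M : Supermanifold p q X I)
    (F G : I → SFun (Option (Fin p) ⊕ Fin q) (Fin q ⊕ Option (Fin p))) :
    I → SFun (Option (Fin p) ⊕ Fin q) (Fin q ⊕ Option (Fin p)) := fun i =>
  (M.hatDomain i).indicator (oddBracket (F i) (G i))

end Supermanifold

end SuperGeom

end

noncomputable section

namespace SuperGeom

/-! ## Supercommutative algebras -/

/-! Since `w*` is odd, its square is zero, and an element of weight λ is locally h₀t^λ + w*t^λh₁. On
such elements δ acts by δ(h₀t^λ + w*t^λh₁) = (Δh₀ + (λ-1)h₁)t^λ - w*t^λΔh₁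
(`IsHatForm.dlt_hatForm`). If h₀ = s, then δ-closedness forces h₁ = Δs/(1-λ), and the second
component then vanishes because Δ² = 0 (`lap_lap`). So for λ ≠ 1 each chart has exactly one δ-closed
element of weight λ over s (`del_lft`, `eq_of_proj_eq`).

Independence of coordinates is a consequence of this uniqueness. The weight operator
(`Change.wt_Ψ`), the projection (`Change.proj_hat_Ψ_lft`) and δ (`Change.del_Ψ`) are compatible with
changes of coordinates, so a transformed lift satisfies the characterization of the lift in the
other chart (`Change.hat_Ψ_lft`).

The substantial point is the invariance of δ. When Δ is transported by a lifted change of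
coordinates, the terms of second order in the fibre derivatives cancel: the second derivatives of
the coordinates supercommute, while the fibre derivatives supercommute with shifted parities
(`lap_comp`). What remains is a first order operator whose coefficients are the Laplacians of the
new fibre coordinates. By the Liouville formula for Berezinians these are logarithmic derivatives of
the Jacobian (`Change.sum_der_G`). On the space of densities each of them occurs twice, once from
the base and once from `t`, and the term -2t⁻¹∂/∂t* of δ removes exactly this
(`Change.del_star_emb`).

The bracket measures the failure of Δ, and equally of δ, to be a derivation (`lap_mul_sub`,
`del_mul_sub`). For δ-closed factors it is therefore δ of their product, and this is again a lift
(`del_lft_mul`).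

The calculations take place in the supercommutative algebra `Sm` of smooth superfunctions on an open
set. Substitution is a Taylor expansion that terminates because souls are nilpotent; it is an
algebra homomorphism (`Subst.toHom`) satisfying the chain rule (`Subst.der_toHom`). -/

/-- The sign `(-1)^d`. -/
def sg (d : ZMod 2) : ℝ := if d = 0 then 1 else -1

theorem eq_zero_or_eq_one (d : ZMod 2) : d = 0 ∨ d = 1 := by
  revert d
  decide

@[simp] theorem sg_zero : sg 0 = 1 := by simp [sg]

@[simp] theorem sg_one : sg 1 = -1 := by simp [sg]

theorem sg_add (d e : ZMod 2) : sg (d + e) = sg d * sg e := by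
  rcases eq_zero_or_eq_one d with rfl | rfl <;> rcases eq_zero_or_eq_one e with rfl | rfl <;>
    simp [sg, show (1 + 1 : ZMod 2) = 0 by decide]

@[simp] theorem sg_mul_self (d : ZMod 2) : sg d * sg d = 1 := by
  rw [← sg_add, CharTwo.add_self_eq_zero, sg_zero]

/-- A real supercommutative algebra, with its parity involution. -/
class SuperRing (R : Type*) [Ring R] [Algebra ℝ R] where
  inv : R →ₐ[ℝ] R
  inv_inv : ∀ x, inv (inv x) = x
  even_comm : ∀ {x : R}, inv x = x → ∀ y, x * y = y * x
  odd_comm : ∀ {x : R}, inv x = -x → ∀ y, y * x = x * inv y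

section SuperRing

variable {R : Type*} [Ring R] [Algebra ℝ R] [SuperRing R]

/-- `x` is homogeneous of parity `d`. -/
def Hom (d : ZMod 2) (x : R) : Prop := SuperRing.inv x = sg d • x

theorem hom_zero_iff {x : R} : Hom 0 x ↔ SuperRing.inv x = x := by simp [Hom]

theorem hom_one_iff {x : R} : Hom 1 x ↔ SuperRing.inv x = -x := by simp [Hom]

theorem Hom.one : Hom 0 (1 : R) := by simp [Hom]

theorem Hom.add {d : ZMod 2} {x y : R} (hx : Hom d x) (hy : Hom d y) : Hom d (x + y) := by
  simp only [Hom] at *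
  rw [map_add, hx, hy, smul_add]

theorem Hom.smul {d : ZMod 2} {x : R} (c : ℝ) (hx : Hom d x) : Hom d (c • x) := by
  simp only [Hom] at *
  rw [map_smul, hx, smul_comm]

theorem Hom.neg {d : ZMod 2} {x : R} (hx : Hom d x) : Hom d (-x) := by
  simpa using hx.smul (-1)

theorem Hom.sub {d : ZMod 2} {x y : R} (hx : Hom d x) (hy : Hom d y) : Hom d (x - y) := by
  simpa [sub_eq_add_neg] using hx.add hy.neg

theorem Hom.sum {d : ZMod 2} {ι : Type*} (s : Finset ι) {f : ι → R} (h : ∀ i ∈ s, Hom d (f i)) :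
    Hom d (∑ i ∈ s, f i) := by
  simp only [Hom] at *
  rw [map_sum, Finset.smul_sum]
  exact Finset.sum_congr rfl h

theorem Hom.mul {d e : ZMod 2} {x y : R} (hx : Hom d x) (hy : Hom e y) :
    Hom (d + e) (x * y) := by
  simp only [Hom] at *
  rw [map_mul, hx, hy, smul_mul_smul_comm, sg_add]

theorem Hom.cast {d e : ZMod 2} {x : R} (hx : Hom d x) (h : d = e) : Hom e x := h ▸ hx

theorem Hom.comm {d e : ZMod 2} {x y : R} (hx : Hom d x) (hy : Hom e y) :
    x * y = sg (d * e) • (y * x) := by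
  rcases eq_zero_or_eq_one d with rfl | rfl
  · simp [SuperRing.even_comm (hom_zero_iff.1 hx)]
  · have h := SuperRing.odd_comm (hom_one_iff.1 hx) y
    rw [h, hy, mul_smul_comm, smul_smul, one_mul, sg_mul_self, one_smul]

/-- The halves of x ± inv x are the even and odd parts of x. This extends identities whose signs are
only defined for homogeneous elements to arbitrary ones. -/
theorem hom_induction {C : R → Prop} (hadd : ∀ x y, C x → C y → C (x + y))
    (hhom : ∀ d x, Hom d x → C x) (x : R) : C x := by
  have h : x = (1 / 2 : ℝ) • (x + SuperRing.inv x) + (1 / 2 : ℝ) • (x - SuperRing.inv x) := by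
    module
  rw [h]
  refine hadd _ _ (hhom 0 _ ?_) (hhom 1 _ ?_)
  · simp [Hom, SuperRing.inv_inv, add_comm]
  · simp only [Hom, map_smul, map_sub, SuperRing.inv_inv, sg_one]
    module

/-- `D` is a (left) superderivation of parity `d`. -/
structure IsSDer (d : ZMod 2) (D : R →ₗ[ℝ] R) : Prop where
  leib : ∀ {e : ZMod 2} {x : R}, Hom e x → ∀ y, D (x * y) = D x * y + sg (d * e) • (x * D y)
  inv : ∀ x, SuperRing.inv (D x) = sg d • D (SuperRing.inv x)

theorem IsSDer.hom {d : ZMod 2} {D : R →ₗ[ℝ] R} (hD : IsSDer d D) {e : ZMod 2} {x : R}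
    (hx : Hom e x) : Hom (d + e) (D x) := by
  simp only [Hom]
  rw [hD.inv, hx, map_smul, smul_smul, sg_add]

theorem IsSDer.one {d : ZMod 2} {D : R →ₗ[ℝ] R} (hD : IsSDer d D) : D 1 = 0 := by
  have := hD.leib (Hom.one (R := R)) 1
  simpa using this

theorem IsSDer.algebraMap {d : ZMod 2} {D : R →ₗ[ℝ] R} (hD : IsSDer d D) (c : ℝ) :
    D (algebraMap ℝ R c) = 0 := by
  rw [Algebra.algebraMap_eq_smul_one, map_smul, hD.one, smul_zero]

end SuperRing

/-- A homomorphism of supercommutative algebras. -/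
def IsSHom {R R' : Type*} [Ring R] [Algebra ℝ R] [SuperRing R] [Ring R'] [Algebra ℝ R']
    [SuperRing R'] (Φ : R' →ₐ[ℝ] R) : Prop :=
  ∀ x, SuperRing.inv (Φ x) = Φ (SuperRing.inv x)

theorem IsSHom.hom {R R' : Type*} [Ring R] [Algebra ℝ R] [SuperRing R] [Ring R'] [Algebra ℝ R']
    [SuperRing R'] {Φ : R' →ₐ[ℝ] R} (hΦ : IsSHom Φ) {d : ZMod 2} {x : R'} (hx : Hom d x) :
    Hom d (Φ x) := by
  simp only [Hom]
  rw [hΦ, hx, map_smul]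

/-! ## The odd Laplacian on an abstract odd cotangent bundle -/

section Laplacian

variable {R : Type*} [Ring R] [Algebra ℝ R] [SuperRing R] {ι : Type*} [Fintype ι]
  {par : ι → ZMod 2} {D Ds : ι → R →ₗ[ℝ] R}

/-- Partial derivatives `D a` of parity `par a` and `Ds a` of parity `par a + 1` that
supercommute. -/
structure IsCotDer (par : ι → ZMod 2) (D Ds : ι → R →ₗ[ℝ] R) : Prop where
  base : ∀ a, IsSDer (par a) (D a)
  star : ∀ a, IsSDer (par a + 1) (Ds a)
  base_base : ∀ a b x, D a (D b x) = sg (par a * par b) • D b (D a x)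
  star_star : ∀ a b x, Ds a (Ds b x) = sg ((par a + 1) * (par b + 1)) • Ds b (Ds a x)
  base_star : ∀ a b x, D a (Ds b x) = sg (par a * (par b + 1)) • Ds b (D a x)

/-- The divergence operator. -/
def lap (par : ι → ZMod 2) (D Ds : ι → R →ₗ[ℝ] R) : R →ₗ[ℝ] R :=
  ∑ a, sg (par a) • (D a ∘ₗ Ds a)

theorem lap_apply (x : R) : lap par D Ds x = ∑ a, sg (par a) • D a (Ds a x) := by
  simp [lap, LinearMap.sum_apply]

/-- The canonical odd bracket of an element `f` of parity `e` with `g`. -/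
def brk (par : ι → ZMod 2) (D Ds : ι → R →ₗ[ℝ] R) (e : ZMod 2) (f g : R) : R :=
  ∑ a, sg (par a * (e + 1)) • (Ds a f * D a g + sg e • (D a f * Ds a g))

/-- Of the four products produced by two derivations, two carry both derivatives on one factor; the
two mixed ones are the bracket. What is left is a comparison of signs in the four parity cases. -/
theorem lap_mul (h : IsCotDer par D Ds) {e : ZMod 2} {f : R} (hf : Hom e f) (g : R) :
    lap par D Ds (f * g) =
      lap par D Ds f * g + sg e • (f * lap par D Ds g) + brk par D Ds e f g := by
  simp only [lap_apply, brk, Finset.sum_mul, Finset.mul_sum, Finset.smul_sum,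
    ← Finset.sum_add_distrib]
  refine Finset.sum_congr rfl fun a _ => ?_
  rw [(h.star a).leib hf, map_add, map_smul, (h.base a).leib ((h.star a).hom hf),
    (h.base a).leib hf]
  generalize par a = k
  simp only [smul_add, smul_smul, smul_mul_assoc, mul_smul_comm, ← sg_add]
  rcases eq_zero_or_eq_one k with rfl | rfl <;> rcases eq_zero_or_eq_one e with rfl | rfl <;>
    simp [show (1 + 1 : ZMod 2) = 0 by decide] <;> abel

theorem lap_inv (h : IsCotDer par D Ds) (f : R) :
    SuperRing.inv (lap par D Ds f) = - lap par D Ds (SuperRing.inv f) := by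
  simp only [lap_apply, map_sum, map_smul, (h.base _).inv, (h.star _).inv, ← Finset.sum_neg_distrib]
  refine Finset.sum_congr rfl fun a _ => ?_
  simp [smul_smul, sg_add]

theorem lap_hom (h : IsCotDer par D Ds) {e : ZMod 2} {f : R} (hf : Hom e f) :
    Hom (e + 1) (lap par D Ds f) := by
  simp only [Hom]
  rw [lap_inv h, hf, map_smul, sg_add]
  simp

theorem eq_zero_of_eq_neg {M : Type*} [AddCommGroup M] [Module ℝ M] {x : M} (h : x = -x) :
    x = 0 := by
  have h2 : x = (1 / 2 : ℝ) • (x - -x) := by module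
  rw [h2, ← h, sub_self, smul_zero]

/-- The operators `D a ∘ Ds a` are odd and anticommute with each other, so the double sum equals its
own negative after interchanging the indices. -/
theorem lap_lap (h : IsCotDer par D Ds) (f : R) : lap par D Ds (lap par D Ds f) = 0 := by
  simp only [lap_apply, map_sum, map_smul, Finset.smul_sum, smul_smul]
  have key : ∀ a b, (sg (par a) * sg (par b)) • D a (Ds a (D b (Ds b f))) =
      -((sg (par b) * sg (par a)) • D b (Ds b (D a (Ds a f)))) := by
    intro a b
    have e1 : Ds a (D b (Ds b f)) = sg (par b * (par a + 1)) • D b (Ds a (Ds b f)) := by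
      rw [h.base_star b a, smul_smul, sg_mul_self, one_smul]
    have e2 : Ds b (D a (Ds a f)) = sg (par a * (par b + 1)) • D a (Ds b (Ds a f)) := by
      rw [h.base_star a b, smul_smul, sg_mul_self, one_smul]
    rw [e1, e2, h.star_star a b]
    simp only [map_smul]
    rw [h.base_base a b, ← neg_smul]
    simp only [smul_smul]
    congr 1
    generalize par a = k
    generalize par b = l
    rcases eq_zero_or_eq_one k with rfl | rfl <;> rcases eq_zero_or_eq_one l with rfl | rfl <;>
    simp [show (1 + 1 : ZMod 2) = 0 by decide]
  have hs := Finset.sum_comm (s := Finset.univ) (t := Finset.univ)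
    (f := fun a b => (sg (par a) * sg (par b)) • D a (Ds a (D b (Ds b f))))
  have h2 : ∑ a, ∑ b, (sg (par a) * sg (par b)) • D a (Ds a (D b (Ds b f))) =
      -∑ a, ∑ b, (sg (par a) * sg (par b)) • D a (Ds a (D b (Ds b f))) := by
    conv_lhs => enter [2, a, 2, b]; rw [key a b]
    simp only [Finset.sum_neg_distrib]
    rw [← hs]
  rw [Finset.sum_comm]
  refine Eq.trans ?_ (eq_zero_of_eq_neg h2)
  exact Finset.sum_congr rfl fun a _ => Finset.sum_congr rfl fun b _ => by rw [mul_comm]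

end Laplacian

/-! ### The odd Laplacian under a change of coordinates -/

section Invariance

variable {R R' R₀ R₀' : Type*} [Ring R] [Algebra ℝ R] [SuperRing R]
  [Ring R'] [Algebra ℝ R'] [SuperRing R'] {ι : Type*} [Fintype ι] [DecidableEq ι]
  {D' Ds' : ι → R' →ₗ[ℝ] R'} {par : ι → ZMod 2} {D Ds : ι → R →ₗ[ℝ] R}

/-- The behaviour of the odd Laplacian under a homomorphism `Φ` that satisfies the chain rule
for new base coordinates `T b` and new fibre coordinates `∑ a, G b a * xs a`. The matrix
`H b c d` of derivatives of `G` along the new base coordinates is symmetric in `b`, `c`. -/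
theorem lap_comp (h : IsCotDer par D Ds) (h' : IsCotDer par D' Ds') {Φ : R' →ₐ[ℝ] R}
    {T xs : ι → R} {G : ι → ι → R} {H : ι → ι → ι → R}
    (hG : ∀ b a, Hom (par b + par a) (G b a))
    (hDsT : ∀ a b, Ds a (T b) = 0) (hDsG : ∀ a b c, Ds a (G b c) = 0)
    (hDx : ∀ a b, D a (xs b) = 0) (hDsx : ∀ a b, Ds a (xs b) = if a = b then 1 else 0)
    (hGT : ∀ b c, ∑ a, G b a * D a (T c) = if b = c then 1 else 0)
    (hGG : ∀ b c d, ∑ a, G b a * D a (G c d) = H b c d)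
    (hH : ∀ b c d, H b c d = sg (par b * par c) • H c b d)
    (hD : ∀ a f, D a (Φ f) = ∑ b, D a (T b) * Φ (D' b f) +
      ∑ b, D a (∑ c, G b c * xs c) * Φ (Ds' b f))
    (hDs : ∀ a f, Ds a (Φ f) = ∑ b, Ds a (T b) * Φ (D' b f) +
      ∑ b, Ds a (∑ c, G b c * xs c) * Φ (Ds' b f)) (f : R') :
    lap par D Ds (Φ f) = Φ (lap par D' Ds' f) +
      ∑ b, lap par D Ds (∑ c, G b c * xs c) * Φ (Ds' b f) := by
  -- The new fibre coordinates are linear in the old ones, so only the coefficient survives, with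
  -- the sign of moving `Ds a` past it.
  have hDsY : ∀ a b, Ds a (∑ c, G b c * xs c) = sg ((par a + 1) * (par b + par a)) • G b a := by
    intro a b
    rw [map_sum, Finset.sum_eq_single a]
    · rw [(h.star a).leib (hG b a), hDsG, hDsx, if_pos rfl, zero_mul, zero_add, mul_one]
    · intro c _ hc
      rw [(h.star a).leib (hG b c), hDsG, hDsx, if_neg hc.symm, zero_mul, mul_zero, smul_zero,
        add_zero]
    · simp
  have hDY : ∀ a c, D a (∑ d, G c d * xs d) = ∑ d, D a (G c d) * xs d := by
    intro a c
    rw [map_sum]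
    refine Finset.sum_congr rfl fun d _ => ?_
    rw [(h.base a).leib (hG c d), hDx, mul_zero, smul_zero, add_zero]
  -- After the chain rule for the inner derivative, the outer one falls either on the coefficient,
  -- giving the first order remainder, or on `Φ (Ds' b f)`. A second use of the chain rule splits
  -- the latter into a mixed part, which becomes the new Laplacian, and a part with two fibre
  -- derivatives.
  have hterm : ∀ a, sg (par a) • D a (Ds a (Φ f)) =
      ∑ b, (sg (par a) • D a (Ds a (∑ c, G b c * xs c))) * Φ (Ds' b f) +
      (∑ b, ∑ c, sg (par b) • (G b a * D a (T c) * Φ (D' c (Ds' b f))) +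
       ∑ b, ∑ c, sg (par b) • (∑ d, G b a * D a (G c d) * xs d) * Φ (Ds' c (Ds' b f))) := by
    intro a
    rw [hDs a f]
    simp only [hDsT, zero_mul, Finset.sum_const_zero, zero_add, map_sum, Finset.smul_sum,
      ← Finset.sum_add_distrib]
    refine Finset.sum_congr rfl fun b _ => ?_
    simp only [← map_sum]
    have hhom : Hom (par b + par a) (Ds a (∑ c, G b c * xs c)) := by
      rw [hDsY]
      exact (hG b a).smul _
    have hsum : ∑ c, sg (par a) • D a (Ds a (G b c * xs c)) =
        sg (par a) • D a (Ds a (∑ c, G b c * xs c)) := by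
      simp only [map_sum, Finset.smul_sum]
    rw [(h.base a).leib hhom, smul_add, hsum, smul_mul_assoc]
    congr 1
    rw [hD a (Ds' b f), hDsY]
    simp only [hDY, mul_add, smul_add, Finset.mul_sum, Finset.sum_mul, Finset.smul_sum,
      smul_mul_assoc, smul_smul, ← Finset.sum_add_distrib, ← sg_add, mul_assoc]
    simp only [← add_assoc]
    have hs : par a + par a * par b + par a * par a + (par a + 1) * par b +
        (par a + 1) * par a = par b := by
      generalize par a = k
      generalize par b = l
      revert k l
      decide
    rw [hs]
  -- `H` supercommutes in its first two indices with parities `par`, the fibre derivatives with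
  -- parities `par + 1`. Together with the sign of `par b` this makes the sum change sign when `b`
  -- and `c` are interchanged.
  have hzero : ∑ b, ∑ c, sg (par b) • (∑ d, H b c d * xs d) * Φ (Ds' c (Ds' b f)) = 0 := by
    refine eq_zero_of_eq_neg ?_
    conv_lhs => rw [Finset.sum_comm]
    rw [← Finset.sum_neg_distrib]
    refine Finset.sum_congr rfl fun b _ => ?_
    rw [← Finset.sum_neg_distrib]
    refine Finset.sum_congr rfl fun c _ => ?_
    rw [h'.star_star b c]
    simp only [map_smul, hH c b, smul_mul_assoc, mul_smul_comm, smul_smul, ← Finset.smul_sum,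
      ← neg_smul]
    congr 1
    generalize par b = k
    generalize par c = l
    rcases eq_zero_or_eq_one k with rfl | rfl <;> rcases eq_zero_or_eq_one l with rfl | rfl <;>
    simp [show (1 + 1 : ZMod 2) = 0 by decide]
  rw [lap_apply, Finset.sum_congr rfl fun a _ => hterm a, Finset.sum_add_distrib,
    Finset.sum_add_distrib, add_comm]
  congr 1
  · rw [Finset.sum_comm, lap_apply, map_sum]
    have e1 : ∑ a, ∑ b, ∑ c, sg (par b) • (∑ d, G b a * D a (G c d) * xs d) *
        Φ (Ds' c (Ds' b f)) =
        ∑ b, ∑ c, sg (par b) • (∑ d, H b c d * xs d) * Φ (Ds' c (Ds' b f)) := by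
      rw [Finset.sum_comm]
      refine Finset.sum_congr rfl fun b _ => ?_
      rw [Finset.sum_comm]
      refine Finset.sum_congr rfl fun c _ => ?_
      rw [← Finset.sum_mul, ← Finset.smul_sum, Finset.sum_comm]
      simp only [← hGG, Finset.sum_mul]
    rw [e1, hzero, add_zero]
    refine Finset.sum_congr rfl fun b _ => ?_
    rw [Finset.sum_comm, map_smul]
    simp only [← Finset.smul_sum, ← Finset.sum_mul, hGT, ite_mul, one_mul, zero_mul,
      Finset.sum_ite_eq, Finset.mem_univ, if_true]
  · rw [Finset.sum_comm]
    simp only [← Finset.sum_mul, ← lap_apply]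

end Invariance

/-! ## The operator `δ` on an abstract odd cotangent bundle with a coordinate `t` -/

section HatLaplacian

variable {R : Type*} [Ring R] [Algebra ℝ R] [SuperRing R] {ι : Type*} [Fintype ι]
  {par : ι → ZMod 2} {D Ds : ι → R →ₗ[ℝ] R} {n : ι} {ti tv τ : R}

/-- The operator `Δ - 2 t⁻¹ ∂/∂t*`. -/
def dlt (par : ι → ZMod 2) (D Ds : ι → R →ₗ[ℝ] R) (n : ι) (ti : R) (f : R) : R :=
  lap par D Ds f - (2 : ℝ) • (ti * Ds n f)

theorem IsCotDer.star_self (h : IsCotDer par D Ds) (hn : par n = 0) (x : R) :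
    Ds n (Ds n x) = 0 := by
  refine eq_zero_of_eq_neg ?_
  have := h.star_star n n x
  rw [hn] at this
  simpa using this

/-- The operator `δ` commutes with a homomorphism that satisfies the chain rule. -/
theorem dlt_comp {R' : Type*} [Ring R'] [Algebra ℝ R'] [SuperRing R']
    {D' Ds' : ι → R' →ₗ[ℝ] R'} {Φ : R' →ₐ[ℝ] R} {ti' : R'} {T Ys : ι → R}
    (hDsT : ∀ a b, Ds a (T b) = 0)
    (hDs : ∀ a f, Ds a (Φ f) = ∑ b, Ds a (T b) * Φ (D' b f) + ∑ b, Ds a (Ys b) * Φ (Ds' b f))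
    (hlap : ∀ f, lap par D Ds (Φ f) = Φ (lap par D' Ds' f) +
      ∑ b, lap par D Ds (Ys b) * Φ (Ds' b f))
    (hb : ∀ b, b ≠ n → dlt par D Ds n ti (Ys b) = 0)
    (hnn : dlt par D Ds n ti (Ys n) = -(2 : ℝ) • Φ ti') (f : R') :
    dlt par D Ds n ti (Φ f) = Φ (dlt par D' Ds' n ti' f) := by
  -- The extra term of `dlt` is a first order operator in the fibre direction, so by the chain rule
  -- it merges with the remainder of the Laplacian. It is then enough to know `dlt` on the new fibre
  -- coordinates.
  have h1 : dlt par D Ds n ti (Φ f) = Φ (lap par D' Ds' f) +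
      ∑ b, dlt par D Ds n ti (Ys b) * Φ (Ds' b f) := by
    simp only [dlt, hlap, hDs, hDsT, zero_mul, Finset.sum_const_zero, zero_add, sub_mul,
      Finset.sum_sub_distrib, smul_mul_assoc, mul_assoc, ← Finset.smul_sum, ← Finset.mul_sum]
    abel
  rw [h1, Finset.sum_eq_single n (fun b _ hbn => by rw [hb b hbn, zero_mul]) (by simp), hnn]
  simp [dlt, sub_eq_add_neg]

/-- An element of weight `w ≠ 1` that is divisible by `t*` and annihilated by `δ` vanishes. -/
theorem eq_zero_of_dlt_eq_zero (h : IsCotDer par D Ds) (hn : par n = 0) (hti : Hom 0 ti)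
    (htv : Hom 0 tv) (htt : tv * ti = 1) (hτ : Hom 1 τ) (hDτ : ∀ a, D a τ = 0)
    (hDsτ : Ds n τ = 1) (hDsτ' : ∀ a, a ≠ n → Ds a τ = 0) (hDsti : Ds n ti = 0)
    {w : ℝ} (hw : w ≠ 1) {x : R} (hx : x = τ * Ds n x) (hδ : dlt par D Ds n ti x = 0)
    (hW : tv * D n x - τ * Ds n x = w • x) : x = 0 := by
  set y := Ds n x with hy
  have hyy : Ds n y = 0 := h.star_self hn x
  have hττ : τ * τ = 0 := by
    refine eq_zero_of_eq_neg ?_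
    nth_rewrite 1 [hτ.comm hτ]
    simp
  have hti' : ∀ z, ti * z = z * ti := SuperRing.even_comm (hom_zero_iff.1 hti)
  have htv' : ∀ z, tv * z = z * tv := SuperRing.even_comm (hom_zero_iff.1 htv)
  -- For these indices the second derivative of `x = τ y` still contains the factor `τ`, which is
  -- killed by another `τ`. Multiplying the equation by `τ` thus leaves only the `t`-direction.
  have h1 : ∀ a, a ≠ n → τ * D a (Ds a x) = 0 := by
    intro a ha
    rw [hx, (h.star a).leib hτ, hDsτ' a ha, zero_mul, zero_add, map_smul, (h.base a).leib hτ,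
      hDτ, zero_mul, zero_add, mul_smul_comm, mul_smul_comm, ← mul_assoc, hττ, zero_mul,
      smul_zero, smul_zero]
  have h2 : τ * (D n y - (2 : ℝ) • (ti * y)) = 0 := by
    have h3 := congrArg (τ * ·) hδ
    simp only [dlt, lap_apply, mul_sub, mul_zero, Finset.mul_sum, mul_smul_comm] at h3
    rw [Finset.sum_eq_single n (fun a _ ha => by rw [h1 a ha, smul_zero]) (by simp), hn, sg_zero,
      one_smul] at h3
    rw [mul_sub, mul_smul_comm, h3]
  -- The factor `τ` is removed by differentiating along it: nothing else in the product depends on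
  -- `t*`.
  have h4 : D n y = (2 : ℝ) • (ti * y) := by
    have h5 := congrArg (Ds n) h2
    have h6 : Ds n (D n y) = 0 := by
      have := h.base_star n n y
      rw [hn, zero_mul, sg_zero, one_smul, hyy, map_zero] at this
      exact this.symm
    rw [(h.star n).leib hτ, hDsτ, one_mul, map_sub, map_smul, (h.star n).leib hti, hDsti, hyy, h6,
      map_zero] at h5
    simpa [sub_eq_zero] using h5
  -- So `x` has degree 2 in `t`. The factor `t*` lowers the weight by 1, hence `x` has weight 1,
  -- which contradicts `w ≠ 1` unless `x = 0`.
  have h7 : tv * D n x = (2 : ℝ) • x := by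
    rw [hx, (h.base n).leib hτ, hDτ, zero_mul, zero_add, hn, zero_mul, sg_zero, one_smul,
      h4, mul_smul_comm, mul_smul_comm, ← mul_assoc, htv', mul_assoc, ← mul_assoc tv, htt, one_mul]
  rw [h7, ← hx] at hW
  have h8 : (1 - w) • x = 0 := by
    rw [sub_smul, one_smul, ← hW]
    module
  exact (smul_eq_zero.1 h8).resolve_left (sub_ne_zero.2 hw.symm)

end HatLaplacian

/-! ### The action of δ on elements h₀t^m + w*t^mh₁ -/

section HatForm

variable {R Rc : Type*} [Ring R] [Algebra ℝ R] [SuperRing R] [Ring Rc] [Algebra ℝ Rc]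
  [SuperRing Rc] {ι κ : Type*} [Fintype ι] [Fintype κ]
  {par : ι → ZMod 2} {D Ds : ι → R →ₗ[ℝ] R} {pc : κ → ZMod 2} {Dc Dcs : κ → Rc →ₗ[ℝ] Rc}
  {n : ι} {ti tv τ : R} {J : Rc →ₐ[ℝ] R} {tp : ℝ → R}

/-- The element `h₀ t^m + w* t^m h₁`, where `w* = t t*`. -/
def hatForm (J : Rc →ₐ[ℝ] R) (tv τ : R) (tp : ℝ → R) (m : ℝ) (h₀ h₁ : Rc) : R :=
  J h₀ * tp m + tv * τ * tp m * J h₁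

/-- The relations between the coordinates of an odd cotangent bundle with a distinguished even
base coordinate `t` and the odd cotangent bundle obtained by omitting it. -/
structure IsHatForm (par : ι → ZMod 2) (D Ds : ι → R →ₗ[ℝ] R) (pc : κ → ZMod 2)
    (Dc Dcs : κ → Rc →ₗ[ℝ] Rc) (n : ι) (ti tv τ : R) (J : Rc →ₐ[ℝ] R) (tp : ℝ → R)
    (emb : κ → ι) : Prop where
  cot : IsCotDer par D Ds
  cotc : IsCotDer pc Dc Dcs
  par_n : par n = 0
  par_emb : ∀ b, par (emb b) = pc b
  emb_ne : ∀ b, emb b ≠ n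
  sum_eq : ∀ f : ι → R, ∑ a, f a = f n + ∑ b, f (emb b)
  hti : Hom 0 ti
  htv : Hom 0 tv
  htt : tv * ti = 1
  hτ : Hom 1 τ
  hJ : IsSHom J
  htp : ∀ m, Hom 0 (tp m)
  tp_add : ∀ l m, tp (l + m) = tp l * tp m
  D_τ : ∀ a, D a τ = 0
  Ds_τ : Ds n τ = 1
  Ds_τ' : ∀ a, a ≠ n → Ds a τ = 0
  Ds_ti : Ds n ti = 0
  Dn_tv : D n tv = 1
  D_tv : ∀ b, D (emb b) tv = 0
  Ds_tv : ∀ a, Ds a tv = 0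
  Dn_tp : ∀ m, D n (tp m) = m • (ti * tp m)
  D_tp : ∀ b m, D (emb b) (tp m) = 0
  Ds_tp : ∀ a m, Ds a (tp m) = 0
  Dn_J : ∀ x, D n (J x) = 0
  Dsn_J : ∀ x, Ds n (J x) = 0
  D_J : ∀ b x, D (emb b) (J x) = J (Dc b x)
  Ds_J : ∀ b x, Ds (emb b) (J x) = J (Dcs b x)

variable {emb : κ → ι}

theorem IsHatForm.lap_J (h : IsHatForm par D Ds pc Dc Dcs n ti tv τ J tp emb) (x : Rc) :
    lap par D Ds (J x) = J (lap pc Dc Dcs x) := by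
  rw [lap_apply, h.sum_eq, lap_apply, map_sum, h.Dsn_J, map_zero, smul_zero, zero_add]
  refine Finset.sum_congr rfl fun b _ => ?_
  rw [h.Ds_J, h.D_J, h.par_emb, map_smul]

/-- In the product rule the element `c` depends on `t` alone, so the bracket reduces to the pair
`t`, `t*`. -/
theorem IsHatForm.lap_mul_of_base (h : IsHatForm par D Ds pc Dc Dcs n ti tv τ J tp emb)
    {c : R} (hc : Hom 0 c) (hD : ∀ b, D (emb b) c = 0) (hDs : ∀ a, Ds a c = 0) (x : R) :
    lap par D Ds (c * x) = c * lap par D Ds x + D n c * Ds n x := by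
  rw [lap_mul h.cot hc, brk, h.sum_eq]
  have h0 : lap par D Ds c = 0 := by simp [lap_apply, hDs]
  simp [h0, hDs, hD, h.par_n]

/-- The coefficient m - 1 is (m+1) - 2: differentiating t·t^m in `t` gives m + 1, and -2t⁻¹∂/∂t*
contributes -2. The sign of the last component comes from moving Δ past `t*`. At m = 1 the
coefficient degenerates, which is why weight 1 is excluded. -/
theorem IsHatForm.dlt_hatForm (h : IsHatForm par D Ds pc Dc Dcs n ti tv τ J tp emb) (m : ℝ)
    (h₀ h₁ : Rc) :
    dlt par D Ds n ti (hatForm J tv τ tp m h₀ h₁) =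
      hatForm J tv τ tp m (lap pc Dc Dcs h₀ + (m - 1) • h₁) (-lap pc Dc Dcs h₁) := by
  have htpc : ∀ m z, tp m * z = z * tp m := fun m => SuperRing.even_comm (hom_zero_iff.1 (h.htp m))
  have htic : ∀ z, ti * z = z * ti := SuperRing.even_comm (hom_zero_iff.1 h.hti)
  have htvc : ∀ z, tv * z = z * tv := SuperRing.even_comm (hom_zero_iff.1 h.htv)
  have hc : Hom 0 (tv * tp m) := (h.htv.mul (h.htp m)).cast (by simp)
  -- The even factors depending on `t` alone are placed on the left, where `lap_mul_of_base`
  -- applies.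
  have e1 : hatForm J tv τ tp m h₀ h₁ = tp m * J h₀ + (tv * tp m) * (τ * J h₁) := by
    rw [hatForm, ← htpc m (J h₀), mul_assoc tv, ← htpc m τ]
    simp only [mul_assoc]
  have hDc : ∀ b, D (emb b) (tv * tp m) = 0 := by
    intro b
    rw [(h.cot.base _).leib h.htv, h.D_tv, h.D_tp]
    simp
  have hDsc : ∀ a, Ds a (tv * tp m) = 0 := by
    intro a
    rw [(h.cot.star _).leib h.htv, h.Ds_tv, h.Ds_tp]
    simp
  have hDnc : D n (tv * tp m) = (m + 1) • tp m := by
    rw [(h.cot.base _).leib h.htv, h.Dn_tv, h.Dn_tp, one_mul, mul_zero, sg_zero, one_smul,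
      mul_smul_comm, ← mul_assoc, h.htt, one_mul]
    module
  have hlapτ : lap par D Ds (τ * J h₁) = -(τ * J (lap pc Dc Dcs h₁)) := by
    rw [lap_mul h.cot h.hτ, h.lap_J]
    have h0 : lap par D Ds τ = 0 := by
      rw [lap_apply, h.sum_eq]
      simp only [h.Ds_τ, h.cot.base n |>.one, h.Ds_τ' _ (h.emb_ne _)]
      simp
    have hb : brk par D Ds 1 τ (J h₁) = 0 := by
      rw [brk, h.sum_eq]
      simp only [h.Ds_τ, h.Ds_τ' _ (h.emb_ne _), h.D_τ, h.Dn_J]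
      simp
    rw [h0, hb]
    simp
  have hDsn : Ds n (τ * J h₁) = J h₁ := by
    rw [(h.cot.star n).leib h.hτ, h.Ds_τ, h.Dsn_J]
    simp
  have hDsn2 : Ds n (tp m * J h₀ + (tv * tp m) * (τ * J h₁)) = tv * tp m * J h₁ := by
    rw [map_add, (h.cot.star n).leib (h.htp m), h.Ds_tp, h.Dsn_J, (h.cot.star n).leib hc, hDsc,
      hDsn]
    simp
  rw [e1, dlt, hDsn2, map_add, h.lap_mul_of_base (h.htp m) (h.D_tp · m) (h.Ds_tp · m),
    h.lap_mul_of_base hc hDc hDsc, h.lap_J, h.Dsn_J, hDnc, hlapτ, hDsn, hatForm, mul_zero, add_zero]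
  have e2 : ti * (tv * tp m * J h₁) = tp m * J h₁ := by
    rw [← mul_assoc, ← mul_assoc, htic tv, h.htt, one_mul]
  have e3 : tv * τ * tp m * J (-lap pc Dc Dcs h₁) =
      tv * tp m * -(τ * J (lap pc Dc Dcs h₁)) := by
    rw [mul_assoc tv, ← htpc m τ]
    simp only [map_neg, mul_neg, mul_assoc]
  rw [e2, e3, map_add, map_smul, ← htpc m (J _ + _), mul_add, smul_mul_assoc, mul_smul_comm]
  module

/-- The product of the two `w*`-components vanishes because t* squares to zero. The involution
records the sign of moving `w*` to the left of `s₀`. -/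
theorem IsHatForm.hatForm_mul (h : IsHatForm par D Ds pc Dc Dcs n ti tv τ J tp emb) (l m : ℝ)
    (s₀ s₁ u₀ u₁ : Rc) :
    hatForm J tv τ tp l s₀ s₁ * hatForm J tv τ tp m u₀ u₁ =
      hatForm J tv τ tp (l + m) (s₀ * u₀) (s₁ * u₀ + SuperRing.inv s₀ * u₁) := by
  have htpc : ∀ m z, tp m * z = z * tp m := fun m => SuperRing.even_comm (hom_zero_iff.1 (h.htp m))
  have htvc : ∀ z, tv * z = z * tv := SuperRing.even_comm (hom_zero_iff.1 h.htv)
  have hττ : τ * τ = 0 := by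
    refine eq_zero_of_eq_neg ?_
    nth_rewrite 1 [h.hτ.comm h.hτ]
    simp
  have hτJ : ∀ x, J x * τ = τ * J (SuperRing.inv x) := by
    intro x
    rw [SuperRing.odd_comm (hom_one_iff.1 h.hτ), h.hJ]
  have e : ∀ m h₀ h₁, hatForm J tv τ tp m h₀ h₁ = (J h₀ + τ * (J h₁ * tv)) * tp m := by
    intro m h₀ h₁
    rw [hatForm, add_mul, htvc τ, mul_assoc _ (tp m), htpc m (J h₁), mul_assoc τ,
      ← mul_assoc tv, htvc (J h₁)]
    simp only [mul_assoc]
  have e2 : τ * (J s₁ * tv) * (τ * (J u₁ * tv)) = 0 := by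
    have : τ * (J s₁ * tv) * τ = 0 := by
      rw [mul_assoc, mul_assoc (J s₁), htvc τ, ← mul_assoc (J s₁), hτJ, ← mul_assoc,
        ← mul_assoc, hττ]
      simp
    rw [← mul_assoc, this, zero_mul]
  have e3 : J s₀ * (τ * (J u₁ * tv)) = τ * (J (SuperRing.inv s₀ * u₁) * tv) := by
    rw [← mul_assoc, hτJ, map_mul]
    simp only [mul_assoc]
  have e4 : τ * (J s₁ * tv) * J u₀ = τ * (J (s₁ * u₀) * tv) := by
    rw [map_mul, mul_assoc, mul_assoc (J s₁), htvc (J u₀), mul_assoc]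
  have e5 : ∀ a b, a * tp l * (b * tp m) = a * b * (tp l * tp m) := by
    intro a b
    rw [mul_assoc, ← mul_assoc (tp l), htpc l b, mul_assoc, ← mul_assoc]
  rw [e, e, e, h.tp_add, e5, add_mul, mul_add, mul_add, e2, e3, e4]
  simp only [map_mul, map_add, mul_add, add_mul, add_zero, add_assoc]
  abel

/-- The factor `w* = t t*` has weight 0, so both components have the weight of `t^m`. -/
theorem IsHatForm.weight_hatForm (h : IsHatForm par D Ds pc Dc Dcs n ti tv τ J tp emb) (m : ℝ)
    (h₀ h₁ : Rc) :
    tv * D n (hatForm J tv τ tp m h₀ h₁) - τ * Ds n (hatForm J tv τ tp m h₀ h₁) =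
      m • hatForm J tv τ tp m h₀ h₁ := by
  have htpc : ∀ m z, tp m * z = z * tp m := fun m => SuperRing.even_comm (hom_zero_iff.1 (h.htp m))
  have hc : Hom 0 (tv * tp m) := (h.htv.mul (h.htp m)).cast (by simp)
  have hcc : ∀ z, tv * tp m * z = z * (tv * tp m) := SuperRing.even_comm (hom_zero_iff.1 hc)
  have e1 : hatForm J tv τ tp m h₀ h₁ = tp m * J h₀ + (tv * tp m) * (τ * J h₁) := by
    rw [hatForm, ← htpc m (J h₀), mul_assoc tv, ← htpc m τ]
    simp only [mul_assoc]
  have hDnc : D n (tv * tp m) = (m + 1) • tp m := by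
    rw [(h.cot.base _).leib h.htv, h.Dn_tv, h.Dn_tp, one_mul, mul_zero, sg_zero, one_smul,
      mul_smul_comm, ← mul_assoc, h.htt, one_mul]
    module
  have hDsnc : Ds n (tv * tp m) = 0 := by
    rw [(h.cot.star n).leib h.htv, h.Ds_tv, h.Ds_tp]
    simp
  have hDs : Ds n (tp m * J h₀ + (tv * tp m) * (τ * J h₁)) = tv * tp m * J h₁ := by
    rw [map_add, (h.cot.star n).leib (h.htp m), h.Ds_tp, h.Dsn_J, (h.cot.star n).leib hc, hDsnc,
      (h.cot.star n).leib h.hτ, h.Ds_τ, h.Dsn_J]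
    simp
  have hD : D n (tp m * J h₀ + (tv * tp m) * (τ * J h₁)) =
      m • (ti * tp m * J h₀) + (m + 1) • (tp m * (τ * J h₁)) := by
    rw [map_add, (h.cot.base n).leib (h.htp m), h.Dn_tp, h.Dn_J, (h.cot.base n).leib hc, hDnc,
      (h.cot.base n).leib h.hτ, h.D_τ, h.Dn_J]
    simp
  rw [e1, hDs, hD, mul_add, mul_smul_comm, mul_smul_comm, ← mul_assoc tv, ← mul_assoc tv, h.htt,
    one_mul, ← mul_assoc τ, ← hcc τ]
  simp only [mul_assoc]
  module

/-- The weight operator commutes with a homomorphism that satisfies the chain rule. -/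
theorem weight_comp {R' : Type*} [Ring R'] [Algebra ℝ R'] [SuperRing R'] [DecidableEq ι]
    {D' Ds' : ι → R' →ₗ[ℝ] R'} {Φ : R' →ₐ[ℝ] R} {tv' τ' : R'} {T Ys : ι → R}
    (hD : ∀ f, D n (Φ f) = ∑ b, D n (T b) * Φ (D' b f) + ∑ b, D n (Ys b) * Φ (Ds' b f))
    (hDs : ∀ f, Ds n (Φ f) = ∑ b, Ds n (T b) * Φ (D' b f) + ∑ b, Ds n (Ys b) * Φ (Ds' b f))
    (hT : ∀ b, tv * D n (T b) - τ * Ds n (T b) = if b = n then Φ tv' else 0)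
    (hY : ∀ b, tv * D n (Ys b) - τ * Ds n (Ys b) = if b = n then -Φ τ' else 0) (f : R') :
    tv * D n (Φ f) - τ * Ds n (Φ f) = Φ (tv' * D' n f - τ' * Ds' n f) := by
  -- A first order operator is determined, through the chain rule, by its values on the new
  -- coordinates.
  have e : tv * D n (Φ f) - τ * Ds n (Φ f) =
      ∑ b, (tv * D n (T b) - τ * Ds n (T b)) * Φ (D' b f) +
      ∑ b, (tv * D n (Ys b) - τ * Ds n (Ys b)) * Φ (Ds' b f) := by
    simp only [hD, hDs, mul_add, Finset.mul_sum, sub_mul, Finset.sum_sub_distrib, mul_assoc]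
    abel
  rw [e]
  simp only [hT, hY, ite_mul, zero_mul, Finset.sum_ite_eq', Finset.mem_univ, if_true, map_add,
    map_neg, map_mul, neg_mul, sub_eq_add_neg]

end HatForm

/-! ## Determinants and Berezinians in a supercommutative algebra -/

section Determinant

variable (R : Type*) [Ring R] [Algebra ℝ R] [SuperRing R]

/-- The commutative subalgebra of even elements. -/
def evenPart : Subalgebra ℝ R where
  carrier := {x | Hom 0 x}
  mul_mem' hx hy := (Hom.mul hx hy).cast (by simp)
  add_mem' hx hy := Hom.add hx hy
  algebraMap_mem' c := by simp [Hom]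

/-- This makes the determinant theory of commutative rings available for matrices with even entries.
-/
instance : CommRing (evenPart R) :=
  { (inferInstance : Ring (evenPart R)) with
    mul_comm := fun x y => Subtype.ext (SuperRing.even_comm (hom_zero_iff.1 x.2) y.1) }

variable {R}

/-- No signs occur because the factors are even; evenness also allows the differentiated factor to
be moved to the right. -/
theorem IsSDer.prod {d : ZMod 2} {D : R →ₗ[ℝ] R} (hD : IsSDer d D) {ι : Type*} [DecidableEq ι]
    (s : Finset ι) (f : ι → evenPart R) :
    D (∏ i ∈ s, f i : evenPart R) =
      ∑ i ∈ s, ((∏ j ∈ s.erase i, f j : evenPart R) : R) * D (f i) := by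
  induction s using Finset.induction_on with
  | empty => simpa using hD.one
  | insert a s ha ih =>
    rw [Finset.prod_insert ha, Finset.sum_insert ha, Finset.erase_insert ha]
    have e1 : D ((f a * ∏ i ∈ s, f i : evenPart R) : R) =
        D (f a : R) * (∏ i ∈ s, f i : evenPart R) + (f a : R) * D (∏ i ∈ s, f i : evenPart R) := by
      rw [Subalgebra.coe_mul, hD.leib (f a).2]
      simp
    rw [e1, ih, Finset.mul_sum,
      ← SuperRing.even_comm (hom_zero_iff.1 (∏ i ∈ s, f i : evenPart R).2)]
    congr 1
    refine Finset.sum_congr rfl fun i hi => ?_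
    rw [Finset.erase_insert_of_ne (by rintro rfl; exact ha hi), Finset.prod_insert,
      Subalgebra.coe_mul,
      mul_assoc]
    exact fun h => ha (Finset.mem_of_mem_erase h)

/-- Jacobi's formula for a superderivation. -/
theorem IsSDer.det {d : ZMod 2} {D : R →ₗ[ℝ] R} (hD : IsSDer d D) {n : Type*} [Fintype n]
    [DecidableEq n] (A : Matrix n n (evenPart R)) :
    D (A.det : evenPart R) = ∑ i, ∑ j, ((A.adjugate i j : evenPart R) : R) * D (A j i) := by
  -- An adjugate entry is the determinant with row `j` replaced by a unit vector, so only the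
  -- permutations taking `i` to `j` contribute.
  have hadj : ∀ i j, A.adjugate i j = ∑ σ : Equiv.Perm n, if σ i = j then
      ((Equiv.Perm.sign σ : ℤˣ) : ℤ) • ∏ k ∈ Finset.univ.erase i, A (σ k) k else 0 := by
    intro i j
    rw [Matrix.adjugate_apply, Matrix.det_apply]
    refine Finset.sum_congr rfl fun σ _ => ?_
    split_ifs with hσ
    · rw [← Finset.mul_prod_erase _ _ (Finset.mem_univ i), hσ, Matrix.updateRow_self,
        Pi.single_eq_same, one_mul]
      rw [Units.smul_def]
      congr 1
      refine Finset.prod_congr rfl fun k hk => ?_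
      rw [Matrix.updateRow_ne]
      rw [← hσ]
      exact fun h => (Finset.ne_of_mem_erase hk) (σ.injective h)
    · rw [Finset.prod_eq_zero (Finset.mem_univ (σ.symm j)), smul_zero]
      rw [Equiv.apply_symm_apply, Matrix.updateRow_self, Pi.single_eq_of_ne]
      rintro rfl
      simp at hσ
  have hL : D (A.det : evenPart R) = ∑ σ : Equiv.Perm n, ∑ i,
      ((((Equiv.Perm.sign σ : ℤˣ) : ℤ) • ∏ k ∈ Finset.univ.erase i, A (σ k) k : evenPart R) : R) *
        D (A (σ i) i) := by
    rw [Matrix.det_apply, AddSubmonoidClass.coe_finsetSum, map_sum]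
    refine Finset.sum_congr rfl fun σ _ => ?_
    rw [Units.smul_def, AddSubgroupClass.coe_zsmul, map_zsmul, hD.prod, Finset.smul_sum]
    simp only [AddSubgroupClass.coe_zsmul, smul_mul_assoc]
  rw [hL, Finset.sum_comm]
  refine Finset.sum_congr rfl fun i _ => ?_
  simp only [hadj, AddSubmonoidClass.coe_finsetSum, Finset.sum_mul]
  rw [Finset.sum_comm]
  refine Finset.sum_congr rfl fun σ _ => ?_
  rw [Finset.sum_eq_single (σ i)]
  · rw [if_pos rfl]
  · intro j _ hj
    rw [if_neg hj.symm]
    simp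
  · simp

/-- All entries of the matrix `A` are homogeneous of parity `d`. -/
def HomM {m n : Type*} (d : ZMod 2) (A : Matrix m n R) : Prop := ∀ i j, Hom d (A i j)

section HomM

variable {l m n : Type*} [Fintype l] [Fintype m] [Fintype n] {d e : ZMod 2}

theorem HomM.mul {A : Matrix l m R} {B : Matrix m n R} (hA : HomM d A) (hB : HomM e B) :
    HomM (d + e) (A * B) := fun i j => by
  rw [Matrix.mul_apply]
  exact Hom.sum _ fun k _ => (hA i k).mul (hB k j)

theorem HomM.sub {A B : Matrix l m R} (hA : HomM d A) (hB : HomM d B) :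
    HomM d (A - B) := fun i j => (hA i j).sub (hB i j)

theorem HomM.cast {A : Matrix l m R} (hA : HomM d A) (h : d = e) : HomM e A := h ▸ hA

theorem HomM.map {D : R →ₗ[ℝ] R} (hD : IsSDer e D) {A : Matrix l m R} (hA : HomM d A) :
    HomM (e + d) (A.map D) := fun i j => hD.hom (hA i j)

theorem HomM.trace_mul_comm {A : Matrix l m R} {B : Matrix m l R} (hA : HomM d A)
    (hB : HomM e B) : (A * B).trace = sg (d * e) • (B * A).trace := by
  simp only [Matrix.trace, Matrix.diag_apply, Matrix.mul_apply, Finset.smul_sum]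
  rw [Finset.sum_comm]
  exact Finset.sum_congr rfl fun i _ => Finset.sum_congr rfl fun j _ => (hA j i).comm (hB i j)

theorem IsSDer.map_mul {D : R →ₗ[ℝ] R} (hD : IsSDer e D) {A : Matrix l m R} (hA : HomM d A)
    (B : Matrix m n R) :
    (A * B).map D = A.map D * B + sg (e * d) • (A * B.map D) := by
  ext i j
  simp only [Matrix.map_apply, Matrix.mul_apply, Matrix.add_apply, Matrix.smul_apply, map_sum,
    Finset.smul_sum, ← Finset.sum_add_distrib]
  exact Finset.sum_congr rfl fun k _ => hD.leib (hA i k) _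

theorem IsSDer.map_one [DecidableEq n] {D : R →ₗ[ℝ] R} (hD : IsSDer e D) :
    (1 : Matrix n n R).map D = 0 := by
  ext i j
  by_cases h : i = j
  · subst h
    simp [hD.one]
  · simp [Matrix.one_apply_ne h]

theorem map_sub' (D : R →ₗ[ℝ] R) (A B : Matrix m n R) :
    (A - B).map D = A.map D - B.map D := by
  ext i j
  simp

end HomM

variable {k : ℕ}

/-- A matrix with even entries as a matrix over the even part. -/
def HomM.toEven {n : Type*} {A : Matrix n n R} (hA : HomM 0 A) : Matrix n n (evenPart R) :=
  Matrix.of fun i j => ⟨A i j, hA i j⟩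

/-- The transposition accounts for the convention: the Leibniz sum here permutes the column index,
`Matrix.det_apply` the row index. -/
theorem HomM.leibnizDet {A : Matrix (Fin k) (Fin k) R} (hA : HomM 0 A) :
    leibnizDet A = ((hA.toEven).det : evenPart R) := by
  rw [← Matrix.det_transpose, Matrix.det_apply, SuperGeom.leibnizDet,
    AddSubmonoidClass.coe_finsetSum]
  refine Finset.sum_congr rfl fun σ _ => ?_
  rw [Units.smul_def, AddSubgroupClass.coe_zsmul]
  congr 1
  rw [← List.prod_ofFn, SubmonoidClass.coe_list_prod, List.map_ofFn]
  rfl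

theorem HomM.leibnizDet_hom {A : Matrix (Fin k) (Fin k) R} (hA : HomM 0 A) :
    Hom 0 (SuperGeom.leibnizDet A) := by
  rw [hA.leibnizDet]
  exact (hA.toEven.det).2

theorem HomM.toEven_mul {A B : Matrix (Fin k) (Fin k) R} (hA : HomM 0 A) (hB : HomM 0 B)
    (h : A * B = 1) : hA.toEven * hB.toEven = 1 := by
  ext i j
  have h' := congrFun (congrFun h i) j
  rw [Matrix.mul_apply] at h' ⊢
  rw [AddSubmonoidClass.coe_finsetSum]
  refine h'.trans ?_
  by_cases hij : i = j
  · subst hij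
    simp
  · simp [Matrix.one_apply_ne hij]

theorem HomM.leibnizDet_mul {A B : Matrix (Fin k) (Fin k) R} (hA : HomM 0 A) (hB : HomM 0 B)
    (h : A * B = 1) : SuperGeom.leibnizDet A * SuperGeom.leibnizDet B = 1 := by
  rw [hA.leibnizDet, hB.leibnizDet, ← Subalgebra.coe_mul, ← Matrix.det_mul]
  rw [hA.toEven_mul hB h, Matrix.det_one, Subalgebra.coe_one]

/-- Jacobi's formula for an invertible even matrix. -/
theorem IsSDer.leibnizDet {d : ZMod 2} {D : R →ₗ[ℝ] R} (hD : IsSDer d D)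
    {A B : Matrix (Fin k) (Fin k) R} (hA : HomM 0 A) (hB : HomM 0 B) (hAB : A * B = 1) :
    D (SuperGeom.leibnizDet A) = SuperGeom.leibnizDet A * (B * A.map D).trace := by
  have h1 := hA.toEven_mul hB hAB
  -- Invertibility turns the adjugate into the determinant times the inverse matrix, hence Jacobi's
  -- formula into a logarithmic derivative.
  have h2 : hA.toEven.adjugate = hA.toEven.det • hB.toEven := by
    calc hA.toEven.adjugate = hA.toEven.adjugate * (hA.toEven * hB.toEven) := by
          rw [h1, mul_one]
      _ = _ := by rw [← mul_assoc, Matrix.adjugate_mul, smul_mul_assoc, one_mul]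
  rw [hA.leibnizDet, hD.det, h2, Matrix.trace, Finset.mul_sum]
  refine Finset.sum_congr rfl fun i _ => ?_
  rw [Matrix.diag_apply, Matrix.mul_apply, Finset.mul_sum]
  refine Finset.sum_congr rfl fun j _ => ?_
  rw [← mul_assoc]
  rfl

/-! ### The logarithmic derivative of the Berezinian -/

/-- The blocks of a pair of mutually inverse even supermatrices, and an inverse of the
odd-odd block `δ` of the first one. -/
structure IsBlockInv {p q : ℕ} (α E : Matrix (Fin p) (Fin p) R) (β F : Matrix (Fin p) (Fin q) R)
    (γ G : Matrix (Fin q) (Fin p) R) (δ H δi : Matrix (Fin q) (Fin q) R) : Prop where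
  hα : HomM 0 α
  hβ : HomM 1 β
  hγ : HomM 1 γ
  hδ : HomM 0 δ
  hE : HomM 0 E
  hF : HomM 1 F
  hG : HomM 1 G
  hH : HomM 0 H
  hδi : HomM 0 δi
  l11 : α * E + β * G = 1
  l21 : γ * E + δ * G = 0
  l22 : γ * F + δ * H = 1
  r11 : E * α + F * γ = 1
  r12 : E * β + F * δ = 0
  mul_inv : δ * δi = 1
  inv_mul : δi * δ = 1

namespace IsBlockInv

variable {p q : ℕ} {α E : Matrix (Fin p) (Fin p) R} {β F : Matrix (Fin p) (Fin q) R}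
    {γ G : Matrix (Fin q) (Fin p) R} {δ H δi : Matrix (Fin q) (Fin q) R}

/-- This and the next two lemmas solve the block equations: the remaining blocks of the inverse are
expressed by `E` and the inverse of `δ`. The traces in the derivative of the Berezinian are
recognized through them. -/
theorem G_eq (h : IsBlockInv α E β F γ G δ H δi) : G = -(δi * γ * E) := by
  have := congrArg (δi * ·) h.l21
  simp only [Matrix.mul_add, ← Matrix.mul_assoc, h.inv_mul, Matrix.one_mul,
    Matrix.mul_zero] at this
  exact eq_neg_of_add_eq_zero_right this

theorem F_eq (h : IsBlockInv α E β F γ G δ H δi) : F = -(E * β * δi) := by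
  have := congrArg (· * δi) h.r12
  simp only [Matrix.add_mul, Matrix.mul_assoc, h.mul_inv, Matrix.mul_one, Matrix.zero_mul] at this
  rw [Matrix.mul_assoc]
  exact eq_neg_of_add_eq_zero_right this

theorem H_eq (h : IsBlockInv α E β F γ G δ H δi) : H = δi + δi * γ * E * β * δi := by
  have h1 : δ * H = 1 + γ * E * β * δi := by
    rw [eq_sub_of_add_eq' h.l22, h.F_eq]
    simp only [Matrix.mul_neg, Matrix.mul_assoc, sub_neg_eq_add]
  have := congrArg (δi * ·) h1
  simp only [Matrix.mul_add, ← Matrix.mul_assoc, h.inv_mul, Matrix.one_mul, Matrix.mul_one] at this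
  exact this

theorem schur_hom (h : IsBlockInv α E β F γ G δ H δi) : HomM 0 (α - β * δi * γ) :=
  h.hα.sub (((h.hβ.mul h.hδi).mul h.hγ).cast (by decide))

theorem schur_mul (h : IsBlockInv α E β F γ G δ H δi) : (α - β * δi * γ) * E = 1 := by
  have := h.l11
  rw [h.G_eq] at this
  simpa [Matrix.add_mul, Matrix.mul_assoc, sub_eq_add_neg] using this

/-- The Berezinian, in terms of the inverse of the odd-odd block. -/
def ber (α : Matrix (Fin p) (Fin p) R) (β : Matrix (Fin p) (Fin q) R)
    (γ : Matrix (Fin q) (Fin p) R) (δi : Matrix (Fin q) (Fin q) R) : R :=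
  leibnizDet (α - β * δi * γ) * leibnizDet δi

/-- The supertrace of the logarithmic derivative of an even supermatrix. -/
def strD (d : ZMod 2) (D : R →ₗ[ℝ] R) (α E : Matrix (Fin p) (Fin p) R)
    (β F : Matrix (Fin p) (Fin q) R) (γ G : Matrix (Fin q) (Fin p) R)
    (δ H : Matrix (Fin q) (Fin q) R) : R :=
  (E * α.map D).trace + sg d • (F * γ.map D).trace - sg d • (G * β.map D).trace -
    (H * δ.map D).trace

theorem ber_hom (h : IsBlockInv α E β F γ G δ H δi) : Hom 0 (ber α β γ δi) :=
  (h.schur_hom.leibnizDet_hom.mul h.hδi.leibnizDet_hom).cast (by simp)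

/-- Liouville's formula. Jacobi's formula is applied to the determinants of the Schur complement,
whose inverse is `E`, and of `δi`. The resulting traces are brought to the form of the supertrace by
graded cyclicity and the block formulas. -/
theorem sder_ber (h : IsBlockInv α E β F γ G δ H δi) {d : ZMod 2} {D : R →ₗ[ℝ] R}
    (hD : IsSDer d D) :
    D (ber α β γ δi) = ber α β γ δi * strD d D α E β F γ G δ H := by
  have hN := h.schur_hom
  have hNE := h.schur_mul
  -- The derivative of an inverse, from differentiating `δi * δ = 1`.
  have hδi' : δi.map D = -(δi * δ.map D * δi) := by
    have e := hD.map_mul h.hδi δ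
    rw [h.inv_mul, hD.map_one] at e
    have e' := congrArg (· * δi) e
    simp only [Matrix.zero_mul, Matrix.add_mul, mul_zero, sg_zero, one_smul, Matrix.mul_assoc,
      h.mul_inv, Matrix.mul_one] at e'
    rw [Matrix.mul_assoc]
    exact eq_neg_of_add_eq_zero_left e'.symm
  have t1 : (E * (β.map D * δi * γ)).trace = sg d • (G * β.map D).trace := by
    have hX : HomM (d + 1) (E * β.map D) := (h.hE.mul (h.hβ.map hD)).cast (by simp)
    have hY : HomM 1 (δi * γ) := (h.hδi.mul h.hγ).cast (by simp)
    rw [h.G_eq, Matrix.mul_assoc, ← Matrix.mul_assoc E, hX.trace_mul_comm hY, mul_one, sg_add,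
      ← Matrix.mul_assoc]
    simp
  have t2 : (E * (β * δi * γ.map D)).trace = -(F * γ.map D).trace := by
    rw [h.F_eq]
    simp [Matrix.mul_assoc]
  have t3 : (E * (β * (δi * δ.map D * δi) * γ)).trace =
      -sg d • (δi * γ * E * β * δi * δ.map D).trace := by
    have hX : HomM (d + 1) (E * β * δi * δ.map D) :=
      (((h.hE.mul h.hβ).mul h.hδi).mul (h.hδ.map hD)).cast (by simp [add_comm])
    have hY : HomM 1 (δi * γ) := (h.hδi.mul h.hγ).cast (by simp)
    have e : E * (β * (δi * δ.map D * δi) * γ) = (E * β * δi * δ.map D) * (δi * γ) := by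
      simp only [Matrix.mul_assoc]
    rw [e, hX.trace_mul_comm hY, mul_one, sg_add]
    simp [Matrix.mul_assoc]
  have t4 : (δ * δi.map D).trace = -(δi * δ.map D).trace := by
    rw [hδi', Matrix.mul_neg, ← Matrix.mul_assoc, ← Matrix.mul_assoc, h.mul_inv, Matrix.one_mul,
      Matrix.trace_neg, (h.hδ.map hD).trace_mul_comm h.hδi]
    simp
  have hmap : (α - β * δi * γ).map D = α.map D - (β.map D * δi * γ -
      sg d • (β * (δi * δ.map D * δi) * γ) + sg d • (β * δi * γ.map D)) := by
    rw [map_sub', hD.map_mul (h.hβ.mul h.hδi), hD.map_mul h.hβ, hδi']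
    simp [Matrix.add_mul, sub_eq_add_neg]
  rw [ber, hD.leib hN.leibnizDet_hom, hD.leibnizDet hN h.hE hNE,
    hD.leibnizDet h.hδi h.hδ h.inv_mul, mul_zero, sg_zero, one_smul, t4, hmap, strD, h.H_eq]
  have hc : ∀ z, z * leibnizDet δi = leibnizDet δi * z := fun z =>
    (SuperRing.even_comm (hom_zero_iff.1 h.hδi.leibnizDet_hom) z).symm
  rw [mul_assoc _ (Matrix.trace _) (leibnizDet δi), hc, ← mul_assoc, ← mul_assoc, ← mul_add]
  congr 1
  simp only [Matrix.mul_sub, Matrix.mul_add, Matrix.mul_smul, Matrix.trace_sub, Matrix.trace_add,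
    Matrix.trace_smul, t1, t2, t3, Matrix.add_mul, smul_smul, mul_neg, sg_mul_self, smul_neg]
  module

/-- The Berezinians of mutually inverse matrices have inverse logarithmic derivatives. -/
theorem sder_ber_mul_ber (h : IsBlockInv α E β F γ G δ H δi) {Hi : Matrix (Fin q) (Fin q) R}
    (h' : IsBlockInv E α F β G γ H δ Hi) {d : ZMod 2} {D : R →ₗ[ℝ] R} (hD : IsSDer d D) :
    D (ber α β γ δi * ber E F G Hi) = 0 := by
  have e1 := congrArg Matrix.trace (congrArg (fun M => M.map D) h.l11)
  have e2 := congrArg Matrix.trace (congrArg (fun M => M.map D) h.l22)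
  have hadd : ∀ {k : ℕ} (A B : Matrix (Fin k) (Fin k) R), (A + B).map D = A.map D + B.map D := by
    intro k A B
    ext i j
    simp
  simp only [hadd, hD.map_mul h.hα, hD.map_mul h.hβ, hD.map_mul h.hγ, hD.map_mul h.hδ, hD.map_one,
    Matrix.trace_add, Matrix.trace_zero, Matrix.trace_smul, (h.hα.map hD).trace_mul_comm h.hE,
    (h.hβ.map hD).trace_mul_comm h.hG, (h.hγ.map hD).trace_mul_comm h.hF,
    (h.hδ.map hD).trace_mul_comm h.hH, mul_zero, mul_one, sg_zero, one_smul, sg_add, sg_one,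
    mul_neg] at e1 e2
  -- The sum of the two logarithmic derivatives is the supertrace of the derivative of the product
  -- of the matrices, which is constant: the trace of the even-even block minus that of the odd-odd
  -- block.
  have e3 : strD d D α E β F γ G δ H + strD d D E α F β G γ H δ = 0 := by
    have e4 := congrArg₂ (· - ·) e1 e2
    simp only [sub_zero] at e4
    rw [← e4, strD, strD]
    module
  have hc := SuperRing.even_comm (hom_zero_iff.1 h'.ber_hom)
  rw [hD.leib h.ber_hom, h.sder_ber hD, h'.sder_ber hD, mul_zero, sg_zero, one_smul,
    mul_assoc, ← hc, ← mul_assoc, ← mul_assoc, ← mul_add, e3, mul_zero]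

end IsBlockInv

end Determinant

/-! ## Grassmann algebras as supercommutative algebras -/

section Grassmann

variable {ο ο' : Type*}

/-- Induction on the number of generators. -/
theorem gr_induction {C : Gr ο → Prop} (halg : ∀ r : ℝ, C (algebraMap ℝ (Gr ο) r))
    (hadd : ∀ x y, C x → C y → C (x + y))
    (hι : ∀ (v : ο → ℝ) (x : Gr ο), C x → C (ExteriorAlgebra.ι ℝ v * x)) (x : Gr ο) : C x :=
  CliffordAlgebra.left_induction (Q := (0 : QuadraticForm ℝ (ο → ℝ))) halg hadd
    (fun x v hx => hι v x hx) x

/-- The parity automorphism as an algebra homomorphism. -/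
def grInv : Gr ο →ₐ[ℝ] Gr ο :=
  CliffordAlgebra.involute (Q := (0 : QuadraticForm ℝ (ο → ℝ)))

theorem grInv_ι (v : ο → ℝ) : grInv (ExteriorAlgebra.ι ℝ v) = -ExteriorAlgebra.ι ℝ v :=
  CliffordAlgebra.involute_ι v

theorem grInv_grInv (x : Gr ο) : grInv (grInv x) = x := CliffordAlgebra.involute_involute x

theorem ι_mul_comm (v : ο → ℝ) (x : Gr ο) :
    x * ExteriorAlgebra.ι ℝ v = ExteriorAlgebra.ι ℝ v * grInv x := by
  induction x using gr_induction with
  | halg r => rw [Algebra.commutes, AlgHom.commutes]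
  | hadd x y hx hy => rw [add_mul, hx, hy, map_add, mul_add]
  | hι w x hx =>
    have h := ExteriorAlgebra.ι_add_mul_swap (R := ℝ) v w
    rw [mul_assoc, hx, map_mul, grInv_ι, neg_mul, mul_neg, ← mul_assoc, ← mul_assoc,
      eq_neg_of_add_eq_zero_left h, neg_mul, neg_neg]

instance : SuperRing (Gr ο) where
  inv := grInv
  inv_inv := grInv_grInv
  even_comm {x} hx y := by
    induction y using gr_induction with
    | halg r => rw [Algebra.commutes]
    | hadd y z hy hz => rw [mul_add, add_mul, hy, hz]
    | hι v y hy => rw [← mul_assoc, ι_mul_comm, hx, mul_assoc, hy, mul_assoc]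
  odd_comm {x} hx y := by
    induction y using gr_induction with
    | halg r => rw [AlgHom.commutes, Algebra.commutes]
    | hadd y z hy hz => rw [map_add, mul_add, add_mul, hy, hz]
    | hι v y hy =>
      rw [mul_assoc, hy, ← mul_assoc, map_mul, grInv_ι, ← mul_assoc, mul_neg, ι_mul_comm, hx]
      simp

theorem inv_eq_grInv (x : Gr ο) : SuperRing.inv x = grInv x := rfl

theorem hom_ι (v : ο → ℝ) : Hom 1 (ExteriorAlgebra.ι ℝ v : Gr ο) :=
  hom_one_iff.2 (grInv_ι v)

theorem hom_gen [DecidableEq ο] (α : ο) : Hom 1 (gen α) := hom_ι _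

theorem hom_algebraMap {R : Type*} [Ring R] [Algebra ℝ R] [SuperRing R] (r : ℝ) :
    Hom 0 (algebraMap ℝ R r) := by simp [Hom]

/-- The two graded parts span the algebra and lie in the ±1 eigenspaces of the involution. Since 2
is invertible, each part is the whole eigenspace. -/
theorem mem_parityPart_iff {d : ZMod 2} {x : Gr ο} : x ∈ parityPart ο d ↔ Hom d x := by
  have h1 : ∀ {d : ZMod 2} {x : Gr ο}, x ∈ parityPart ο d → Hom d x := by
    intro d x hx
    rcases eq_zero_or_eq_one d with rfl | rfl
    · exact hom_zero_iff.2 (CliffordAlgebra.involute_eq_of_mem_even hx)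
    · exact hom_one_iff.2 (CliffordAlgebra.involute_eq_of_mem_odd hx)
  refine ⟨h1, fun hx => ?_⟩
  have hx' : x ∈ (⊤ : Submodule ℝ (Gr ο)) := Submodule.mem_top
  rw [← (CliffordAlgebra.evenOdd_isCompl (0 : QuadraticForm ℝ (ο → ℝ))).sup_eq_top] at hx'
  obtain ⟨y, hy, z, hz, rfl⟩ := Submodule.mem_sup.1 hx'
  have hy' := h1 (d := 0) hy
  have hz' := h1 (d := 1) hz
  simp only [Hom] at hx hy' hz'
  rw [map_add, hy', hz'] at hx
  rcases eq_zero_or_eq_one d with rfl | rfl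
  · have hz0 : z = 0 := by
      refine eq_zero_of_eq_neg ?_
      simpa [eq_comm] using hx
    rw [hz0, add_zero]
    exact hy
  · have hy0 : y = 0 := by
      refine eq_zero_of_eq_neg ?_
      simp only [sg_zero, one_smul, sg_one, neg_smul, neg_add] at hx
      exact add_right_cancel hx
    rw [hy0, zero_add]
    exact hz

/-- The left derivative of the Grassmann algebra in the generator `α`. -/
def oddD (α : ο) : Gr ο →ₗ[ℝ] Gr ο :=
  CliffordAlgebra.contractLeft (Q := (0 : QuadraticForm ℝ (ο → ℝ))) (LinearMap.proj α)

theorem oddD_ι_mul (α : ο) (v : ο → ℝ) (x : Gr ο) :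
    oddD α (ExteriorAlgebra.ι ℝ v * x) = v α • x - ExteriorAlgebra.ι ℝ v * oddD α x :=
  CliffordAlgebra.contractLeft_ι_mul _ _ _

@[simp] theorem oddD_algebraMap (α : ο) (r : ℝ) : oddD α (algebraMap ℝ (Gr ο) r) = 0 :=
  CliffordAlgebra.contractLeft_algebraMap _ _ _

theorem oddD_comm (α β : ο) (x : Gr ο) : oddD α (oddD β x) = -oddD β (oddD α x) :=
  CliffordAlgebra.contractLeft_comm _ _ _

theorem oddD_gen [DecidableEq ο] (α β : ο) : oddD α (gen β) = if α = β then 1 else 0 := by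
  have h := oddD_ι_mul α (Pi.single β 1) (1 : Gr ο)
  rw [← map_one (algebraMap ℝ (Gr ο)), oddD_algebraMap, mul_zero, sub_zero, map_one, mul_one] at h
  rw [gen, h, Pi.single_apply]
  split_ifs <;> simp

theorem inv_oddD (α : ο) (x : Gr ο) : SuperRing.inv (oddD α x) = -oddD α (SuperRing.inv x) := by
  simp only [inv_eq_grInv]
  induction x using gr_induction with
  | halg r => simp
  | hadd x y hx hy => simp only [map_add, hx, hy, neg_add]
  | hι v x hx =>
    rw [oddD_ι_mul, map_sub, map_smul, map_mul, map_mul, grInv_ι, hx, neg_mul, neg_mul, map_neg,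
      oddD_ι_mul]
    simp only [mul_neg, neg_neg, neg_sub]

theorem isSDer_oddD (α : ο) : IsSDer 1 (oddD α) where
  leib {e x} hx y := by
    have key : ∀ x y : Gr ο, oddD α (x * y) = oddD α x * y + grInv x * oddD α y := by
      intro x y
      induction x using gr_induction with
      | halg r => simp [← Algebra.smul_def]
      | hadd x z hx hz => simp only [map_add, add_mul, hx, hz]; abel
      | hι v x hx =>
        rw [mul_assoc, oddD_ι_mul, hx, oddD_ι_mul, map_mul, grInv_ι]
        simp only [sub_mul, mul_add, smul_mul_assoc, neg_mul, mul_assoc]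
        abel
    rw [key, one_mul, ← smul_mul_assoc, ← inv_eq_grInv, hx]
  inv x := by simp [inv_oddD]

/-- The body as an algebra homomorphism. -/
def bodyHom : Gr ο →ₐ[ℝ] ℝ := ExteriorAlgebra.algebraMapInv

theorem body_eq (x : Gr ο) : body x = bodyHom x := rfl

@[simp] theorem bodyHom_ι (v : ο → ℝ) : bodyHom (ExteriorAlgebra.ι ℝ v) = 0 := by
  simp [bodyHom, ExteriorAlgebra.algebraMapInv]

theorem bodyHom_inv (x : Gr ο) : bodyHom (SuperRing.inv x) = bodyHom x := by
  rw [inv_eq_grInv]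
  induction x using gr_induction with
  | halg r => simp
  | hadd x y hx hy => simp only [map_add, hx, hy]
  | hι v x hx => simp [grInv_ι]

theorem bodyHom_of_odd {x : Gr ο} (hx : Hom 1 x) : bodyHom x = 0 := by
  have h := bodyHom_inv x
  rw [hom_one_iff.1 hx, map_neg] at h
  linarith

theorem soul_eq (x : Gr ο) : soul x = x - algebraMap ℝ (Gr ο) (bodyHom x) := rfl

/-- The linear map that kills the coordinates in `s`. -/
def killCoord (s : Set ο) : (ο → ℝ) →ₗ[ℝ] (ο → ℝ) where
  toFun v := sᶜ.indicator v
  map_add' _ _ := Set.indicator_add _ _ _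
  map_smul' c v := Set.indicator_const_smul sᶜ c v

/-- Taylor's formula in one odd variable: an element has degree at most one in each generator. -/
theorem map_killCoord_add [DecidableEq ο] (α : ο) (x : Gr ο) :
    ExteriorAlgebra.map (killCoord {α}) x + gen α * oddD α x = x := by
  induction x using gr_induction with
  | halg r => simp
  | hadd x y hx hy =>
    conv_rhs => rw [← hx, ← hy]
    simp only [map_add, mul_add]
    abel
  | hι v x hx =>
    have hv : v = killCoord {α} v + v α • Pi.single α 1 := by
      ext β
      by_cases h : β = α
      · subst h
        simp [killCoord]
      · simp [killCoord, h]
    have h1 : ExteriorAlgebra.ι ℝ (killCoord {α} v) = ExteriorAlgebra.ι ℝ v - v α • gen α := by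
      rw [eq_sub_iff_add_eq, gen, ← map_smul, ← map_add, ← hv]
    have h2 : gen α * ExteriorAlgebra.ι ℝ v = -(ExteriorAlgebra.ι ℝ v * gen α) :=
      eq_neg_of_add_eq_zero_left (ExteriorAlgebra.ι_add_mul_swap _ _)
    have h3 : gen α * gen α = (0 : Gr ο) := ExteriorAlgebra.ι_sq_zero _
    have h4 : ExteriorAlgebra.map (killCoord {α}) x = x - gen α * oddD α x :=
      eq_sub_of_add_eq hx
    rw [map_mul, ExteriorAlgebra.map_apply_ι, h1, oddD_ι_mul, h4]
    simp only [mul_sub, sub_mul, mul_smul_comm, smul_mul_assoc, ← mul_assoc, h2, h3, neg_mul]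
    simp only [zero_mul, smul_zero]
    abel

theorem map_zero_eq (x : Gr ο) :
    ExteriorAlgebra.map (0 : (ο → ℝ) →ₗ[ℝ] (ο → ℝ)) x = algebraMap ℝ (Gr ο) (bodyHom x) := by
  induction x using gr_induction with
  | halg r => simp
  | hadd x y hx hy => simp [hx, hy]
  | hι v x hx => simp

/-- An element annihilated by all derivatives is a scalar. -/
theorem eq_algebraMap_of_oddD_eq_zero [Fintype ο] {x : Gr ο} (hx : ∀ α, oddD α x = 0) :
    x = algebraMap ℝ (Gr ο) (bodyHom x) := by
  classical
  -- Setting one generator to zero changes an element by a multiple of its derivative, here zero. So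
  -- all generators can be set to zero one after the other, which leaves the body.
  have key : ∀ s : Finset ο, ExteriorAlgebra.map (killCoord (s : Set ο)) x = x := by
    intro s
    induction s using Finset.induction_on with
    | empty =>
      have : killCoord ((∅ : Finset ο) : Set ο) = LinearMap.id := by
        ext v
        simp [killCoord]
      rw [this, ExteriorAlgebra.map_id]
      rfl
    | insert a s _ ih =>
      have h1 : killCoord ((insert a s : Finset ο) : Set ο) =
          (killCoord {a}).comp (killCoord (s : Set ο)) := by
        refine LinearMap.ext fun v => funext fun β => ?_
        by_cases h : β = a <;> by_cases h' : β ∈ s <;> simp [killCoord, h, h']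
      rw [h1, ← ExteriorAlgebra.map_comp_map, AlgHom.comp_apply, ih]
      have := map_killCoord_add a x
      rwa [hx, mul_zero, add_zero] at this
  have h0 : killCoord ((Finset.univ : Finset ο) : Set ο) = 0 := by
    refine LinearMap.ext fun v => funext fun β => ?_
    simp [killCoord]
  rw [← map_zero_eq, ← h0, key]

/-- The ideal of elements with body zero. -/
def aug (ο : Type*) : Submodule ℝ (Gr ο) := LinearMap.ker (bodyHom (ο := ο)).toLinearMap

theorem mem_aug {x : Gr ο} : x ∈ aug ο ↔ bodyHom x = 0 := Iff.rfl

theorem soul_mem_aug (x : Gr ο) : soul x ∈ aug ο := by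
  simp [mem_aug, soul_eq]

/-- The ideal is generated by the generator space `V`, and `V` can be moved to the left past
everything. A product of k elements is thus in the ideal generated by k-fold products of vectors,
and these vanish once k exceeds the dimension. All Taylor expansions terminate for this reason. -/
theorem aug_pow_eq_bot [Fintype ο] {k : ℕ} (hk : Fintype.card ο < k) : aug ο ^ k = ⊥ := by
  set V : Submodule ℝ (Gr ο) := LinearMap.range (ExteriorAlgebra.ι ℝ) with hV
  have h1 : aug ο ≤ V * ⊤ := by
    have h : ∀ x : Gr ο, x - algebraMap ℝ (Gr ο) (bodyHom x) ∈ V * ⊤ := by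
      intro x
      induction x using gr_induction with
      | halg r => simp
      | hadd x y hx hy =>
        have := add_mem hx hy
        rwa [sub_add_sub_comm, ← map_add, ← map_add] at this
      | hι v x hx =>
        simp only [map_mul, bodyHom_ι, zero_mul, map_zero, sub_zero]
        exact Submodule.mul_mem_mul ⟨v, rfl⟩ trivial
    intro x hx
    simpa [mem_aug.1 hx] using h x
  have h2 : (⊤ : Submodule ℝ (Gr ο)) * V ≤ V * ⊤ := by
    rw [Submodule.mul_le]
    rintro x - _ ⟨v, rfl⟩
    rw [ι_mul_comm]
    exact Submodule.mul_mem_mul ⟨v, rfl⟩ trivial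
  have h3 : ∀ k, (V * ⊤) ^ k ≤ V ^ k * ⊤ := by
    intro k
    induction k with
    | zero => 
      rw [pow_zero, pow_zero, one_mul]
      exact le_top
    | succ k ih =>
      calc (V * ⊤) ^ (k + 1) ≤ (V ^ k * ⊤) * (V * ⊤) := by
            rw [pow_succ]; exact mul_le_mul' ih le_rfl
        _ = V ^ k * (⊤ * V) * ⊤ := by simp only [mul_assoc]
        _ ≤ V ^ k * (V * ⊤) * ⊤ := mul_le_mul' (mul_le_mul' le_rfl h2) le_rfl
        _ = V ^ (k + 1) * (⊤ * ⊤) := by rw [pow_succ]; simp only [mul_assoc]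
        _ ≤ V ^ (k + 1) * ⊤ := mul_le_mul' le_rfl le_top
  have h4 : V ^ k = ⊥ := by
    rw [eq_bot_iff, hV, ← ExteriorAlgebra.exteriorPower, ← ExteriorAlgebra.ιMulti_span_fixedDegree,
      Submodule.span_le]
    rintro _ ⟨v, rfl⟩
    refine AlternatingMap.map_linearDependent _ _ fun h => ?_
    have := h.fintype_card_le_finrank
    simp at this
    omega
  rw [eq_bot_iff]
  refine (pow_le_pow_left' h1 k).trans ((h3 k).trans ?_)
  rw [h4, Submodule.bot_mul]

end Grassmann

/-! ## Homomorphisms of Grassmann algebras -/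

section GrassmannHom

variable {ο ο' ο'' : Type*}

theorem isSHom_map (L : (ο → ℝ) →ₗ[ℝ] (ο' → ℝ)) :
    IsSHom (ExteriorAlgebra.map L : Gr ο →ₐ[ℝ] Gr ο') := by
  intro x
  simp only [inv_eq_grInv]
  induction x using gr_induction with
  | halg r => simp
  | hadd x y hx hy => simp only [map_add, hx, hy]
  | hι v x hx =>
    simp only [map_mul, hx, ExteriorAlgebra.map_apply_ι, grInv_ι, map_neg]

theorem isSHom_relabel (φ : ο → ο') : IsSHom (relabel φ) := isSHom_map _

theorem isSHom_killRest (φ : ο → ο') : IsSHom (killRest φ) := isSHom_map _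

/-- Homomorphisms that preserve parity preserve the body. -/
theorem IsSHom.bodyHom {χ : Gr ο →ₐ[ℝ] Gr ο'} (hχ : IsSHom χ) (x : Gr ο) :
    bodyHom (χ x) = SuperGeom.bodyHom x := by
  induction x using gr_induction with
  | halg r => simp
  | hadd x y hx hy => simp only [map_add, hx, hy]
  | hι v x hx => simp [bodyHom_of_odd (hχ.hom (hom_ι v))]

theorem IsSHom.soul {χ : Gr ο →ₐ[ℝ] Gr ο'} (hχ : IsSHom χ) (x : Gr ο) :
    SuperGeom.soul (χ x) = χ (SuperGeom.soul x) := by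
  simp [soul_eq, hχ.bodyHom]

theorem extend_single [DecidableEq ο] [DecidableEq ο'] {φ : ο → ο'} (hφ : φ.Injective) (α : ο)
    (c : ℝ) : Function.ExtendByZero.linearMap ℝ φ (Pi.single α c) = Pi.single (φ α) c := by
  ext β
  simp only [Function.ExtendByZero.linearMap_apply]
  by_cases h : ∃ γ, φ γ = β
  · obtain ⟨γ, rfl⟩ := h
    rw [hφ.extend_apply, Pi.single_apply, Pi.single_apply]
    simp [hφ.eq_iff]
  · rw [Function.extend_apply' _ _ _ h, Pi.single_apply, if_neg]
    · rfl
    · rintro rfl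
      exact h ⟨α, rfl⟩

@[simp] theorem relabel_gen [DecidableEq ο] [DecidableEq ο'] {φ : ο → ο'} (hφ : φ.Injective)
    (α : ο) : relabel φ (gen α) = gen (φ α) := by
  rw [relabel, gen, ExteriorAlgebra.map_apply_ι, extend_single hφ, gen]

theorem relabel_id (x : Gr ο) : relabel id x = x := by
  have : Function.ExtendByZero.linearMap ℝ (id : ο → ο) = LinearMap.id := by
    refine LinearMap.ext fun v => funext fun β => ?_
    exact Function.injective_id.extend_apply v 0 β
  rw [relabel, this, ExteriorAlgebra.map_id]
  rfl

theorem killRest_relabel {φ : ο → ο'} (hφ : φ.Injective) (x : Gr ο) :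
    killRest φ (relabel φ x) = x := by
  have : (LinearMap.funLeft ℝ ℝ φ).comp (Function.ExtendByZero.linearMap ℝ φ) =
      LinearMap.id := by
    refine LinearMap.ext fun v => funext fun β => ?_
    exact hφ.extend_apply v 0 β
  rw [relabel, killRest, ← AlgHom.comp_apply, ExteriorAlgebra.map_comp_map, this,
    ExteriorAlgebra.map_id]
  rfl

theorem killRest_gen [DecidableEq ο'] {φ : ο → ο'} {β : ο'} (hβ : ∀ α, φ α ≠ β) :
    killRest φ (gen β) = 0 := by
  have : LinearMap.funLeft ℝ ℝ φ (Pi.single β 1) = 0 := by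
    funext α
    simp [LinearMap.funLeft_apply, hβ α]
  rw [killRest, gen, ExteriorAlgebra.map_apply_ι, this, map_zero]

/-- Taylor's formula in the single generator missed by `φ`. It shows that an element with zero
projection is divisible by that generator. -/
theorem relabel_killRest_add [DecidableEq ο'] {φ : ο → ο'} (hφ : φ.Injective) {β : ο'}
    (hβ : ∀ γ, (∃ α, φ α = γ) ↔ γ ≠ β) (x : Gr ο') :
    relabel φ (killRest φ x) + gen β * oddD β x = x := by
  have h : (Function.ExtendByZero.linearMap ℝ φ).comp (LinearMap.funLeft ℝ ℝ φ) =
      killCoord {β} := by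
    refine LinearMap.ext fun v => funext fun γ => ?_
    simp only [LinearMap.comp_apply, Function.ExtendByZero.linearMap_apply]
    by_cases hγ : γ = β
    · rw [Function.extend_apply' _ _ _ (fun h => (hβ γ).1 h hγ)]
      simp [killCoord, hγ]
    · obtain ⟨α, rfl⟩ := (hβ γ).2 hγ
      rw [hφ.extend_apply]
      simp [killCoord, hγ, LinearMap.funLeft_apply]
  conv_rhs => rw [← map_killCoord_add β x]
  rw [relabel, killRest, ← AlgHom.comp_apply, ExteriorAlgebra.map_comp_map, h]

/-! ### Substitution of odd elements for generators -/

section OddSubst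

variable [Fintype ο] {R : Type*} [Ring R] [Algebra ℝ R] [SuperRing R]

theorem Hom.mul_self {x : R} (hx : Hom 1 x) : x * x = 0 := by
  refine eq_zero_of_eq_neg ?_
  nth_rewrite 1 [hx.comm hx]
  simp

theorem hom_linearCombination {θ : ο → R} (hθ : ∀ α, Hom 1 (θ α)) (v : ο → ℝ) :
    Hom 1 (Fintype.linearCombination ℝ θ v) := by
  rw [Fintype.linearCombination_apply]
  exact Hom.sum _ fun α _ => (hθ α).smul _

/-- The homomorphism from a Grassmann algebra that sends the generator `α` to the odd
element `θ α`. -/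
def oddSubst (θ : ο → R) (hθ : ∀ α, Hom 1 (θ α)) : Gr ο →ₐ[ℝ] R :=
  ExteriorAlgebra.lift ℝ ⟨Fintype.linearCombination ℝ θ, fun v =>
    (hom_linearCombination hθ v).mul_self⟩

variable {θ : ο → R} (hθ : ∀ α, Hom 1 (θ α))

theorem oddSubst_ι (v : ο → ℝ) :
    oddSubst θ hθ (ExteriorAlgebra.ι ℝ v) = Fintype.linearCombination ℝ θ v :=
  ExteriorAlgebra.lift_ι_apply ℝ _ _ _

theorem oddSubst_gen [DecidableEq ο] (α : ο) : oddSubst θ hθ (gen α) = θ α := by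
  rw [gen, oddSubst_ι]
  simp

theorem isSHom_oddSubst : IsSHom (oddSubst θ hθ) := by
  intro x
  induction x using gr_induction with
  | halg r => simp
  | hadd x y hx hy => simp only [map_add, hx, hy]
  | hι v x hx =>
    have h := hom_linearCombination hθ v
    simp only [Hom] at h
    rw [map_mul, map_mul, hx, oddSubst_ι, h, map_mul, map_mul, inv_eq_grInv, inv_eq_grInv,
      grInv_ι, map_neg, oddSubst_ι]
    simp

/-- The chain rule for odd substitutions, by induction on the number of generators. Moving `D (θ α)`
past an odd element produces the sign that matches the antiderivation rule of `oddD`. -/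
theorem IsSDer.oddSubst {d : ZMod 2} {D : R →ₗ[ℝ] R} (hD : IsSDer d D) (x : Gr ο) :
    D (oddSubst θ hθ x) = ∑ α, D (θ α) * SuperGeom.oddSubst θ hθ (oddD α x) := by
  induction x using gr_induction with
  | halg r => simp [hD.algebraMap]
  | hadd x y hx hy => simp only [map_add, hx, hy, mul_add, Finset.sum_add_distrib]
  | hι v x hx =>
    have h := hom_linearCombination hθ v
    have h2 : ∀ α, D (θ α) * Fintype.linearCombination ℝ θ v =
        -(sg d • (Fintype.linearCombination ℝ θ v * D (θ α))) := by
      intro α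
      rw [(hD.hom (hθ α)).comm h, mul_one, sg_add]
      simp
    rw [_root_.map_mul, oddSubst_ι, hD.leib h, hx, mul_one]
    simp only [oddD_ι_mul, map_sub, _root_.map_mul, map_smul, oddSubst_ι, mul_sub,
      Finset.sum_sub_distrib, ← mul_assoc, h2]
    rw [Fintype.linearCombination_apply, map_sum]
    simp only [map_smul, Finset.sum_mul, Finset.mul_sum, smul_mul_assoc, mul_smul_comm, neg_mul,
      Finset.sum_neg_distrib, sub_neg_eq_add, Finset.smul_sum, mul_assoc]

/-- Homomorphisms from a Grassmann algebra are determined by the images of the generators. -/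
theorem comp_oddSubst {R' : Type*} [Ring R'] [Algebra ℝ R'] [SuperRing R'] (χ : R →ₐ[ℝ] R')
    (hχ : ∀ α, Hom 1 (χ (θ α))) (x : Gr ο) :
    χ (oddSubst θ hθ x) = oddSubst (fun α => χ (θ α)) hχ x := by
  induction x using gr_induction with
  | halg r => simp
  | hadd x y hx hy => simp only [map_add, hx, hy]
  | hι v x hx =>
    rw [map_mul, map_mul, map_mul, hx, oddSubst_ι, oddSubst_ι, Fintype.linearCombination_apply,
      Fintype.linearCombination_apply, map_sum]
    simp

theorem substOdd_eq {y : ο → Gr ο'} (hy : ∀ α, Hom 1 (y α)) : substOdd y = oddSubst y hy := by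
  rw [substOdd, dif_pos]
  rfl

theorem oddSubst_relabel [Fintype ο'] {φ : ο → ο'} (hφ : φ.Injective) {θ : ο' → R}
    (hθ : ∀ α, Hom 1 (θ α)) (x : Gr ο) :
    oddSubst θ hθ (relabel φ x) = oddSubst (fun α => θ (φ α)) (fun _ => hθ _) x := by
  classical
  induction x using gr_induction with
  | halg r => simp
  | hadd x y hx hy => simp only [map_add, hx, hy]
  | hι v x hx =>
    have h1 : relabel φ (ExteriorAlgebra.ι ℝ v) = ∑ α, v α • gen (φ α) := by
      conv_lhs => rw [pi_eq_sum_univ' v]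
      rw [map_sum, map_sum]
      refine Finset.sum_congr rfl fun α _ => ?_
      rw [← relabel_gen hφ, gen, ← map_smul, ← map_smul]
    rw [map_mul, map_mul, map_mul, hx, oddSubst_ι, h1, map_sum]
    simp only [map_smul, oddSubst_gen, Fintype.linearCombination_apply]

theorem oddSubst_gen_eq [DecidableEq ο] (x : Gr ο) : oddSubst gen hom_gen x = x := by
  have : oddSubst (gen (ο := ο)) hom_gen = AlgHom.id ℝ (Gr ο) := by
    refine ExteriorAlgebra.hom_ext ?_
    refine LinearMap.pi_ext' fun α => ?_
    ext
    simpa [gen] using oddSubst_gen (hom_gen (ο := ο)) α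
  rw [this]
  rfl

end OddSubst

end GrassmannHom

/-! ## Smooth superfunctions -/

section Smooth

variable {ε ο ο' : Type*} [Fintype ε] [Fintype ο] [DecidableEq ε] [DecidableEq ο]
  [Fintype ο'] [DecidableEq ο'] {U : Set (ε → ℝ)}

theorem gr_sum_repr (x : Gr ο) : ∑ k, (grBasis ο).repr x k • grBasis ο k = x :=
  (grBasis ο).sum_repr x

theorem gr_ext {x y : Gr ο} (h : ∀ k, (grBasis ο).repr x k = (grBasis ο).repr y k) : x = y :=
  (grBasis ο).ext_elem h

theorem functional_apply (L : Gr ο →ₗ[ℝ] ℝ) (x : Gr ο) :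
    L x = ∑ k, (grBasis ο).repr x k * L (grBasis ο k) := by
  conv_lhs => rw [← gr_sum_repr x]
  simp only [map_sum, map_smul, smul_eq_mul]

theorem SmoothOn.congr {f g : SFun ε ο} (hf : SmoothOn f U) (h : EqOn g f U) : SmoothOn g U :=
  fun k => (hf k).congr fun x hx => by rw [h hx]

theorem SmoothOn.mono {f : SFun ε ο} {V : Set (ε → ℝ)} (hf : SmoothOn f U) (h : V ⊆ U) :
    SmoothOn f V :=
  fun k => (hf k).mono h

/-- The value of a linear functional on a smooth superfunction is smooth. -/
theorem SmoothOn.functional {f : SFun ε ο} (hf : SmoothOn f U) (L : Gr ο →ₗ[ℝ] ℝ) :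
    ContDiffOn ℝ ∞ (fun x => L (f x)) U := by
  have h : (fun x => L (f x)) = fun x => ∑ k, (grBasis ο).repr (f x) k * L (grBasis ο k) := by
    funext x
    exact functional_apply L _
  rw [h]
  exact ContDiffOn.sum fun k _ => (hf k).mul contDiffOn_const

theorem SmoothOn.map {f : SFun ε ο} (hf : SmoothOn f U) (χ : Gr ο →ₗ[ℝ] Gr ο') :
    SmoothOn (fun x => χ (f x)) U :=
  fun k => hf.functional ((grBasis ο').coord k ∘ₗ χ)

/-- A functional is a combination of the basis coordinates with constant coefficients, so it
commutes with differentiation. Hence the even derivatives do not depend on the basis and commute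
with linear maps of Grassmann algebras. -/
theorem fderiv_functional {f : SFun ε ο} (hU : IsOpen U) (hf : SmoothOn f U) {x : ε → ℝ}
    (hx : x ∈ U) (L : Gr ο →ₗ[ℝ] ℝ) (i : ε) :
    fderiv ℝ (fun z => L (f z)) x (Pi.single i 1) = L (evenDeriv i f x) := by
  have h : (fun x => L (f x)) = fun x => ∑ k, (grBasis ο).repr (f x) k * L (grBasis ο k) := by
    funext x
    exact functional_apply L _
  rw [h, fderiv_fun_sum fun k _ => (hf.differentiableAt hU hx k).mul_const _]
  simp only [fderiv_mul_const (hf.differentiableAt hU hx _), FunLike.coe_sum,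
    Finset.sum_apply, evenDeriv, map_sum, map_smul, smul_apply, smul_eq_mul]
  exact Finset.sum_congr rfl fun k _ => mul_comm _ _

theorem evenDeriv_map {f : SFun ε ο} (hU : IsOpen U) (hf : SmoothOn f U) {x : ε → ℝ}
    (hx : x ∈ U) (χ : Gr ο →ₗ[ℝ] Gr ο') (i : ε) :
    evenDeriv i (fun z => χ (f z)) x = χ (evenDeriv i f x) := by
  refine gr_ext fun k => ?_
  rw [repr_evenDeriv]
  exact fderiv_functional hU hf hx ((grBasis ο').coord k ∘ₗ χ) i

theorem smoothOn_const (c : Gr ο) : SmoothOn (fun _ : ε → ℝ => c) U :=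
  fun _ => contDiffOn_const

theorem evenDeriv_const (c : Gr ο) (i : ε) (x : ε → ℝ) :
    evenDeriv i (fun _ => c) x = 0 := by
  simp [evenDeriv]

/-- Multiplication is bilinear with constant structure constants, which reduces smoothness and the
Leibniz rule for products to real functions. -/
theorem repr_mul (x y : Gr ο) (k) : (grBasis ο).repr (x * y) k =
    ∑ a, ∑ b, (grBasis ο).repr x a * (grBasis ο).repr y b *
      (grBasis ο).repr (grBasis ο a * grBasis ο b) k := by
  conv_lhs => rw [← gr_sum_repr x, ← gr_sum_repr y]
  simp only [Finset.sum_mul, Finset.mul_sum, map_sum, Finsupp.finsetSum_apply, smul_mul_smul_comm,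
    map_smul, Finsupp.smul_apply, smul_eq_mul]
  rw [Finset.sum_comm]

theorem SmoothOn.mul {f g : SFun ε ο} (hf : SmoothOn f U) (hg : SmoothOn g U) :
    SmoothOn (f * g) U := by
  intro k
  refine ContDiffOn.congr ?_ fun x _ => repr_mul (f x) (g x) k
  exact ContDiffOn.sum fun a _ => ContDiffOn.sum fun b _ =>
    ((hf a).mul (hg b)).mul contDiffOn_const

theorem evenDeriv_mul {f g : SFun ε ο} (hU : IsOpen U) (hf : SmoothOn f U) (hg : SmoothOn g U)
    (i : ε) {x : ε → ℝ} (hx : x ∈ U) :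
    evenDeriv i (f * g) x = evenDeriv i f x * g x + f x * evenDeriv i g x := by
  refine gr_ext fun k => ?_
  have hf' := fun a => hf.differentiableAt hU hx a
  have hg' := fun a => hg.differentiableAt hU hx a
  have e : (fun z => (grBasis ο).repr ((f * g) z) k) = fun z =>
      ∑ a, ∑ b, (grBasis ο).repr (f z) a * (grBasis ο).repr (g z) b *
        (grBasis ο).repr (grBasis ο a * grBasis ο b) k :=
    funext fun z => repr_mul (f z) (g z) k
  rw [repr_evenDeriv, e, fderiv_fun_sum fun a _ => DifferentiableAt.fun_sum fun b _ =>
    ((hf' a).fun_mul (hg' b)).mul_const _]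
  rw [map_add, Finsupp.add_apply, repr_mul, repr_mul, ← Finset.sum_add_distrib, FunLike.coe_sum,
    Finset.sum_apply]
  refine Finset.sum_congr rfl fun a _ => ?_
  rw [fderiv_fun_sum fun b _ => ((hf' a).fun_mul (hg' b)).mul_const _, FunLike.coe_sum,
    Finset.sum_apply, ← Finset.sum_add_distrib]
  refine Finset.sum_congr rfl fun b _ => ?_
  rw [fderiv_mul_const ((hf' a).fun_mul (hg' b)), fderiv_fun_mul (hf' a) (hg' b), repr_evenDeriv,
    repr_evenDeriv]
  simp only [smul_apply, add_apply, smul_eq_mul]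
  ring

theorem evenDeriv_comm {f : SFun ε ο} (hU : IsOpen U) (hf : SmoothOn f U) (i j : ε) {x : ε → ℝ}
    (hx : x ∈ U) : evenDeriv i (evenDeriv j f) x = evenDeriv j (evenDeriv i f) x := by
  refine gr_ext fun k => ?_
  simp only [repr_evenDeriv]
  have h1 : ContDiffAt ℝ ∞ (fun z => (grBasis ο).repr (f z) k) x :=
    (hf k).contDiffAt (hU.mem_nhds hx)
  have h2 : DifferentiableAt ℝ (fderiv ℝ fun z => (grBasis ο).repr (f z) k) x :=
    (h1.fderiv_right (m := ∞) (by simp)).differentiableAt (by simp)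
  have h3 : ∀ i j : ε, fderiv ℝ (fun z => fderiv ℝ (fun z => (grBasis ο).repr (f z) k) z
      (Pi.single j 1)) x (Pi.single i 1) =
      fderiv ℝ (fderiv ℝ fun z => (grBasis ο).repr (f z) k) x (Pi.single i 1)
        (Pi.single j 1) := by
    intro i j
    rw [fderiv_clm_apply h2 (differentiableAt_const _)]
    simp
  rw [h3, h3]
  exact (h1.isSymmSndFDerivAt (by
    rw [minSmoothness_of_isRCLikeNormedField]
    exact WithTop.coe_le_coe.2 (le_top : (2 : ℕ∞) ≤ ⊤))).eq _ _

theorem evenDeriv_fsmul {φ : (ε → ℝ) → ℝ} {f : SFun ε ο} (hU : IsOpen U)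
    (hφ : ContDiffOn ℝ ∞ φ U) (hf : SmoothOn f U) (i : ε) {x : ε → ℝ} (hx : x ∈ U) :
    evenDeriv i (fun z => φ z • f z) x =
      fderiv ℝ φ x (Pi.single i 1) • f x + φ x • evenDeriv i f x := by
  refine gr_ext fun k => ?_
  have h1 : DifferentiableAt ℝ φ x :=
    (hφ.contDiffAt (hU.mem_nhds hx)).differentiableAt (by simp)
  rw [repr_evenDeriv]
  simp only [map_smul, map_add, Finsupp.smul_apply, Finsupp.add_apply, repr_evenDeriv, smul_eq_mul]
  rw [fderiv_fun_mul h1 (hf.differentiableAt hU hx k)]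
  simp [add_comm, mul_comm]

theorem smoothOn_fsmul {φ : (ε → ℝ) → ℝ} {f : SFun ε ο} (hφ : ContDiffOn ℝ ∞ φ U)
    (hf : SmoothOn f U) : SmoothOn (fun z => φ z • f z) U := by
  intro k
  simpa using hφ.mul (hf k)

end Smooth

open TopologicalSpace (Opens)

/-! ## The supercommutative algebra of smooth superfunctions on an open set -/

section Sm

variable {ε : Type*} (ο : Type*) [Fintype ε] [Fintype ο] [DecidableEq ε] [DecidableEq ο]

/-- The smooth superfunctions on the open set `U`, as a subalgebra. -/
def smAlg (U : Opens (ε → ℝ)) : Subalgebra ℝ (U → Gr ο) where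
  carrier := {g | ∃ f : SFun ε ο, SmoothOn f U ∧ ∀ x : U, g x = f x}
  mul_mem' := by
    rintro g h ⟨f, hf, hfg⟩ ⟨k, hk, hkh⟩
    exact ⟨f * k, hf.mul hk, fun x => by simp [hfg, hkh]⟩
  add_mem' := by
    rintro g h ⟨f, hf, hfg⟩ ⟨k, hk, hkh⟩
    exact ⟨f + k, hf.add hk, fun x => by simp [hfg, hkh]⟩
  algebraMap_mem' r := ⟨fun _ => algebraMap ℝ _ r, smoothOn_const _, fun _ => rfl⟩

/-- The algebra of smooth superfunctions on the open set `U`. -/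
def Sm (U : Opens (ε → ℝ)) : Type _ := smAlg ο U

variable {ο} {U : Opens (ε → ℝ)}

instance : Ring (Sm ο U) := inferInstanceAs (Ring (smAlg ο U))

instance : Algebra ℝ (Sm ο U) := inferInstanceAs (Algebra ℝ (smAlg ο U))

namespace Sm

/-- The element of `Sm ο U` given by a smooth superfunction. -/
def mk (f : SFun ε ο) (hf : SmoothOn f U) : Sm ο U := ⟨fun x => f x, f, hf, fun _ => rfl⟩

/-- A superfunction that represents an element of `Sm ο U`. -/
def out (g : Sm ο U) : SFun ε ο := g.2.choose

theorem smooth_out (g : Sm ο U) : SmoothOn (out g) U := g.2.choose_spec.1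

theorem out_apply (g : Sm ο U) (x : U) : (out g) x = g.1 x := (g.2.choose_spec.2 x).symm

@[simp] theorem mk_apply (f : SFun ε ο) (hf : SmoothOn f U) (x : U) : (mk f hf).1 x = f x := rfl

theorem ext {g h : Sm ο U} (H : ∀ x, g.1 x = h.1 x) : g = h := Subtype.ext (funext H)

theorem mk_eq_mk {f g : SFun ε ο} {hf : SmoothOn f U} {hg : SmoothOn g U} :
    mk f hf = mk g hg ↔ EqOn f g U :=
  ⟨fun h x hx => congrFun (congrArg Subtype.val h) ⟨x, hx⟩, fun h => ext fun x => h x.2⟩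

theorem mk_out (g : Sm ο U) : mk (out g) (smooth_out g) = g := ext (out_apply g)

@[elab_as_elim]
theorem ind {C : Sm ο U → Prop} (h : ∀ f hf, C (mk f hf)) (g : Sm ο U) : C g :=
  mk_out g ▸ h _ _

@[simp] theorem mul_val (g h : Sm ο U) (x : U) : (g * h).1 x = g.1 x * h.1 x := rfl

@[simp] theorem add_val (g h : Sm ο U) (x : U) : (g + h).1 x = g.1 x + h.1 x := rfl

@[simp] theorem sub_val (g h : Sm ο U) (x : U) : (g - h).1 x = g.1 x - h.1 x := rfl

@[simp] theorem neg_val (g : Sm ο U) (x : U) : (-g).1 x = -g.1 x := rfl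

@[simp] theorem smul_val (c : ℝ) (g : Sm ο U) (x : U) : (c • g).1 x = c • g.1 x := rfl

@[simp] theorem one_val (x : U) : (1 : Sm ο U).1 x = 1 := rfl

@[simp] theorem zero_val (x : U) : (0 : Sm ο U).1 x = 0 := rfl

/-- Evaluation at a point. -/
def ev (x : U) : Sm ο U →ₐ[ℝ] Gr ο := (Pi.evalAlgHom ℝ (fun _ : U => Gr ο) x).comp (smAlg ο U).val

@[simp] theorem sum_val {ι : Type*} (s : Finset ι) (g : ι → Sm ο U) (x : U) :
    (∑ i ∈ s, g i).1 x = ∑ i ∈ s, (g i).1 x := map_sum (ev x) _ _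

/-- Composition with an algebra homomorphism of Grassmann algebras. -/
def mapHom (χ : Gr ο →ₐ[ℝ] Gr ο) : Sm ο U →ₐ[ℝ] Sm ο U where
  toFun g := ⟨fun x => χ (g.1 x), fun x => χ ((out g) x), (smooth_out g).map χ.toLinearMap, fun x =>
    congrArg χ (out_apply g x).symm⟩
  map_one' := ext fun _ => map_one χ
  map_mul' _ _ := ext fun _ => map_mul χ _ _
  map_zero' := ext fun _ => map_zero χ
  map_add' _ _ := ext fun _ => map_add χ _ _
  commutes' r := ext fun _ => χ.commutes r

instance : SuperRing (Sm ο U) where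
  inv := mapHom grInv
  inv_inv _ := ext fun _ => grInv_grInv _
  even_comm hg _ := ext fun x =>
    SuperRing.even_comm (R := Gr ο) (congrFun (congrArg Subtype.val hg) x) _
  odd_comm hg _ := ext fun x =>
    SuperRing.odd_comm (R := Gr ο) (congrFun (congrArg Subtype.val hg) x) _

theorem inv_val (g : Sm ο U) (x : U) : (SuperRing.inv g).1 x = SuperRing.inv (g.1 x) := rfl

theorem isSHom_ev (x : U) : IsSHom (ev (ο := ο) x) := fun _ => rfl

theorem hom_iff {d : ZMod 2} {g : Sm ο U} : Hom d g ↔ ∀ x, Hom d (g.1 x) :=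
  ⟨fun h x => (isSHom_ev x).hom h, fun h => ext h⟩

end Sm

/-- The parity of a coordinate. -/
def gpar {ε ο : Type*} : ε ⊕ ο → ZMod 2 := Sum.elim (fun _ => 0) (fun _ => 1)

theorem SmoothOn.oddDeriv {f : SFun ε ο} {U : Set (ε → ℝ)} (hf : SmoothOn f U) (α : ο) :
    SmoothOn (oddDeriv α f) U := hf.map (oddD α)

theorem SmoothOn.pderiv {f : SFun ε ο} {U : Set (ε → ℝ)} (hU : IsOpen U) (hf : SmoothOn f U)
    (a : ε ⊕ ο) : SmoothOn (pderiv a f) U := by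
  cases a with
  | inl i => exact hf.evenDeriv hU i
  | inr α => exact hf.oddDeriv α

theorem pderiv_congr {f g : SFun ε ο} {U : Set (ε → ℝ)} (hU : IsOpen U) (h : EqOn f g U)
    (a : ε ⊕ ο) : EqOn (pderiv a f) (pderiv a g) U := by
  cases a with
  | inl i => exact evenDeriv_congr hU h i
  | inr α => exact fun x hx => congrArg (oddD α) (h hx)

namespace Sm

/-- Because `U` is open, a derivative at a point of `U` does not see the extension chosen outside.
So `der` may be computed with any representative. -/
theorem derAux {f g : SFun ε ο} (h : EqOn f g U) (a : ε ⊕ ο) (x : U) :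
    pderiv a f x = pderiv a g x :=
  pderiv_congr U.2 h a x.2

/-- The partial derivative in the coordinate `a`. -/
def der (a : ε ⊕ ο) : Sm ο U →ₗ[ℝ] Sm ο U where
  toFun g := mk (pderiv a (out g)) ((smooth_out g).pderiv U.2 a)
  map_add' g h := ext fun x => by
    have e : EqOn (out (g + h)) (out g + out h) U := fun x hx => by
      simp [out_apply _ ⟨x, hx⟩]
    rw [mk_apply, derAux e]
    cases a with
    | inl i => exact evenDeriv_add U.2 (smooth_out g) (smooth_out h) i x.2
    | inr α => exact map_add (oddD α) _ _
  map_smul' c g := ext fun x => by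
    have e : EqOn (out (c • g)) (c • out g) U := fun x hx => by
      simp [out_apply _ ⟨x, hx⟩]
    rw [mk_apply, derAux e]
    cases a with
    | inl i => exact evenDeriv_smul U.2 (smooth_out g) c i x.2
    | inr α => exact map_smul (oddD α) _ _

theorem der_mk (a : ε ⊕ ο) (f : SFun ε ο) (hf : SmoothOn f U) :
    der a (mk f hf) = mk (pderiv a f) (hf.pderiv U.2 a) :=
  ext fun x => derAux (fun _ hx => out_apply (mk f hf) ⟨_, hx⟩) a x

theorem der_val (a : ε ⊕ ο) (g : Sm ο U) (x : U) : (der a g).1 x = pderiv a (out g) x := rfl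

theorem der_inr_val (α : ο) (g : Sm ο U) (x : U) : (der (Sum.inr α) g).1 x = oddD α (g.1 x) :=
  congrArg (oddD α) (out_apply g x)

theorem isSDer_der (a : ε ⊕ ο) : IsSDer (gpar a) (der (U := U) a) where
  leib {e g} hg h := by
    induction g using ind with | h f hf => ?_
    induction h using ind with | h k hk => ?_
    have e1 : mk f hf * mk k hk = mk (f * k) (hf.mul hk) := rfl
    refine ext fun x => ?_
    rw [e1, der_mk, der_mk, der_mk]
    cases a with
    | inl i =>
      simp only [gpar, Sum.elim_inl, zero_mul, sg_zero, one_smul]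
      exact evenDeriv_mul U.2 hf hk i x.2
    | inr α =>
      exact (isSDer_oddD α).leib (hom_iff.1 hg x) _
  inv g := by
    induction g using ind with | h f hf => ?_
    have e1 : SuperRing.inv (mk f hf) =
      mk (fun x => grInv.toLinearMap (f x)) (hf.map grInv.toLinearMap) := rfl
    refine ext fun x => ?_
    rw [e1, der_mk, der_mk]
    cases a with
    | inl i =>
      simp only [gpar, Sum.elim_inl, sg_zero, one_smul]
      exact (evenDeriv_map U.2 hf x.2 grInv.toLinearMap i).symm
    | inr α =>
      exact (isSDer_oddD α).inv _

theorem der_comm (a b : ε ⊕ ο) (g : Sm ο U) :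
    der a (der b g) = sg (gpar a * gpar b) • der b (der a g) := by
  induction g using ind with | h f hf => ?_
  simp only [der_mk]
  refine ext fun x => ?_
  rcases a with i | α <;> rcases b with j | β
  · simp only [gpar, Sum.elim_inl, zero_mul, sg_zero, one_smul]
    exact evenDeriv_comm U.2 hf i j x.2
  · simp only [gpar, Sum.elim_inl, zero_mul, sg_zero, one_smul]
    exact evenDeriv_map U.2 hf x.2 (oddD β) i
  · simp only [gpar, Sum.elim_inl, mul_zero, sg_zero, one_smul]
    exact (evenDeriv_map U.2 hf x.2 (oddD α) j).symm
  · simp only [gpar, Sum.elim_inr, mul_one, sg_one, neg_smul, one_smul]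
    exact oddD_comm α β _

end Sm

theorem smoothOn_real {φ : (ε → ℝ) → ℝ} {U : Set (ε → ℝ)} (hφ : ContDiffOn ℝ ∞ φ U) :
    SmoothOn (fun x => algebraMap ℝ (Gr ο) (φ x)) U := by
  simp only [Algebra.algebraMap_eq_smul_one]
  exact smoothOn_fsmul hφ (smoothOn_const 1)

theorem evenDeriv_real {φ : (ε → ℝ) → ℝ} {U : Set (ε → ℝ)} (hU : IsOpen U)
    (hφ : ContDiffOn ℝ ∞ φ U) (i : ε) {x : ε → ℝ} (hx : x ∈ U) :
    evenDeriv i (fun x => algebraMap ℝ (Gr ο) (φ x)) x =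
      algebraMap ℝ (Gr ο) (fderiv ℝ φ x (Pi.single i 1)) := by
  simp only [Algebra.algebraMap_eq_smul_one]
  rw [evenDeriv_fsmul hU hφ (smoothOn_const 1) i hx, evenDeriv_const, smul_zero, add_zero]

theorem smoothOn_coord (a : ε ⊕ ο) (U : Set (ε → ℝ)) : SmoothOn (coord a : SFun ε ο) U := by
  cases a with
  | inl i => exact smoothOn_real (contDiff_apply ℝ ℝ i).contDiffOn
  | inr α => exact smoothOn_const _

namespace Sm

/-- The real function `φ` as a superfunction. -/
def real (φ : (ε → ℝ) → ℝ) (hφ : ContDiffOn ℝ ∞ φ U) : Sm ο U := mk _ (smoothOn_real hφ)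

theorem real_val (φ : (ε → ℝ) → ℝ) (hφ : ContDiffOn ℝ ∞ φ U) (x : U) :
    (real (ο := ο) φ hφ).1 x = algebraMap ℝ (Gr ο) (φ x) := rfl

theorem hom_real (φ : (ε → ℝ) → ℝ) (hφ : ContDiffOn ℝ ∞ φ U) : Hom 0 (real (ο := ο) φ hφ) :=
  hom_iff.2 fun _ => hom_algebraMap _

theorem der_inl_real_val (φ : (ε → ℝ) → ℝ) (hφ : ContDiffOn ℝ ∞ φ U) (i : ε) (x : U) :
    (der (Sum.inl i) (real (ο := ο) φ hφ)).1 x =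
      algebraMap ℝ (Gr ο) (fderiv ℝ φ x (Pi.single i 1)) := by
  rw [real, der_mk]
  exact evenDeriv_real (ο := ο) U.2 hφ i x.2

theorem der_inr_real (φ : (ε → ℝ) → ℝ) (hφ : ContDiffOn ℝ ∞ φ U) (α : ο) :
    der (Sum.inr α) (real (ο := ο) φ hφ) = 0 := ext fun x => by
  rw [der_inr_val, real_val, oddD_algebraMap]
  rfl

/-- The coordinate `a`. -/
def crd (a : ε ⊕ ο) : Sm ο U := mk _ (smoothOn_coord a U)

theorem hom_crd (a : ε ⊕ ο) : Hom (gpar a) (crd (U := U) a) := by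
  cases a with
  | inl i => exact hom_iff.2 fun _ => hom_algebraMap _
  | inr α => exact hom_iff.2 fun _ => hom_gen α

theorem der_crd (a b : ε ⊕ ο) : der a (crd (U := U) b) = if a = b then 1 else 0 := by
  rcases b with j | β
  · have e : crd (U := U) (Sum.inl j : ε ⊕ ο) =
      real (fun x => x j) (contDiff_apply ℝ ℝ j).contDiffOn := rfl
    rcases a with i | α
    · refine ext fun x => ?_
      have e2 : fderiv ℝ (fun x : ε → ℝ => x j) x.1 = ContinuousLinearMap.proj j :=
        (ContinuousLinearMap.proj (R := ℝ) (φ := fun _ : ε => ℝ) j).hasFDerivAt.fderiv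
      rw [e, der_inl_real_val, e2]
      by_cases h : i = j
      · subst h
        simp
      · simp [h, Ne.symm h]
    · rw [e, der_inr_real]
      simp
  · rcases a with i | α
    · refine ext fun x => ?_
      rw [crd, der_mk]
      exact (evenDeriv_const (gen β) i x.1).trans (by simp)
    · refine ext fun x => ?_
      rw [der_inr_val]
      refine (oddD_gen α β).trans ?_
      by_cases h : α = β <;> simp [h]

end Sm

end Sm

/-! ## Substitutions and the chain rule -/

section Subst

variable {ε ο ε' ο' : Type*} [Fintype ε'] [Fintype ο'] [DecidableEq ε']
  [DecidableEq ο'] [Fintype ε] [Fintype ο] [DecidableEq ε] [DecidableEq ο]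

/-- A substitution of superfunctions on `U` for the coordinates of `V`. -/
structure Subst (ε ο ε' ο' : Type*) [Fintype ε] [Fintype ο] [DecidableEq ε] [DecidableEq ο]
    [Fintype ε'] [Fintype ο'] [DecidableEq ε'] [DecidableEq ο']
    (U : Opens (ε' → ℝ)) (V : Opens (ε → ℝ)) where
  /-- The superfunction that is substituted for the coordinate `a`. -/
  Y : ε ⊕ ο → Sm ο' U
  hom : ∀ a, Hom (gpar a) (Y a)
  mem : ∀ x : U, (fun i => bodyHom ((Y (Sum.inl i)).1 x)) ∈ V

theorem Sm.contDiffOn_repr {U : Opens (ε → ℝ)} (h : Sm ο U) (k) :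
    ContDiffOn ℝ ∞ (fun y => (grBasis ο).repr (Sm.out h y) k) U := Sm.smooth_out h k

namespace Subst

variable {U : Opens (ε' → ℝ)} {V : Opens (ε → ℝ)} (S : Subst ε ο ε' ο' U V)

/-- The body of the substitution. -/
def z (x : ε' → ℝ) : ε → ℝ := fun i => bodyHom (Sm.out (S.Y (Sum.inl i)) x)

theorem z_apply (x : U) (i : ε) : S.z x i = bodyHom ((S.Y (Sum.inl i)).1 x) := by
  rw [z, Sm.out_apply]

theorem z_mem (x : U) : S.z x ∈ V := by
  have : S.z x = fun i => bodyHom ((S.Y (Sum.inl i)).1 x) := funext fun i => S.z_apply x i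
  rw [this]
  exact S.mem x

/-- The body of the substitution, as a map of domains. -/
def pt (x : U) : V := ⟨S.z x, S.z_mem x⟩

theorem contDiffOn_zi (i : ε) : ContDiffOn ℝ ∞ (fun x => S.z x i) U :=
  (Sm.smooth_out (S.Y (Sum.inl i))).functional bodyHom.toLinearMap

theorem contDiffOn_z : ContDiffOn ℝ ∞ S.z U := contDiffOn_pi.2 S.contDiffOn_zi

/-- The body of an even component of the substitution. -/
def zi (i : ε) : Sm ο' U := Sm.real (fun x => S.z x i) (S.contDiffOn_zi i)

/-- The soul of an even component of the substitution. -/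
def n (i : ε) : Sm ο' U := S.Y (Sum.inl i) - S.zi i

theorem n_val (i : ε) (x : U) : (S.n i).1 x = soul ((S.Y (Sum.inl i)).1 x) := by
  rw [soul_eq, n, Sm.sub_val, zi, Sm.real_val, z_apply]

theorem hom_n (i : ε) : Hom 0 (S.n i) := (S.hom (Sum.inl i)).sub (Sm.hom_real _ _)

theorem n_comm (i : ε) (g : Sm ο' U) : S.n i * g = g * S.n i :=
  SuperRing.even_comm (hom_zero_iff.1 (S.hom_n i)) g

theorem n_left_comm (i : ε) (g h : Sm ο' U) : S.n i * (g * h) = g * (S.n i * h) := by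
  rw [← mul_assoc, n_comm, mul_assoc]

/-- The function `φ` of the body of the substitution. -/
def cmp (φ : (ε → ℝ) → ℝ) (hφ : ContDiffOn ℝ ∞ φ V) : Sm ο' U :=
  Sm.real (fun x => φ (S.z x)) (hφ.comp S.contDiffOn_z fun x hx => S.z_mem ⟨x, hx⟩)

theorem contDiffOn_partial {φ : (ε → ℝ) → ℝ} (hφ : ContDiffOn ℝ ∞ φ V) (j : ε) :
    ContDiffOn ℝ ∞ (fun x => fderiv ℝ φ x (Pi.single j 1)) V :=
  (hφ.fderiv_of_isOpen V.2 (m := ∞) (by simp)).clm_apply contDiffOn_const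

/-- The classical chain rule for real functions; along odd coordinates both sides vanish. -/
theorem der_cmp (a : ε' ⊕ ο') (φ : (ε → ℝ) → ℝ) (hφ : ContDiffOn ℝ ∞ φ V) :
    Sm.der a (S.cmp φ hφ) =
      ∑ j, Sm.der a (S.zi j) * S.cmp (fun x => fderiv ℝ φ x (Pi.single j 1))
        (contDiffOn_partial hφ j) := by
  rcases a with i | α
  · refine Sm.ext fun x => ?_
    rw [Sm.sum_val]
    simp only [Sm.mul_val, cmp, zi, Sm.der_inl_real_val, Sm.real_val, ← map_mul, ← map_sum]
    congr 1
    have h1 : DifferentiableAt ℝ φ (S.z x) :=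
      (hφ.contDiffAt (V.2.mem_nhds (S.z_mem x))).differentiableAt (by simp)
    have h2 : ∀ j, DifferentiableAt ℝ (fun x => S.z x j) x := fun j =>
      ((S.contDiffOn_zi j).contDiffAt (U.2.mem_nhds x.2)).differentiableAt (by simp)
    have h3 : DifferentiableAt ℝ S.z x := differentiableAt_pi.2 h2
    have h4 := fderiv_comp x.1 h1 h3
    have h5 : (fun x => φ (S.z x)) = φ ∘ S.z := rfl
    rw [h5, h4]
    have h6 : ∀ v, fderiv ℝ S.z x.1 v = ∑ j, (fderiv ℝ (fun x => S.z x j) x v) •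
        (Pi.single j (1 : ℝ) : ε → ℝ) := by
      intro v
      have h7 : fderiv ℝ S.z x.1 =
          ContinuousLinearMap.pi fun j => fderiv ℝ (fun x => S.z x j) x.1 :=
        fderiv_pi h2
      rw [h7]
      exact pi_eq_sum_univ' _
    rw [ContinuousLinearMap.comp_apply, h6, map_sum]
    simp
  · simp only [cmp, zi, Sm.der_inr_real, zero_mul, Finset.sum_const_zero]

theorem hom_odd (α : ο) : Hom 1 (S.Y (Sum.inr α)) := S.hom (Sum.inr α)

/-- The substitution for the odd coordinates. -/
def os : Gr ο →ₐ[ℝ] Sm ο' U :=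
  oddSubst (fun α => S.Y (Sum.inr α)) fun α => S.hom_odd α

/-- The substitution for the odd coordinates, at a point. -/
def osAt (x : U) : Gr ο →ₐ[ℝ] Gr ο' :=
  oddSubst (fun α => (S.Y (Sum.inr α)).1 x) fun α => Sm.hom_iff.1 (S.hom_odd α) x

theorem os_val (g : Gr ο) (x : U) : (S.os g).1 x = S.osAt x g :=
  comp_oddSubst _ (Sm.ev x) (fun α => Sm.hom_iff.1 (S.hom_odd α) x) g

/-- The composition with the body of a substitution for the even coordinates, and the
substitution for the odd coordinates. -/
def E₀Fun (h : Sm ο V) : Sm ο' U :=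
  ∑ k, S.cmp (fun y => (grBasis ο).repr (Sm.out h y) k) (Sm.contDiffOn_repr h k) *
    S.os (grBasis ο k)

theorem E₀Fun_val (h : Sm ο V) (x : U) : (S.E₀Fun h).1 x = S.osAt x (h.1 (S.pt x)) := by
  rw [← Sm.out_apply h, ← gr_sum_repr (Sm.out h (S.pt x)), map_sum, E₀Fun, Sm.sum_val]
  refine Finset.sum_congr rfl fun k _ => ?_
  rw [Sm.mul_val, os_val, map_smul, Algebra.smul_def]
  rfl

/-- The composition with the body of a substitution for the even coordinates, and the
substitution for the odd coordinates, as a homomorphism. -/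
def E₀ : Sm ο V →ₐ[ℝ] Sm ο' U where
  toFun := S.E₀Fun
  map_one' := Sm.ext fun x => by simp [E₀Fun_val]
  map_mul' g h := Sm.ext fun x => by simp [E₀Fun_val]
  map_zero' := Sm.ext fun x => by simp [E₀Fun_val]
  map_add' g h := Sm.ext fun x => by simp [E₀Fun_val]
  commutes' r := Sm.ext fun x => by
    rw [E₀Fun_val]
    exact (S.osAt x).commutes r

theorem E₀_val (h : Sm ο V) (x : U) : (S.E₀ h).1 x = S.osAt x (h.1 (S.pt x)) :=
  S.E₀Fun_val h x

theorem isSHom_E₀ : IsSHom S.E₀ := fun h => Sm.ext fun x => by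
  rw [Sm.inv_val, E₀_val, E₀_val, Sm.inv_val]
  exact isSHom_oddSubst _ _

/-- The chain rule when only the bodies of the even components are substituted. In a basis expansion
the real coefficients obey the classical chain rule and the constant Grassmann factors obey that for
odd substitutions. -/
theorem der_E₀ (a : ε' ⊕ ο') (h : Sm ο V) :
    Sm.der a (S.E₀ h) = ∑ j, Sm.der a (S.zi j) * S.E₀ (Sm.der (Sum.inl j) h) +
      ∑ β, Sm.der a (S.Y (Sum.inr β)) * S.E₀ (Sm.der (Sum.inr β) h) := by
  have h1 : ∀ j, S.E₀ (Sm.der (Sum.inl j) h) = ∑ k, S.cmp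
      (fun y => fderiv ℝ (fun z => (grBasis ο).repr (Sm.out h z) k) y (Pi.single j 1))
      (contDiffOn_partial (Sm.contDiffOn_repr h k) j) * S.os (grBasis ο k) := by
    intro j
    refine Sm.ext fun x => ?_
    rw [E₀_val, Sm.sum_val, Sm.der_val, ← gr_sum_repr (pderiv _ _ _), map_sum]
    refine Finset.sum_congr rfl fun k _ => ?_
    rw [Sm.mul_val, os_val, map_smul, Algebra.smul_def]
    congr 1
    exact congrArg _ (repr_evenDeriv j _ _ _)
  have h2 : ∀ β, S.E₀ (Sm.der (Sum.inr β) h) = ∑ k, S.cmp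
      (fun y => (grBasis ο).repr (Sm.out h y) k) (Sm.contDiffOn_repr h k) *
        S.os (oddD β (grBasis ο k)) := by
    intro β
    refine Sm.ext fun x => ?_
    rw [E₀_val, Sm.sum_val, Sm.der_inr_val, ← Sm.out_apply,
      ← gr_sum_repr (Sm.out h (S.pt x)), map_sum, map_sum]
    refine Finset.sum_congr rfl fun k _ => ?_
    rw [Sm.mul_val, os_val, map_smul, map_smul, Algebra.smul_def]
    rfl
  have h3 : S.E₀ h = S.E₀Fun h := rfl
  have hc : ∀ φ hφ, Hom 0 (S.cmp φ hφ) := fun _ _ => Sm.hom_real _ _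
  rw [h3, E₀Fun, map_sum]
  simp only [(Sm.isSDer_der a).leib (hc _ _), mul_zero, sg_zero, one_smul, der_cmp,
    Finset.sum_add_distrib, h1, h2, Finset.mul_sum, Finset.sum_mul]
  congr 1
  · rw [Finset.sum_comm]
    simp only [mul_assoc]
  · rw [Finset.sum_comm]
    refine Finset.sum_congr rfl fun k _ => ?_
    have h4 : Sm.der a (S.os (grBasis ο k)) =
        ∑ β, Sm.der a (S.Y (Sum.inr β)) * S.os (oddD β (grBasis ο k)) :=
      (Sm.isSDer_der a).oddSubst _ _
    rw [h4, Finset.mul_sum]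
    refine Finset.sum_congr rfl fun β _ => ?_
    rw [← mul_assoc, ← mul_assoc, SuperRing.even_comm (hom_zero_iff.1 (hc _ _))]

/-- The term of order `k` of the Taylor expansion. -/
def E : ℕ → Sm ο V →ₗ[ℝ] Sm ο' U
  | 0 => S.E₀.toLinearMap
  | k + 1 => ((k + 1 : ℕ) : ℝ)⁻¹ •
      ∑ j, LinearMap.mulLeft ℝ (S.n j) ∘ₗ E k ∘ₗ Sm.der (Sum.inl j)

theorem E_zero (h : Sm ο V) : S.E 0 h = S.E₀ h := rfl

/-- The recursion of the Taylor terms without denominators. It replaces sums over multi-indices in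
the inductions below. -/
theorem E_succ (k : ℕ) (h : Sm ο V) :
    ((k + 1 : ℕ) : ℝ) • S.E (k + 1) h = ∑ j, S.n j * S.E k (Sm.der (Sum.inl j) h) := by
  rw [E, LinearMap.smul_apply, smul_smul, mul_inv_cancel₀ (by positivity), one_smul]
  simp

theorem E_succ' (k : ℕ) (h : Sm ο V) :
    S.E (k + 1) h = ((k + 1 : ℕ) : ℝ)⁻¹ • ∑ j, S.n j * S.E k (Sm.der (Sum.inl j) h) := by
  rw [← E_succ, smul_smul, inv_mul_cancel₀ (by positivity), one_smul]

theorem inv_E (k : ℕ) (h : Sm ο V) : SuperRing.inv (S.E k h) = S.E k (SuperRing.inv h) := by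
  induction k generalizing h with
  | zero => exact S.isSHom_E₀ h
  | succ k ih =>
    simp only [E_succ', map_smul, map_sum, map_mul, ih, (Sm.isSDer_der _).inv,
      hom_zero_iff.1 (S.hom_n _), gpar, Sum.elim_inl, sg_zero, one_smul]

theorem E_one (k : ℕ) : S.E (k + 1) 1 = 0 := by
  simp [E_succ', (Sm.isSDer_der _).one]

/-- The Leibniz rule for Taylor terms. After multiplication by k + 1 the recursion moves a
derivative onto either factor. -/
theorem E_mul (k : ℕ) (f g : Sm ο V) :
    S.E k (f * g) = ∑ p ∈ Finset.HasAntidiagonal.antidiagonal k,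
    S.E p.1 f * S.E p.2 g := by
  induction k generalizing f g with
  | zero => simp [E_zero]
  | succ k ih =>
    have hl : ∀ j, Sm.der (Sum.inl j) (f * g) =
        Sm.der (Sum.inl j) f * g + f * Sm.der (Sum.inl j) g := by
      intro j
      induction f using hom_induction with
      | hadd x y hx hy => simp only [add_mul, map_add, hx, hy]; abel
      | hhom d x hx =>
        rw [(Sm.isSDer_der _).leib hx]
        simp [gpar]
    have hne : ((k + 1 : ℕ) : ℝ) ≠ 0 := by positivity
    refine smul_right_injective _ hne ?_
    simp only
    rw [E_succ]
    simp only [hl, map_add, ih, mul_add, Finset.mul_sum, Finset.sum_add_distrib]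
    -- On the antidiagonal k + 1 is the sum of the two orders. Each summand absorbs its own order
    -- through the recursion and loses its boundary term, where that order is zero.
    have h1 : ((k + 1 : ℕ) : ℝ) •
        ∑ p ∈ Finset.HasAntidiagonal.antidiagonal (k + 1), S.E p.1 f * S.E p.2 g =
        ∑ p ∈ Finset.HasAntidiagonal.antidiagonal (k + 1), ((p.1 : ℝ) • (S.E p.1 f * S.E p.2 g)) +
        ∑ p ∈ Finset.HasAntidiagonal.antidiagonal (k + 1),
          ((p.2 : ℝ) • (S.E p.1 f * S.E p.2 g)) := by
      rw [Finset.smul_sum, ← Finset.sum_add_distrib]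
      refine Finset.sum_congr rfl fun p hp => ?_
      rw [← add_smul, ← Finset.HasAntidiagonal.mem_antidiagonal.1 hp, Nat.cast_add]
    rw [h1, Finset.Nat.sum_antidiagonal_succ, Finset.Nat.sum_antidiagonal_succ' (n := k)]
    simp only [Nat.cast_zero, zero_smul, zero_add]
    congr 1
    · rw [Finset.sum_comm]
      refine Finset.sum_congr rfl fun p _ => ?_
      rw [← smul_mul_assoc, E_succ, Finset.sum_mul]
      simp only [mul_assoc]
    · rw [Finset.sum_comm]
      refine Finset.sum_congr rfl fun p _ => ?_
      rw [← mul_smul_comm, E_succ, Finset.mul_sum]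
      simp only [n_left_comm]

/-- Derivatives of the bodies and of the odd components keep the Taylor order, while a derivative of
a soul uses up one soul factor. After summation over all orders the body and soul contributions
combine to the derivative of the component. -/
theorem der_E (a : ε' ⊕ ο') (k : ℕ) (h : Sm ο V) :
    Sm.der a (S.E (k + 1) h) = ∑ j, Sm.der a (S.zi j) * S.E (k + 1) (Sm.der (Sum.inl j) h) +
      ∑ β, Sm.der a (S.Y (Sum.inr β)) * S.E (k + 1) (Sm.der (Sum.inr β) h) +
      ∑ j, Sm.der a (S.n j) * S.E k (Sm.der (Sum.inl j) h) := by
  -- `r` is the part with a differentiated soul. It is zero at order 0 and given by the induction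
  -- hypothesis afterwards, so one calculation serves both cases.
  have step : ∀ (k : ℕ) (h : Sm ο V) (r : Sm ο V → Sm ο' U),
      (∀ h, Sm.der a (S.E k h) = ∑ j, Sm.der a (S.zi j) * S.E k (Sm.der (Sum.inl j) h) +
        ∑ β, Sm.der a (S.Y (Sum.inr β)) * S.E k (Sm.der (Sum.inr β) h) + r h) →
      ((k + 1 : ℕ) : ℝ) • Sm.der a (S.E (k + 1) h) =
        ((k + 1 : ℕ) : ℝ) • ∑ j, Sm.der a (S.zi j) * S.E (k + 1) (Sm.der (Sum.inl j) h) +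
        ((k + 1 : ℕ) : ℝ) •
          ∑ β, Sm.der a (S.Y (Sum.inr β)) * S.E (k + 1) (Sm.der (Sum.inr β) h) +
        ∑ j, Sm.der a (S.n j) * S.E k (Sm.der (Sum.inl j) h) +
        ∑ j, S.n j * r (Sm.der (Sum.inl j) h) := by
    intro k h r ih
    have e1 : ∀ b : ε ⊕ ο, ((k + 1 : ℕ) : ℝ) • S.E (k + 1) (Sm.der b h) =
        ∑ j, S.n j * S.E k (Sm.der b (Sm.der (Sum.inl j) h)) := by
      intro b
      rw [E_succ]
      refine Finset.sum_congr rfl fun j _ => ?_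
      rw [Sm.der_comm b]
      simp [gpar]
    rw [← map_smul, E_succ, map_sum]
    simp only [(Sm.isSDer_der a).leib (S.hom_n _), mul_zero, sg_zero, one_smul, ih, mul_add,
      Finset.sum_add_distrib, Finset.smul_sum, ← mul_smul_comm, e1]
    simp only [Finset.mul_sum, n_left_comm]
    have c1 : ∀ f : ε → ε → Sm ο' U, ∑ i, ∑ j, f i j = ∑ j, ∑ i, f i j := fun _ =>
      Finset.sum_comm
    have c2 : ∀ f : ε → ο → Sm ο' U, ∑ i, ∑ j, f i j = ∑ j, ∑ i, f i j := fun _ =>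
      Finset.sum_comm
    rw [c1 fun i j => Sm.der a (S.zi j) * (S.n i * _), c2]
    abel
  induction k generalizing h with
  | zero =>
    have := step 0 h (fun _ => 0) fun h => by rw [E_zero, der_E₀, add_zero]; rfl
    simpa using this
  | succ k ih =>
    have hne : ((k + 1 + 1 : ℕ) : ℝ) ≠ 0 := by positivity
    refine smul_right_injective _ hne ?_
    simp only
    rw [step (k + 1) h _ ih, smul_add, smul_add, add_assoc]
    congr 1
    have e2 : ∀ i, ((k + 1 : ℕ) : ℝ) • S.E (k + 1) (Sm.der (Sum.inl i) h) =
        ∑ j, S.n j * S.E k (Sm.der (Sum.inl i) (Sm.der (Sum.inl j) h)) := by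
      intro b
      rw [E_succ]
      refine Finset.sum_congr rfl fun j _ => ?_
      rw [Sm.der_comm (Sum.inl b)]
      simp [gpar]
    -- The old remainder contributes k + 1 copies of the new one; the soul differentiated at this
    -- step supplies the missing copy.
    have e3 : ∑ j, S.n j * ∑ i, Sm.der a (S.n i) *
        S.E k (Sm.der (Sum.inl i) (Sm.der (Sum.inl j) h)) =
        ((k + 1 : ℕ) : ℝ) • ∑ i, Sm.der a (S.n i) * S.E (k + 1) (Sm.der (Sum.inl i) h) := by
      simp only [Finset.smul_sum, ← mul_smul_comm, e2]
      simp only [Finset.mul_sum, n_left_comm]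
      exact Finset.sum_comm
    rw [e3, Nat.cast_succ (k + 1), add_smul, one_smul, add_comm]

theorem E_val_mem (k : ℕ) (h : Sm ο V) (x : U) : (S.E k h).1 x ∈ aug ο' ^ k * ⊤ := by
  induction k generalizing h with
  | zero => simp
  | succ k ih =>
    rw [E_succ', Sm.smul_val, Sm.sum_val, pow_succ', mul_assoc]
    refine Submodule.smul_mem _ _ (Submodule.sum_mem _ fun j _ => ?_)
    rw [Sm.mul_val, n_val]
    exact Submodule.mul_mem_mul (soul_mem_aug _) (ih _)

theorem E_eq_zero {k : ℕ} (hk : Fintype.card ο' < k) : S.E k = 0 :=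
  LinearMap.ext fun h => Sm.ext fun x => by
    have := S.E_val_mem k h x
    rwa [aug_pow_eq_bot hk, Submodule.bot_mul] at this

theorem E_mem_range {k : ℕ} (h : S.E k ≠ 0) : k ∈ Finset.range (Fintype.card ο' + 1) := by
  by_contra hk
  exact h (S.E_eq_zero (by simpa using hk))

/-- The pullback of superfunctions under a substitution, as a linear map. -/
def homFun : Sm ο V →ₗ[ℝ] Sm ο' U := ∑ k ∈ Finset.range (Fintype.card ο' + 1), S.E k

/-- All Taylor terms beyond the number of odd generators vanish, so the truncation order may be
adapted to each argument. -/
theorem homFun_apply {m : ℕ} (hm : Fintype.card ο' < m) (h : Sm ο V) :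
    S.homFun h = ∑ k ∈ Finset.range m, S.E k h := by
  rw [homFun, LinearMap.sum_apply]
  refine Finset.sum_subset (Finset.range_subset_range.2 hm) fun k _ hk => ?_
  rw [S.E_eq_zero (by simpa using hk), LinearMap.zero_apply]

/-- The pullback of superfunctions under a substitution. -/
def toHom : Sm ο V →ₐ[ℝ] Sm ο' U :=
  AlgHom.ofLinearMap S.homFun
    (by
      rw [S.homFun_apply (Nat.lt_succ_self _), Finset.sum_range_succ']
      simp [E_one, E_zero])
    (fun f g => by
      set N := Fintype.card ο'
      -- The truncation at 2N contains every product of two terms of order at most N.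
      have h : S.homFun (f * g) = ∑ k ∈ Finset.range (2 * N + 1),
          ∑ p ∈ Finset.HasAntidiagonal.antidiagonal k, S.E p.1 f * S.E p.2 g := by
        rw [S.homFun_apply (m := 2 * N + 1) (by omega)]
        exact Finset.sum_congr rfl fun k _ => S.E_mul k f g
      rw [h, S.homFun_apply (Nat.lt_succ_self _), S.homFun_apply (Nat.lt_succ_self _),
        Finset.sum_mul_sum, ← Finset.sum_product', Finset.sum_sigma']
      symm
      -- The square of pairs of orders and the triangle of antidiagonals differ only in pairs with
      -- an order above N, where a factor vanishes.
      refine Finset.sum_bij_ne_zero (fun p _ _ => ⟨p.1 + p.2, p⟩) ?_ ?_ ?_ ?_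
      · rintro ⟨a, b⟩ hp -
        simp only [Finset.mem_product, Finset.mem_range] at hp
        simp only [Finset.mem_sigma, Finset.mem_range, Finset.HasAntidiagonal.mem_antidiagonal,
          and_true]
        omega
      · rintro a - - b - - h
        simpa using congrArg (fun x : Σ _ : ℕ, ℕ × ℕ => x.2) h
      · rintro ⟨k, a, b⟩ hp hne
        simp only [Finset.mem_sigma, Finset.HasAntidiagonal.mem_antidiagonal] at hp
        obtain ⟨-, rfl⟩ := hp
        refine ⟨(a, b), ?_, hne, rfl⟩
        refine Finset.mem_product.2 ⟨S.E_mem_range fun h0 => hne ?_,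
          S.E_mem_range fun h0 => hne ?_⟩
        · simp only [h0, LinearMap.zero_apply, zero_mul]
        · simp only [h0, LinearMap.zero_apply, mul_zero]
      · intros; rfl)

theorem toHom_apply {m : ℕ} (hm : Fintype.card ο' < m) (h : Sm ο V) :
    S.toHom h = ∑ k ∈ Finset.range m, S.E k h := S.homFun_apply hm h

theorem isSHom_toHom : IsSHom S.toHom := fun h => by
  simp only [S.toHom_apply (Nat.lt_succ_self _), map_sum, inv_E]

/-- The chain rule. -/
theorem der_toHom (a : ε' ⊕ ο') (h : Sm ο V) :
    Sm.der a (S.toHom h) = ∑ b, Sm.der a (S.Y b) * S.toHom (Sm.der b h) := by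
  have h0 : ∀ j, Sm.der a (S.Y (Sum.inl j)) = Sm.der a (S.zi j) + Sm.der a (S.n j) := by
    intro j
    rw [← map_add, n, add_sub_cancel]
  have hN := Nat.lt_succ_self (Fintype.card ο')
  -- One order more than necessary is kept, so that after splitting off order 0 the soul terms,
  -- shifted down by one, still form a complete Taylor sum.
  rw [S.toHom_apply (hN.trans (Nat.lt_succ_self _)), map_sum, Finset.sum_range_succ', E_zero,
    der_E₀, Fintype.sum_sum_type]
  simp only [der_E, h0, add_mul, Finset.sum_add_distrib]
  have h1 : ∀ h, S.toHom h = ∑ k ∈ Finset.range (Fintype.card ο' + 1), S.E (k + 1) h + S.E₀ h := by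
    intro h
    rw [S.toHom_apply (hN.trans (Nat.lt_succ_self _)), Finset.sum_range_succ', E_zero]
  have h2 : ∑ j, Sm.der a (S.n j) * S.toHom (Sm.der (Sum.inl j) h) =
      ∑ k ∈ Finset.range (Fintype.card ο' + 1),
        ∑ j, Sm.der a (S.n j) * S.E k (Sm.der (Sum.inl j) h) := by
    rw [Finset.sum_comm]
    simp only [S.toHom_apply hN, Finset.mul_sum]
  rw [h2]
  simp only [h1, mul_add, Finset.sum_add_distrib, Finset.mul_sum]
  rw [Finset.sum_comm (t := Finset.univ (α := ε)), Finset.sum_comm (t := Finset.univ (α := ο))]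
  abel

end Subst

end Subst

/-! ### Pullbacks: explicit formula, naturality and relabellings -/

section Subst

variable {ε ο ε' ο' ε'' ο'' : Type*} [Fintype ε] [Fintype ο] [DecidableEq ε] [DecidableEq ο]
  [Fintype ε'] [Fintype ο'] [DecidableEq ε'] [DecidableEq ο']
  [Fintype ε''] [Fintype ο''] [DecidableEq ε''] [DecidableEq ο'']

namespace Subst

variable {U : Opens (ε' → ℝ)} {V : Opens (ε → ℝ)} (S : Subst ε ο ε' ο' U V)

/-- Unrolling the recursion gives a sum over k-tuples of indices. The last index of a tuple is the
innermost derivative, so tuples are split with `Fin.snocEquiv`; the souls are even and can be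
reordered. -/
theorem factorial_smul_E_val (k : ℕ) {f : SFun ε ο} (hf : SmoothOn f V) (x : U) :
    ((k.factorial : ℝ) • S.E k (Sm.mk f hf)).1 x = ∑ i : Fin k → ε,
      S.osAt x (iterDeriv (List.ofFn i) f (S.z x)) * (List.ofFn fun j => (S.n (i j)).1 x).prod := by
  induction k generalizing f with
  | zero =>
    simp [E_zero, E₀_val, iterDeriv, pt]
  | succ k ih =>
    rw [Nat.factorial_succ, mul_comm, Nat.cast_mul, ← smul_smul, E_succ, Finset.smul_sum,
      Sm.sum_val, ← (Fin.snocEquiv fun _ => ε).sum_comp, Fintype.sum_prod_type]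
    refine Finset.sum_congr rfl fun j _ => ?_
    rw [← mul_smul_comm, n_comm, Sm.mul_val, Sm.der_mk, ih, Finset.sum_mul]
    refine Finset.sum_congr rfl fun i _ => ?_
    have h1 : iterDeriv (List.ofFn (Fin.snocEquiv (fun _ => ε) (j, i))) f =
        iterDeriv (List.ofFn i) (pderiv (Sum.inl j) f) := by
      have : List.ofFn (Fin.snocEquiv (fun _ => ε) (j, i)) = List.ofFn i ++ [j] := by
        rw [List.ofFn_succ']
        simp [Fin.snocEquiv]
      rw [this, iterDeriv, List.foldr_append]
      rfl
    rw [h1, List.ofFn_succ', List.prod_concat, mul_assoc]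
    simp [Fin.snocEquiv]

/-- The value of a pullback is given by the formula of the definition of `pull`. -/
theorem toHom_mk_val {f : SFun ε ο} (hf : SmoothOn f V) (x : U) {Y : ε ⊕ ο → SFun ε' ο'}
    (hY : ∀ b, (S.Y b).1 x = Y b x) : (S.toHom (Sm.mk f hf)).1 x = pull Y f x := by
  have h1 : substOdd (fun α => Y (Sum.inr α) x) = S.osAt x := by
    have h : (fun α => Y (Sum.inr α) x) = fun α => (S.Y (Sum.inr α)).1 x :=
      funext fun α => (hY _).symm
    rw [h]
    exact substOdd_eq _
  have h2 : bodyPoint Y x = S.z x := funext fun i => by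
    rw [z_apply, hY]
    rfl
  rw [S.toHom_apply (Nat.lt_succ_self _), Sm.sum_val, pull]
  refine Finset.sum_congr rfl fun k _ => ?_
  have h3 := S.factorial_smul_E_val k hf x
  rw [Sm.smul_val] at h3
  rw [h1, h2]
  simp only [n_val, hY] at h3
  rw [← h3, smul_smul, inv_mul_cancel₀ (by positivity), one_smul]

/-- At a point a Taylor term is built algebraically from the values of the substitution at that
point. A parity preserving homomorphism respects bodies and souls, so it carries one expression to
the other. -/
theorem E_val_eq {U' : Opens (ε'' → ℝ)} (S' : Subst ε ο ε'' ο'' U' V) {χ : Gr ο' →ₐ[ℝ] Gr ο''}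
    (hχ : IsSHom χ) {x : U} {x' : U'} (hY : ∀ b, (S'.Y b).1 x' = χ ((S.Y b).1 x)) (k : ℕ)
    (h : Sm ο V) : (S'.E k h).1 x' = χ ((S.E k h).1 x) := by
  have hz : S'.pt x' = S.pt x := Subtype.ext (funext fun i => by
    change S'.z x' i = S.z x i
    rw [z_apply, z_apply, hY, hχ.bodyHom])
  induction k generalizing h with
  | zero =>
    have h1 : ∀ α, Hom 1 (χ ((S.Y (Sum.inr α)).1 x)) := fun α =>
      hχ.hom (Sm.hom_iff.1 (S.hom_odd α) x)
    rw [E_zero, E_zero, E₀_val, E₀_val, hz, osAt, osAt, comp_oddSubst _ χ h1]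
    congr 2
    exact funext fun α => hY _
  | succ k ih =>
    simp only [E_succ', Sm.smul_val, Sm.sum_val, Sm.mul_val, map_smul, map_sum, map_mul, ih, n_val,
      hY, hχ.soul]

/-- Naturality of pullbacks under homomorphisms of Grassmann algebras. -/
theorem toHom_val_eq {U' : Opens (ε'' → ℝ)} (S' : Subst ε ο ε'' ο'' U' V)
    {χ : Gr ο' →ₐ[ℝ] Gr ο''} (hχ : IsSHom χ) {x : U} {x' : U'}
    (hY : ∀ b, (S'.Y b).1 x' = χ ((S.Y b).1 x)) (h : Sm ο V) :
    (S'.toHom h).1 x' = χ ((S.toHom h).1 x) := by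
  set m := max (Fintype.card ο') (Fintype.card ο'') + 1
  rw [S.toHom_apply (m := m) (by omega), S'.toHom_apply (m := m) (by omega), Sm.sum_val,
    Sm.sum_val, map_sum]
  exact Finset.sum_congr rfl fun k _ => S.E_val_eq S' hχ hY k h

theorem toHom_val_congr {U' : Opens (ε' → ℝ)} (S' : Subst ε ο ε' ο' U' V) {x : U} {x' : U'}
    (hY : ∀ b, (S'.Y b).1 x' = (S.Y b).1 x) (h : Sm ο V) :
    (S'.toHom h).1 x' = (S.toHom h).1 x :=
  S.toHom_val_eq S' (χ := AlgHom.id ℝ _) (fun _ => rfl) hY h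

/-- The Taylor expansion of a coordinate stops at order one: an even coordinate gives body plus
soul, an odd one only its order zero term. -/
theorem toHom_crd (b : ε ⊕ ο) : S.toHom (Sm.crd b) = S.Y b := by
  have h1 : ∀ k, S.E (k + 2) (Sm.crd b) = 0 := by
    intro k
    rw [E_succ']
    have h : ∀ j, S.E (k + 1) (Sm.der (Sum.inl j) (Sm.crd b)) = 0 := by
      intro j
      rw [Sm.der_crd]
      split_ifs
      · exact S.E_one k
      · exact map_zero _
    simp [h]
  rw [S.toHom_apply (m := Fintype.card ο' + 1 + 1) (by omega), Finset.sum_range_succ',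
    Finset.sum_range_succ']
  simp only [h1, Finset.sum_const_zero, zero_add]
  rw [E_succ', E_zero]
  simp only [E_zero, Sm.der_crd]
  refine Sm.ext fun x => ?_
  rcases b with i | β
  · have h2 : S.E₀ (Sm.crd (Sum.inl i)) = S.zi i := Sm.ext fun x => by
      rw [E₀_val]
      exact (S.osAt x).commutes _
    rw [h2, Finset.sum_eq_single i]
    · simp [n]
    · intro j _ hj
      simp [hj]
    · simp
  · rw [Sm.add_val, E₀_val]
    simp only [reduceCtorEq, if_false, map_zero, mul_zero, Finset.sum_const_zero, smul_zero,
      Sm.zero_val, zero_add]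
    exact oddSubst_gen _ β

/-- The substitution that relabels the coordinates along injective maps. -/
def incl (φe : ε → ε') (φo : ο → ο') (U : Opens (ε' → ℝ)) (V : Opens (ε → ℝ))
    (h : ∀ x ∈ U, (fun i => x (φe i)) ∈ V) : Subst ε ο ε' ο' U V where
  Y b := Sm.crd (Sum.map φe φo b)
  hom b := by rcases b with i | β <;> exact Sm.hom_crd _
  mem x := by
    have : ∀ i, bodyHom ((Sm.crd (U := U) (ο := ο') (Sum.map φe φo (Sum.inl i : ε ⊕ ο))).1 x) =
      x.1 (φe i) := fun i => bodyHom.commutes _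
    simp only [this]
    exact h x x.2

section Incl

variable {φe : ε → ε'} {φo : ο → ο'} {hUV : ∀ x ∈ U, (fun i => x (φe i)) ∈ V}

theorem z_incl (x : U) : (incl φe φo U V hUV).z x = fun i => x.1 (φe i) := funext fun i => by
  rw [z_apply]
  exact bodyHom.commutes _

theorem n_incl (i : ε) : (incl φe φo U V hUV).n i = 0 := Sm.ext fun x => by
  rw [n_val, soul_eq]
  have : ((incl φe φo U V hUV).Y (Sum.inl i)).1 x = algebraMap ℝ (Gr ο') (x.1 (φe i)) := rfl
  rw [this, AlgHom.commutes]
  exact sub_self _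

/-- Relabelled even coordinates have no soul, so only order zero remains. -/
theorem toHom_incl (h : Sm ο V) : (incl φe φo U V hUV).toHom h = (incl φe φo U V hUV).E₀ h := by
  rw [toHom_apply _ (Nat.lt_succ_self _), Finset.sum_range_succ', E_zero]
  simp [E_succ', n_incl]

theorem toHom_incl_val (hφo : φo.Injective) (h : Sm ο V) (x : U) :
    ((incl φe φo U V hUV).toHom h).1 x = relabel φo (h.1 ⟨fun i => x.1 (φe i), hUV x x.2⟩) := by
  rw [toHom_incl, E₀_val]
  have h1 : (incl φe φo U V hUV).pt x = ⟨fun i => x.1 (φe i), hUV x x.2⟩ := Subtype.ext (z_incl x)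
  rw [h1, ← oddSubst_gen_eq (relabel φo _), oddSubst_relabel hφo]
  rfl

theorem der_toHom_incl (hφe : φe.Injective) (hφo : φo.Injective) (b : ε ⊕ ο) (h : Sm ο V) :
    Sm.der (Sum.map φe φo b) ((incl φe φo U V hUV).toHom h) =
      (incl φe φo U V hUV).toHom (Sm.der b h) := by
  rw [der_toHom]
  simp only [incl, Sm.der_crd]
  rw [Finset.sum_eq_single b]
  · simp
  · intro c _ hc
    rw [if_neg fun h => hc (Sum.map_injective.2 ⟨hφe, hφo⟩ h).symm, zero_mul]
  · simp

theorem der_toHom_incl_of_ne {a : ε' ⊕ ο'} (ha : ∀ b : ε ⊕ ο, Sum.map φe φo b ≠ a) (h : Sm ο V) :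
    Sm.der a ((incl φe φo U V hUV).toHom h) = 0 := by
  rw [der_toHom]
  simp only [incl, Sm.der_crd]
  refine Finset.sum_eq_zero fun b _ => ?_
  rw [if_neg (ha b).symm, zero_mul]

end Incl

/-- The composition of a substitution with a relabelling of the coordinates. -/
def comp {W : Opens (ε'' → ℝ)} (φe : ε'' → ε) (φo : ο'' → ο)
    (hVW : ∀ x ∈ V, (fun i => x (φe i)) ∈ W) : Subst ε'' ο'' ε' ο' U W where
  Y b := S.Y (Sum.map φe φo b)
  hom b := by rcases b with i | β <;> exact S.hom _
  mem x := hVW _ (S.mem x)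

/-- Functoriality when the inner substitution is a relabelling. It holds term by term, since
derivatives along coordinates outside the relabelled ones vanish. -/
theorem toHom_toHom_incl {W : Opens (ε'' → ℝ)} {φe : ε'' → ε} {φo : ο'' → ο}
    (hVW : ∀ x ∈ V, (fun i => x (φe i)) ∈ W) (hφe : φe.Injective) (hφo : φo.Injective)
    (h : Sm ο'' W) : S.toHom ((incl φe φo V W hVW).toHom h) = (S.comp φe φo hVW).toHom h := by
  have key : ∀ k (h : Sm ο'' W), S.E k ((incl φe φo V W hVW).toHom h) =
      (S.comp φe φo hVW).E k h := by
    intro k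
    induction k with
    | zero =>
      intro h
      refine Sm.ext fun x => ?_
      rw [E_zero, E_zero, E₀_val, E₀_val, toHom_incl_val hφo, osAt, oddSubst_relabel hφo]
      rfl
    | succ k ih =>
      intro h
      have hn : ∀ i, (S.comp φe φo hVW).n i = S.n (φe i) := fun i => Sm.ext fun x => by
        rw [n_val, n_val]
        rfl
      rw [E_succ', E_succ']
      congr 1
      rw [← Finset.sum_subset (Finset.subset_univ (Finset.univ.map ⟨φe, hφe⟩)), Finset.sum_map]
      · refine Finset.sum_congr rfl fun i _ => ?_
        rw [hn, ← ih, ← der_toHom_incl hφe hφo]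
        rfl
      · intro j _ hj
        rw [der_toHom_incl_of_ne, map_zero, mul_zero]
        rintro (i | β)
        · simp only [Finset.mem_map, Finset.mem_univ, true_and, Function.Embedding.coeFn_mk,
            not_exists] at hj
          simpa using hj i
        · simp
  rw [S.toHom_apply (Nat.lt_succ_self _), (S.comp φe φo hVW).toHom_apply (Nat.lt_succ_self _)]
  exact Finset.sum_congr rfl fun k _ => key k h

end Subst

end Subst

/-! ## Berezinians of mutually inverse even supermatrices -/

section Berezinian

variable {R : Type*} [Ring R] [Algebra ℝ R] [SuperRing R] {p q : ℕ}

theorem ring_inverse_eq {M : Type*} [MonoidWithZero M] {x y : M} (h : x * y = 1) (h' : y * x = 1) :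
    Ring.inverse x = y := Ring.inverse_unit ⟨x, y, h, h'⟩

theorem map_leibnizDet {S : Type*} [Ring S] (χ : R →+* S) {k : ℕ} (A : Matrix (Fin k) (Fin k) R) :
    χ (leibnizDet A) = leibnizDet (A.map χ) := by
  simp only [leibnizDet, map_sum, map_zsmul, map_list_prod, List.map_ofFn]
  rfl

theorem leibnizDet_eq_det {S : Type*} [CommRing S] {k : ℕ} (A : Matrix (Fin k) (Fin k) S) :
    leibnizDet A = A.det := by
  rw [← Matrix.det_transpose, Matrix.det_apply, leibnizDet]
  refine Finset.sum_congr rfl fun σ _ => ?_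
  rw [Units.smul_def, ← List.prod_ofFn]
  rfl

/-- An even square matrix `δ` is invertible if `δ * H` differs from `1` by a product of odd
matrices. -/
theorem HomM.exists_inverse {γ : Matrix (Fin q) (Fin p) R} {F : Matrix (Fin p) (Fin q) R}
    {δ H : Matrix (Fin q) (Fin q) R} (hγ : HomM 1 γ) (hF : HomM 1 F) (hδ : HomM 0 δ)
    (hH : HomM 0 H) (h : γ * F + δ * H = 1) :
    ∃ δi : Matrix (Fin q) (Fin q) R, HomM 0 δi ∧ δ * δi = 1 ∧ δi * δ = 1 := by
  have hN : HomM 0 (γ * F) := (hγ.mul hF).cast (by decide)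
  have h1 : hN.toEven + hδ.toEven * hH.toEven = 1 := by
    ext i j
    have h' := congrFun (congrFun h i) j
    rw [Matrix.add_apply, Matrix.mul_apply (M := δ)] at h'
    rw [Matrix.add_apply, Matrix.mul_apply (M := hδ.toEven), Subalgebra.coe_add,
      AddSubmonoidClass.coe_finsetSum]
    refine h'.trans ?_
    by_cases hij : i = j
    · subst hij
      simp
    · simp [Matrix.one_apply_ne hij]
  -- A product of two odd elements squares to zero, and finite sums of commuting nilpotents are
  -- nilpotent.
  have h2 : ∀ i j, IsNilpotent (hN.toEven i j) := by
    intro i j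
    have e : hN.toEven i j = ∑ k, (⟨γ i k * F k j, ((hγ i k).mul (hF k j)).cast (by decide)⟩ :
        evenPart R) := by
      refine Subtype.ext ?_
      rw [AddSubmonoidClass.coe_finsetSum]
      exact Matrix.mul_apply
    rw [e]
    refine isNilpotent_sum fun k _ => ⟨2, Subtype.ext ?_⟩
    have e2 : F k j * γ i k = -(γ i k * F k j) := by
      rw [(hF k j).comm (hγ i k)]
      simp
    rw [pow_two, Subalgebra.coe_mul]
    change γ i k * F k j * (γ i k * F k j) = 0
    rw [mul_assoc, ← mul_assoc (F k j), e2, neg_mul, mul_neg, ← mul_assoc, ← mul_assoc,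
      (hγ i k).mul_self, zero_mul, zero_mul, neg_zero]
  -- The determinant of `1 - γ F` is 1 modulo the nilradical, hence a unit.
  have h3 : IsUnit (hδ.toEven.det * hH.toEven.det) := by
    rw [← Matrix.det_mul, eq_sub_of_add_eq' h1]
    set I := nilradical (evenPart R)
    have e : Ideal.Quotient.mk I (1 - hN.toEven).det = 1 := by
      rw [RingHom.map_det]
      have e2 : (Ideal.Quotient.mk I).mapMatrix (1 - hN.toEven) = 1 := by
        rw [map_sub, map_one, sub_eq_self]
        ext i j
        exact Ideal.Quotient.eq_zero_iff_mem.2 (mem_nilradical.2 (h2 i j))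
      rw [e2, Matrix.det_one]
    have e3 : IsNilpotent ((1 - hN.toEven).det - 1) := by
      rw [← mem_nilradical, ← Ideal.Quotient.eq_zero_iff_mem, map_sub, e, map_one, sub_self]
    have := e3.isUnit_add_one
    rwa [sub_add_cancel] at this
  have h4 : IsUnit hδ.toEven.det := isUnit_of_mul_isUnit_left h3
  refine ⟨Matrix.of fun i j => (hδ.toEven⁻¹ i j : R), fun i j => (hδ.toEven⁻¹ i j).2, ?_, ?_⟩
  · ext i j
    have h' := congrArg Subtype.val (congrFun (congrFun (Matrix.mul_nonsing_inv _ h4) i) j)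
    rw [Matrix.mul_apply, AddSubmonoidClass.coe_finsetSum] at h'
    rw [Matrix.mul_apply]
    refine h'.trans ?_
    by_cases hij : i = j
    · subst hij
      simp
    · simp [Matrix.one_apply_ne hij]
  · ext i j
    have h' := congrArg Subtype.val (congrFun (congrFun (Matrix.nonsing_inv_mul _ h4) i) j)
    rw [Matrix.mul_apply, AddSubmonoidClass.coe_finsetSum] at h'
    rw [Matrix.mul_apply]
    refine h'.trans ?_
    by_cases hij : i = j
    · subst hij
      simp
    · simp [Matrix.one_apply_ne hij]

/-- A pair of mutually inverse even supermatrices. -/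
structure IsInvPair (A B : Matrix (Fin p ⊕ Fin q) (Fin p ⊕ Fin q) R) : Prop where
  hA : ∀ a b, Hom (gpar a + gpar b) (A a b)
  hB : ∀ a b, Hom (gpar a + gpar b) (B a b)
  mul : A * B = 1
  mul' : B * A = 1

namespace IsInvPair

variable {A B : Matrix (Fin p ⊕ Fin q) (Fin p ⊕ Fin q) R}

theorem symm (h : IsInvPair A B) : IsInvPair B A := ⟨h.hB, h.hA, h.mul', h.mul⟩

theorem map {R' : Type*} [Ring R'] [Algebra ℝ R'] [SuperRing R'] {χ : R →ₐ[ℝ] R'} (hχ : IsSHom χ)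
    (h : IsInvPair A B) : IsInvPair (A.map χ) (B.map χ) where
  hA a b := hχ.hom (h.hA a b)
  hB a b := hχ.hom (h.hB a b)
  mul := by rw [← Matrix.map_mul, h.mul, Matrix.map_one _ (map_zero χ) (map_one χ)]
  mul' := by rw [← Matrix.map_mul, h.mul', Matrix.map_one _ (map_zero χ) (map_one χ)]

theorem blocks (h : IsInvPair A B) :
    A.toBlocks₁₁ * B.toBlocks₁₁ + A.toBlocks₁₂ * B.toBlocks₂₁ = 1 ∧
    A.toBlocks₁₁ * B.toBlocks₁₂ + A.toBlocks₁₂ * B.toBlocks₂₂ = 0 ∧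
    A.toBlocks₂₁ * B.toBlocks₁₁ + A.toBlocks₂₂ * B.toBlocks₂₁ = 0 ∧
    A.toBlocks₂₁ * B.toBlocks₁₂ + A.toBlocks₂₂ * B.toBlocks₂₂ = 1 := by
  have := h.mul
  rw [← Matrix.fromBlocks_toBlocks A, ← Matrix.fromBlocks_toBlocks B, Matrix.fromBlocks_multiply,
    ← Matrix.fromBlocks_one, Matrix.fromBlocks_inj] at this
  exact this

theorem hom₁₁ (h : IsInvPair A B) : HomM 0 A.toBlocks₁₁ := fun i j =>
  (h.hA (Sum.inl i) (Sum.inl j)).cast (by simp [gpar, CharTwo.add_self_eq_zero])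

theorem hom₁₂ (h : IsInvPair A B) : HomM 1 A.toBlocks₁₂ := fun i j =>
  (h.hA (Sum.inl i) (Sum.inr j)).cast (by simp [gpar])

theorem hom₂₁ (h : IsInvPair A B) : HomM 1 A.toBlocks₂₁ := fun i j =>
  (h.hA (Sum.inr i) (Sum.inl j)).cast (by simp [gpar])

theorem hom₂₂ (h : IsInvPair A B) : HomM 0 A.toBlocks₂₂ := fun i j =>
  (h.hA (Sum.inr i) (Sum.inr j)).cast (by simp [gpar, CharTwo.add_self_eq_zero])

theorem exists_inverse (h : IsInvPair A B) :
    ∃ δi : Matrix (Fin q) (Fin q) R, HomM 0 δi ∧ A.toBlocks₂₂ * δi = 1 ∧ δi * A.toBlocks₂₂ = 1 :=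
  h.hom₂₁.exists_inverse h.symm.hom₁₂ h.hom₂₂ h.symm.hom₂₂ h.blocks.2.2.2

/-- The inverse of the odd-odd block. -/
def δi (h : IsInvPair A B) : Matrix (Fin q) (Fin q) R := h.exists_inverse.choose

theorem hom_δi (h : IsInvPair A B) : HomM 0 h.δi := h.exists_inverse.choose_spec.1

theorem mul_δi (h : IsInvPair A B) : A.toBlocks₂₂ * h.δi = 1 := h.exists_inverse.choose_spec.2.1

theorem δi_mul (h : IsInvPair A B) : h.δi * A.toBlocks₂₂ = 1 := h.exists_inverse.choose_spec.2.2

theorem blockInv (h : IsInvPair A B) : IsBlockInv A.toBlocks₁₁ B.toBlocks₁₁ A.toBlocks₁₂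
    B.toBlocks₁₂ A.toBlocks₂₁ B.toBlocks₂₁ A.toBlocks₂₂ B.toBlocks₂₂ h.δi where
  hα := h.hom₁₁
  hβ := h.hom₁₂
  hγ := h.hom₂₁
  hδ := h.hom₂₂
  hE := h.symm.hom₁₁
  hF := h.symm.hom₁₂
  hG := h.symm.hom₂₁
  hH := h.symm.hom₂₂
  hδi := h.hom_δi
  l11 := h.blocks.1
  l21 := h.blocks.2.2.1
  l22 := h.blocks.2.2.2
  r11 := h.symm.blocks.1
  r12 := h.symm.blocks.2.1
  mul_inv := h.mul_δi
  inv_mul := h.δi_mul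

theorem berezinian_eq (h : IsInvPair A B) : berezinian A =
    IsBlockInv.ber A.toBlocks₁₁ A.toBlocks₁₂ A.toBlocks₂₁ h.δi := by
  rw [berezinian, IsBlockInv.ber, ring_inverse_eq h.mul_δi h.δi_mul,
    ring_inverse_eq (h.hom₂₂.leibnizDet_mul h.hom_δi h.mul_δi)
      (h.hom_δi.leibnizDet_mul h.hom₂₂ h.δi_mul)]

theorem hom_berezinian (h : IsInvPair A B) : Hom 0 (berezinian A) := by
  rw [h.berezinian_eq]
  exact h.blockInv.ber_hom

/-- `Ring.inverse` need not commute with homomorphisms; here it does because the odd-odd block and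
its determinant are invertible. -/
theorem map_berezinian {R' : Type*} [Ring R'] [Algebra ℝ R'] [SuperRing R'] {χ : R →ₐ[ℝ] R'}
    (hχ : IsSHom χ) (h : IsInvPair A B) : χ (berezinian A) = berezinian (A.map χ) := by
  have e1 : (A.map χ).toBlocks₂₂ * h.δi.map χ = 1 := by
    have := congrArg (fun M => M.map χ) h.mul_δi
    simp only [Matrix.map_mul, Matrix.map_one _ (map_zero χ) (map_one χ)] at this
    exact this
  have e2 : h.δi.map χ * (A.map χ).toBlocks₂₂ = 1 := by
    have := congrArg (fun M => M.map χ) h.δi_mul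
    simp only [Matrix.map_mul, Matrix.map_one _ (map_zero χ) (map_one χ)] at this
    exact this
  have e3 : HomM 0 (h.δi.map χ) := fun i j => hχ.hom (h.hom_δi i j)
  rw [h.berezinian_eq, IsBlockInv.ber, berezinian, ring_inverse_eq e1 e2, ring_inverse_eq
    ((h.map hχ).hom₂₂.leibnizDet_mul e3 e1) (e3.leibnizDet_mul (h.map hχ).hom₂₂ e2), map_mul]
  have e4 : ∀ {k : ℕ} (A : Matrix (Fin k) (Fin k) R), _ := map_leibnizDet (χ : R →+* R')
  simp only [RingHom.coe_coe] at e4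
  rw [e4, e4]
  congr 2
  rw [Matrix.map_sub _ (map_sub χ), Matrix.map_mul, Matrix.map_mul]
  rfl

theorem sder_berezinian (h : IsInvPair A B) {d : ZMod 2} {D : R →ₗ[ℝ] R} (hD : IsSDer d D) :
    D (berezinian A) = berezinian A *
      ∑ a, ∑ c, sg (gpar a + d * (gpar a + gpar c)) • (B a c * D (A c a)) := by
  rw [h.berezinian_eq, h.blockInv.sder_ber hD]
  congr 1
  simp only [IsBlockInv.strD, Matrix.trace, Matrix.diag_apply, Matrix.mul_apply, Matrix.map_apply,
    Fintype.sum_sum_type, gpar, Sum.elim_inl, Sum.elim_inr, Finset.sum_add_distrib,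
    Finset.smul_sum]
  simp only [add_zero, zero_add, mul_zero, sg_zero, one_smul, mul_one, sg_add, sg_one, neg_smul,
    neg_mul, one_mul, show (1 + 1 : ZMod 2) = 0 by decide, Finset.sum_neg_distrib]
  simp only [Matrix.toBlocks₁₁, Matrix.toBlocks₁₂, Matrix.toBlocks₂₁, Matrix.toBlocks₂₂,
    Matrix.of_apply]
  abel

theorem sder_berezinian_mul (h : IsInvPair A B) {d : ZMod 2} {D : R →ₗ[ℝ] R} (hD : IsSDer d D) :
    D (berezinian A * berezinian B) = 0 := by
  rw [h.berezinian_eq, h.symm.berezinian_eq]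
  exact h.blockInv.sder_ber_mul_ber h.symm.blockInv hD

/-- Under the body map the odd blocks vanish, and the Berezinian becomes a quotient of ordinary
determinants of mutually inverse pairs. -/
theorem bodyHom_berezinian_mul {ο : Type*} {A B : Matrix (Fin p ⊕ Fin q) (Fin p ⊕ Fin q) (Gr ο)}
    (h : IsInvPair A B) : bodyHom (berezinian A * berezinian B) = 1 := by
  set β : Gr ο →+* ℝ := (bodyHom (ο := ο)).toRingHom with hβ
  have e0 : ∀ {k l m : ℕ} {X : Matrix (Fin k) (Fin l) (Gr ο)} {Y : Matrix (Fin l) (Fin m) (Gr ο)},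
      HomM 1 X → (X * Y).map β = 0 := by
    intro k l m X Y hX
    rw [Matrix.map_mul]
    have : X.map β = 0 := by
      ext i j
      exact bodyHom_of_odd (hX i j)
    rw [this, Matrix.zero_mul]
  have e1 : ∀ {A B : Matrix (Fin p ⊕ Fin q) (Fin p ⊕ Fin q) (Gr ο)} (h : IsInvPair A B),
      β (berezinian A) = (A.toBlocks₁₁.map β).det * (h.δi.map β).det := by
    intro A B h
    rw [h.berezinian_eq, IsBlockInv.ber, map_mul, map_leibnizDet, map_leibnizDet,
      leibnizDet_eq_det, leibnizDet_eq_det, Matrix.map_sub _ (map_sub β), Matrix.mul_assoc,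
      e0 h.hom₁₂, sub_zero]
  have e2 : (A.toBlocks₁₁.map β) * (B.toBlocks₁₁.map β) = 1 := by
    have := congrArg (fun M => M.map β) h.blocks.1
    simp only [Matrix.map_add _ (map_add β), e0 h.hom₁₂,
      Matrix.map_one _ (map_zero β) (map_one β), add_zero] at this
    rwa [Matrix.map_mul] at this
  have e3 : (A.toBlocks₂₂.map β) * (B.toBlocks₂₂.map β) = 1 := by
    have := congrArg (fun M => M.map β) h.blocks.2.2.2
    simp only [Matrix.map_add _ (map_add β), e0 h.hom₂₁,
      Matrix.map_one _ (map_zero β) (map_one β), zero_add] at this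
    rwa [Matrix.map_mul] at this
  have e4 : ∀ {A B : Matrix (Fin p ⊕ Fin q) (Fin p ⊕ Fin q) (Gr ο)} (h : IsInvPair A B),
      (A.toBlocks₂₂.map β).det * (h.δi.map β).det = 1 := by
    intro A B h
    rw [← Matrix.det_mul, ← Matrix.map_mul, h.mul_δi, Matrix.map_one _ (map_zero β) (map_one β),
      Matrix.det_one]
  have d2 := congrArg Matrix.det e2
  have d3 := congrArg Matrix.det e3
  rw [Matrix.det_mul, Matrix.det_one] at d2 d3
  change β (berezinian A * berezinian B) = 1
  rw [map_mul, e1 h, e1 h.symm]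
  have d4 := e4 h
  have d5 := e4 h.symm
  linear_combination (h.δi.map β).det * (h.symm.δi.map β).det * d2 -
    (h.δi.map β).det * (h.symm.δi.map β).det * d3 +
    (B.toBlocks₂₂.map β).det * (h.symm.δi.map β).det * d4 + d5

end IsInvPair

end Berezinian

/-! ## Changes of coordinates and their lifts to the odd cotangent bundle -/

section Change

variable {ε ο : Type*} [Fintype ε] [Fintype ο] [DecidableEq ε] [DecidableEq ο]

/-- Over a Noetherian ring a one-sided inverse of a square matrix is two-sided; this supplies the
missing side for Jacobian matrices. -/
instance : IsNoetherianRing (Gr ο) :=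
  haveI : Module.Finite ℝ (Gr ο) := Module.Finite.of_basis (grBasis ο)
  isNoetherian_of_tower ℝ (inferInstance : IsNoetherian ℝ (Gr ο))

/-- The statement is checked at each point, where the entries lie in a finite dimensional algebra.
-/
theorem sm_matrix_mul_eq_one_comm {ι : Type*} [Fintype ι] [DecidableEq ι] {U : Opens (ε → ℝ)}
    {A B : Matrix ι ι (Sm ο U)} (h : A * B = 1) : B * A = 1 := by
  have key : ∀ x : U, B.map (Sm.ev x) * A.map (Sm.ev x) = 1 := by
    intro x
    rw [mul_eq_one_comm, ← Matrix.map_mul, h, Matrix.map_one _ (map_zero _) (map_one _)]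
  refine Matrix.ext fun i j => Sm.ext fun x => ?_
  have h1 := congrFun (congrFun (key x) i) j
  rw [← Matrix.map_mul, ← Matrix.map_one (Sm.ev x) (map_zero _) (map_one _)] at h1
  exact h1

/-- A change of coordinates: a pair of mutually inverse substitutions. -/
structure Change (ε ο : Type*) [Fintype ε] [Fintype ο] [DecidableEq ε] [DecidableEq ο]
    (U V : Opens (ε → ℝ)) where
  S : Subst ε ο ε ο U V
  S' : Subst ε ο ε ο V U
  l : ∀ b, S.toHom (S'.Y b) = Sm.crd b
  r : ∀ b, S'.toHom (S.Y b) = Sm.crd b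

namespace Change

variable {U V : Opens (ε → ℝ)} (C : Change ε ο U V)

/-- The inverse change of coordinates. -/
def symm : Change ε ο V U := ⟨C.S', C.S, C.r, C.l⟩

/-- The pullback under a change of coordinates. -/
def Φ : Sm ο V →ₐ[ℝ] Sm ο U := C.S.toHom

/-- The Jacobian matrix. -/
def jac : Matrix (ε ⊕ ο) (ε ⊕ ο) (Sm ο U) := Matrix.of fun a b => Sm.der a (C.S.Y b)

/-- The Jacobian matrix of the inverse change of coordinates, in the old coordinates. -/
def G : Matrix (ε ⊕ ο) (ε ⊕ ο) (Sm ο U) := C.symm.jac.map C.Φ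

theorem G_apply (b c : ε ⊕ ο) : C.G b c = C.Φ (Sm.der b (C.S'.Y c)) := rfl

theorem isSHom_Φ : IsSHom C.Φ := C.S.isSHom_toHom

theorem der_Φ (a : ε ⊕ ο) (h : Sm ο V) :
    Sm.der a (C.Φ h) = ∑ b, C.jac a b * C.Φ (Sm.der b h) := C.S.der_toHom a h

theorem jac_mul_G : C.jac * C.G = 1 := by
  ext1 a c
  rw [Matrix.mul_apply]
  simp only [G_apply, ← der_Φ]
  rw [Φ, C.l, Sm.der_crd, Matrix.one_apply]

theorem G_mul_jac : C.G * C.jac = 1 := sm_matrix_mul_eq_one_comm C.jac_mul_G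

theorem hom_jac (a b : ε ⊕ ο) : Hom (gpar a + gpar b) (C.jac a b) :=
  (Sm.isSDer_der a).hom (C.S.hom b)

theorem hom_G (a b : ε ⊕ ο) : Hom (gpar a + gpar b) (C.G a b) :=
  C.isSHom_Φ.hom (C.symm.hom_jac a b)

/-- The derivatives of `G` along the new coordinates. -/
theorem sum_G_mul_der_G (b c d : ε ⊕ ο) :
    ∑ a, C.G b a * Sm.der a (C.G c d) = C.Φ (Sm.der b (Sm.der c (C.S'.Y d))) := by
  simp only [C.G_apply c d, der_Φ, Finset.mul_sum, ← mul_assoc]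
  rw [Finset.sum_comm]
  simp only [← Finset.sum_mul]
  have h : ∀ e, ∑ a, C.G b a * C.jac a e = if b = e then 1 else 0 := by
    intro e
    rw [← Matrix.mul_apply, G_mul_jac, Matrix.one_apply]
  simp [h]

end Change

theorem gpar_baseIdx (a : ε ⊕ ο) : gpar (baseIdx a) = gpar a := by rcases a with i | α <;> rfl

theorem gpar_starIdx (a : ε ⊕ ο) : gpar (starIdx a) = gpar a + 1 := by
  rcases a with i | α <;> simp [gpar, starIdx, CharTwo.add_self_eq_zero]

theorem baseIdx_ne_starIdx (a b : ε ⊕ ο) : baseIdx a ≠ starIdx b := by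
  rcases a with i | α <;> rcases b with j | β <;> simp [baseIdx, starIdx]

theorem baseIdx_injective : (baseIdx : ε ⊕ ο → _).Injective := by
  rintro (i | α) (j | β) <;> simp [baseIdx]

theorem starIdx_injective : (starIdx : ε ⊕ ο → _).Injective := by
  rintro (i | α) (j | β) <;> simp [starIdx]

theorem map_inl_inl (a : ε ⊕ ο) : Sum.map (Sum.inl : ε → ε ⊕ ο) (Sum.inl : ο → ο ⊕ ε) a =
    baseIdx a := by
  rcases a with i | α <;> rfl

theorem sum_cot {M : Type*} [AddCommMonoid M] (f : (ε ⊕ ο) ⊕ (ο ⊕ ε) → M) :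
    ∑ a, f a = ∑ b, f (baseIdx b) + ∑ b, f (starIdx b) := by
  simp only [Fintype.sum_sum_type, baseIdx, starIdx, Sum.elim_inl, Sum.elim_inr]
  abel

/-- The inverse image in the odd cotangent bundle of an open subset of the base. -/
def cot (ο : Type*) (U : Opens (ε → ℝ)) : Opens (ε ⊕ ο → ℝ) :=
  ⟨cotDomain U, U.2.preimage (f := fun (y : ε ⊕ ο → ℝ) i => y (Sum.inl i)) (by fun_prop)⟩

variable {U V : Opens (ε → ℝ)}

/-- The partial derivatives in the base coordinates of the odd cotangent bundle. -/
def bder (a : ε ⊕ ο) : Sm (ο ⊕ ε) (cot ο U) →ₗ[ℝ] Sm (ο ⊕ ε) (cot ο U) := Sm.der (baseIdx a)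

/-- The partial derivatives in the fibre coordinates of the odd cotangent bundle. -/
def sder (a : ε ⊕ ο) : Sm (ο ⊕ ε) (cot ο U) →ₗ[ℝ] Sm (ο ⊕ ε) (cot ο U) := Sm.der (starIdx a)

theorem isCotDer : IsCotDer (gpar (ε := ε) (ο := ο)) (bder (U := U)) sder where
  base a := by
    rw [← gpar_baseIdx]
    exact Sm.isSDer_der _
  star a := by
    rw [← gpar_starIdx]
    exact Sm.isSDer_der _
  base_base a b x := by
    rw [← gpar_baseIdx a, ← gpar_baseIdx b]
    exact Sm.der_comm _ _ _
  star_star a b x := by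
    rw [← gpar_starIdx a, ← gpar_starIdx b]
    exact Sm.der_comm _ _ _
  base_star a b x := by
    rw [← gpar_baseIdx a, ← gpar_starIdx b]
    exact Sm.der_comm _ _ _

/-- The superfunctions on the base as superfunctions on the odd cotangent bundle. -/
def bas : Sm ο U →ₐ[ℝ] Sm (ο ⊕ ε) (cot ο U) :=
  (Subst.incl Sum.inl Sum.inl (cot ο U) U fun _ h => h).toHom

theorem bas_val (g : Sm ο U) (y : cot ο U) :
    (bas g).1 y = relabel Sum.inl (g.1 ⟨fun i => y.1 (Sum.inl i), y.2⟩) :=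
  Subst.toHom_incl_val Sum.inl_injective g y

theorem isSHom_bas : IsSHom (bas (ο := ο) (U := U)) := Subst.isSHom_toHom _

theorem hom_bas {d : ZMod 2} {g : Sm ο U} (hg : Hom d g) : Hom d (bas g) :=
  isSHom_bas.hom hg

theorem bder_bas (a : ε ⊕ ο) (g : Sm ο U) : bder a (bas g) = bas (Sm.der a g) := by
  have := Subst.der_toHom_incl (ε := ε) (ο := ο) (ε' := ε ⊕ ο) (ο' := ο ⊕ ε) (φe := Sum.inl)
    (φo := Sum.inl) (U := cot ο U) (V := U)
    (hUV := fun _ h => h) Sum.inl_injective Sum.inl_injective a g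
  rwa [map_inl_inl] at this

theorem sder_bas (a : ε ⊕ ο) (g : Sm ο U) : sder a (bas g) = 0 :=
  Subst.der_toHom_incl_of_ne (φe := Sum.inl) (φo := Sum.inl) (U := cot ο U) (V := U)
    (hUV := fun _ h => h) (fun b => by
      rw [map_inl_inl]
      exact baseIdx_ne_starIdx b a) g

/-- The fibre coordinates of the odd cotangent bundle. -/
def fib (a : ε ⊕ ο) : Sm (ο ⊕ ε) (cot ο U) := Sm.crd (starIdx a)

theorem hom_fib (a : ε ⊕ ο) : Hom (gpar a + 1) (fib (U := U) a) := by
  exact (Sm.hom_crd (ο := ο ⊕ ε) (U := cot ο U) (starIdx a)).cast (gpar_starIdx a)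

theorem bder_fib (a b : ε ⊕ ο) : bder a (fib (U := U) b) = 0 := by
  rw [bder, fib, Sm.der_crd, if_neg (baseIdx_ne_starIdx a b)]

theorem sder_fib (a b : ε ⊕ ο) : sder a (fib (U := U) b) = if a = b then 1 else 0 := by
  rw [sder, fib, Sm.der_crd]
  simp only [starIdx_injective.eq_iff]

namespace Change

variable (C : Change ε ο U V)

/-- The new fibre coordinates of the odd cotangent bundle. -/
def star (b : ε ⊕ ο) : Sm (ο ⊕ ε) (cot ο U) := ∑ a, bas (C.G b a) * fib a

theorem hom_star (b : ε ⊕ ο) : Hom (gpar b + 1) (C.star b) :=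
  Hom.sum _ fun a _ => ((hom_bas (C.hom_G b a)).mul (hom_fib a)).cast (by
    rw [add_assoc, ← add_assoc (gpar a), CharTwo.add_self_eq_zero, zero_add])

/-- The new coordinates of the odd cotangent bundle. -/
def cotY : (ε ⊕ ο) ⊕ (ο ⊕ ε) → Sm (ο ⊕ ε) (cot ο U) :=
  Sum.elim
    (Sum.elim (fun i => bas (C.S.Y (Sum.inl i))) (fun α => C.star (Sum.inr α)))
    (Sum.elim (fun α => bas (C.S.Y (Sum.inr α))) (fun i => C.star (Sum.inl i)))

theorem hom_cotY (a : (ε ⊕ ο) ⊕ (ο ⊕ ε)) : Hom (gpar a) (C.cotY a) := by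
  rcases a with (i | α) | (α | i)
  · exact hom_bas (C.S.hom (Sum.inl i))
  · exact (C.hom_star (Sum.inr α)).cast (by simp [gpar, CharTwo.add_self_eq_zero])
  · exact hom_bas (C.S.hom (Sum.inr α))
  · exact (C.hom_star (Sum.inl i)).cast (by simp [gpar])

theorem bodyHom_bas (g : Sm ο U) (y : cot ο U) :
    bodyHom ((bas g).1 y) = bodyHom (g.1 ⟨fun i => y.1 (Sum.inl i), y.2⟩) := by
  rw [bas_val, (isSHom_relabel _).bodyHom]

theorem cotY_mem (y : cot ο U) : (fun i => bodyHom ((C.cotY (Sum.inl i)).1 y)) ∈ cot ο V := by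
  have h2 := C.S.mem ⟨fun i => y.1 (Sum.inl i), y.2⟩
  simp only [← bodyHom_bas] at h2
  exact h2

/-- The lift of a change of coordinates to the odd cotangent bundle. -/
def cotS : Subst (ε ⊕ ο) (ο ⊕ ε) (ε ⊕ ο) (ο ⊕ ε) (cot ο U) (cot ο V) :=
  ⟨C.cotY, C.hom_cotY, C.cotY_mem⟩

/-- The pullback under the lift of a change of coordinates to the odd cotangent bundle. -/
def Ψ : Sm (ο ⊕ ε) (cot ο V) →ₐ[ℝ] Sm (ο ⊕ ε) (cot ο U) := C.cotS.toHom

theorem cotS_baseIdx (b : ε ⊕ ο) : C.cotS.Y (baseIdx b) = bas (C.S.Y b) := by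
  rcases b with i | α <;> rfl

theorem cotS_starIdx (b : ε ⊕ ο) : C.cotS.Y (starIdx b) = C.star b := by
  rcases b with i | α <;> rfl

theorem Ψ_bas (g : Sm ο V) : C.Ψ (bas g) = bas (C.Φ g) := by
  refine (C.cotS.toHom_toHom_incl _ Sum.inl_injective Sum.inl_injective g).trans
    (Sm.ext fun y => ?_)
  rw [bas_val]
  refine C.S.toHom_val_eq _ (isSHom_relabel _) (fun b => ?_) g
  change (C.cotS.Y (Sum.map Sum.inl Sum.inl b)).1 y = _
  rw [map_inl_inl, cotS_baseIdx, bas_val]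

theorem Ψ_fib (b : ε ⊕ ο) : C.Ψ (fib b) = C.star b := by
  rw [Ψ, fib, Subst.toHom_crd, cotS_starIdx]

theorem bder_Ψ (a : ε ⊕ ο) (f : Sm (ο ⊕ ε) (cot ο V)) :
    bder a (C.Ψ f) = ∑ b, bder a (bas (C.S.Y b)) * C.Ψ (bder b f) +
      ∑ b, bder a (C.star b) * C.Ψ (sder b f) := by
  rw [bder, Ψ, Subst.der_toHom, sum_cot]
  simp only [cotS_baseIdx, cotS_starIdx]
  rfl

theorem sder_Ψ (a : ε ⊕ ο) (f : Sm (ο ⊕ ε) (cot ο V)) :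
    sder a (C.Ψ f) = ∑ b, sder a (bas (C.S.Y b)) * C.Ψ (bder b f) +
      ∑ b, sder a (C.star b) * C.Ψ (sder b f) := by
  rw [sder, Ψ, Subst.der_toHom, sum_cot]
  simp only [cotS_baseIdx, cotS_starIdx]
  rfl

theorem sder_star (a b : ε ⊕ ο) :
    sder a (C.star b) = sg ((gpar a + 1) * (gpar b + gpar a)) • bas (C.G b a) := by
  rw [star, map_sum, Finset.sum_eq_single a]
  · rw [(isCotDer.star a).leib (hom_bas (C.hom_G b a)), sder_bas, sder_fib, if_pos rfl, zero_mul,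
      zero_add, mul_one]
  · intro c _ hc
    rw [(isCotDer.star a).leib (hom_bas (C.hom_G b c)), sder_bas, sder_fib, if_neg hc.symm,
      zero_mul, mul_zero, smul_zero, add_zero]
  · simp

/-- The behaviour of the odd Laplacian under a change of coordinates. -/
theorem lap_Ψ (f : Sm (ο ⊕ ε) (cot ο V)) :
    lap gpar bder sder (C.Ψ f) = C.Ψ (lap gpar bder sder f) +
      ∑ b, lap gpar bder sder (C.star b) * C.Ψ (sder b f) := by
  have h1 : ∀ b c, ∑ a, bas (C.G b a) * bder a (bas (C.S.Y c)) = if b = c then 1 else 0 := by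
    intro b c
    simp only [bder_bas, ← map_mul, ← map_sum]
    have h : ∑ a, C.G b a * Sm.der a (C.S.Y c) = if b = c then 1 else 0 := by
      have := congrFun (congrFun C.G_mul_jac b) c
      rwa [Matrix.mul_apply, Matrix.one_apply] at this
    rw [h]
    split_ifs
    · exact map_one _
    · exact map_zero _
  have h2 : ∀ b c d, ∑ a, bas (C.G b a) * bder a (bas (C.G c d)) =
      bas (C.Φ (Sm.der b (Sm.der c (C.S'.Y d)))) := by
    intro b c d
    simp only [bder_bas, ← map_mul, ← map_sum, sum_G_mul_der_G]
  -- The symmetry needed to cancel the second order terms: mixed partial derivatives of the old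
  -- coordinates supercommute.
  have h3 : ∀ b c d, bas (C.Φ (Sm.der b (Sm.der c (C.S'.Y d)))) =
      sg (gpar b * gpar c) • bas (C.Φ (Sm.der c (Sm.der b (C.S'.Y d)))) := by
    intro b c d
    rw [Sm.der_comm b c, map_smul, map_smul]
  have h4 : ∀ b a, Hom (gpar b + gpar a) (bas (C.G b a)) := fun b a => hom_bas (C.hom_G b a)
  have h5 : ∀ a b, sder a (bas (C.S.Y b)) = 0 := fun a b => sder_bas _ _
  have h6 : ∀ a b c, sder a (bas (C.G b c)) = 0 := fun a b c => sder_bas _ _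
  exact lap_comp (R := Sm (ο ⊕ ε) (cot ο U)) (R' := Sm (ο ⊕ ε) (cot ο V)) (ι := ε ⊕ ο)
    (par := gpar) (D := bder) (Ds := sder) (D' := bder) (Ds' := sder) isCotDer isCotDer (Φ := C.Ψ)
    (T := fun b => bas (C.S.Y b)) (xs := fib) (G := fun b a => bas (C.G b a))
    (H := fun b c d => bas (C.Φ (Sm.der b (Sm.der c (C.S'.Y d))))) h4 h5 h6 bder_fib sder_fib
    h1 h2 h3 C.bder_Ψ C.sder_Ψ f

end Change

end Change

/-! ## The Jacobian of a change of coordinates -/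

namespace Change

variable {p q : ℕ} {U V : Opens (Fin p → ℝ)} (C : Change (Fin p) (Fin q) U V)

theorem isInvPair : IsInvPair C.jac C.G := ⟨C.hom_jac, C.hom_G, C.jac_mul_G, C.G_mul_jac⟩

/-- The Berezinian of the Jacobian matrix. -/
def ber : Sm (Fin q) U := berezinian C.jac

theorem hom_ber : Hom 0 C.ber := C.isInvPair.hom_berezinian

theorem Φ_ber : C.Φ C.symm.ber = berezinian C.G := C.symm.isInvPair.map_berezinian C.isSHom_Φ

/-- The full multiplicativity of the Berezinian is not needed. All odd derivatives of the product
vanish by the logarithmic derivative formula, so each of its values is a scalar, and the scalar is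
found by passing to bodies. -/
theorem ber_mul : C.ber * C.Φ C.symm.ber = 1 := by
  rw [Φ_ber]
  refine Sm.ext fun x => ?_
  have h1 : ∀ α, oddD α ((C.ber * berezinian C.G).1 x) = 0 := by
    intro α
    rw [← Sm.der_inr_val]
    exact congrArg (fun g : Sm (Fin q) U => g.1 x)
      (C.isInvPair.sder_berezinian_mul (Sm.isSDer_der (Sum.inr α)))
  have h2 : bodyHom ((C.ber * berezinian C.G).1 x) = 1 := by
    have h3 := (C.isInvPair.map (Sm.isSHom_ev x)).bodyHom_berezinian_mul
    rw [← C.isInvPair.map_berezinian (Sm.isSHom_ev x),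
      ← C.isInvPair.symm.map_berezinian (Sm.isSHom_ev x)] at h3
    exact h3
  rw [eq_algebraMap_of_oddD_eq_zero h1, h2, map_one]
  rfl

/-- Both matrices are inverse to `C.G`. The argument uses only uniqueness of inverses, not a
composition of the two pullbacks. -/
theorem map_symm_G : C.symm.G.map C.Φ = C.jac := by
  have h : C.G * C.symm.G.map C.Φ = 1 := by
    have := congrArg (fun M => M.map C.Φ) C.symm.jac_mul_G
    simp only [Matrix.map_mul, Matrix.map_one _ (map_zero C.Φ) (map_one C.Φ)] at this
    exact this
  calc _ = C.jac * C.G * C.symm.G.map C.Φ := by rw [C.jac_mul_G, Matrix.one_mul]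
    _ = _ := by rw [Matrix.mul_assoc, h, Matrix.mul_one]

/-- The divergence of the new fibre coordinates is given by the logarithmic derivative of the
Berezinian. -/
theorem sum_der_G (b : Fin p ⊕ Fin q) :
    ∑ a, sg (gpar b * gpar a + gpar a) • Sm.der a (C.G b a) =
      C.ber * C.Φ (Sm.der b C.symm.ber) := by
  -- Liouville's formula is applied to the inverse change of coordinates, whose Jacobian entries
  -- have `G` as pullback. It matches the divergence once the two second derivatives are
  -- interchanged.
  have h1 : Sm.der b C.symm.ber = _ := C.symm.isInvPair.sder_berezinian (Sm.isSDer_der b)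
  rw [h1, map_mul, ← mul_assoc]
  have h2 : C.Φ (berezinian C.symm.jac) = C.Φ C.symm.ber := rfl
  rw [h2, C.ber_mul, one_mul, map_sum]
  refine Finset.sum_congr rfl fun a _ => ?_
  rw [C.G_apply, C.der_Φ, map_sum, Finset.smul_sum]
  refine Finset.sum_congr rfl fun c _ => ?_
  have h3 : C.Φ (C.symm.G a c) = C.jac a c := congrFun (congrFun C.map_symm_G a) c
  have h4 : C.symm.jac c a = Sm.der c (C.S'.Y a) := rfl
  rw [map_smul, map_mul, h3, h4, Sm.der_comm b c, map_smul, mul_smul_comm, smul_smul, ← sg_add]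
  congr 2
  generalize gpar a = x
  generalize gpar b = y
  generalize gpar c = z
  revert x y z
  decide

end Change

/-! ## Powers of even superfunctions -/

section Subst

variable {ε ο ε' ο' : Type*} [Fintype ε] [Fintype ο] [DecidableEq ε] [DecidableEq ο]
  [Fintype ε'] [Fintype ο'] [DecidableEq ε'] [DecidableEq ο']

namespace Subst

variable {U : Opens (ε' → ℝ)} {V : Opens (ε → ℝ)} (S : Subst ε ο ε' ο' U V)

theorem bodyHom_toHom (h : Sm ο V) (x : U) :
    bodyHom ((S.toHom h).1 x) = bodyHom (h.1 (S.pt x)) := by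
  rw [S.toHom_apply (Nat.lt_succ_self _), Finset.sum_range_succ', Sm.add_val, Sm.sum_val, map_add,
    map_sum, E_zero, E₀_val, osAt, (isSHom_oddSubst _).bodyHom]
  refine add_eq_right.2 (Finset.sum_eq_zero fun k _ => ?_)
  have h1 : ∀ j, bodyHom ((S.n j).1 x) = 0 := fun j => by
    rw [n_val]
    exact soul_mem_aug _
  simp [E_succ', h1]

theorem toHom_of_der_eq_zero {h : Sm ο V} (hh : ∀ j, Sm.der (Sum.inl j) h = 0) :
    S.toHom h = S.E₀ h := by
  rw [S.toHom_apply (Nat.lt_succ_self _), Finset.sum_range_succ', E_zero]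
  simp [E_succ', hh]

end Subst

end Subst

section Power

variable {ε ο : Type*} [Fintype ε] [Fintype ο] [DecidableEq ε] [DecidableEq ο]
  {U : Opens (ε → ℝ)}

/-- The punctured line. -/
def punc : Opens (Unit → ℝ) :=
  ⟨{u | u () ≠ 0}, isOpen_ne.preimage (f := fun u : Unit → ℝ => u ()) (by fun_prop)⟩

theorem contDiffOn_punc {f : ℝ → ℝ} (hf : ContDiffOn ℝ ∞ f {0}ᶜ) :
    ContDiffOn ℝ ∞ (fun u : Unit → ℝ => f (u ())) punc :=
  hf.comp (contDiff_apply ℝ ℝ ()).contDiffOn fun _ h => h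

/-- A function on the punctured line as a superfunction. -/
def pfun (f : ℝ → ℝ) (hf : ContDiffOn ℝ ∞ f {0}ᶜ) : Sm Empty punc :=
  Sm.real (fun u => f (u ())) (contDiffOn_punc hf)

theorem contDiffOn_deriv_punc {f : ℝ → ℝ} (hf : ContDiffOn ℝ ∞ f {0}ᶜ) :
    ContDiffOn ℝ ∞ (deriv f) {0}ᶜ := hf.deriv_of_isOpen isOpen_compl_singleton (by simp)

theorem der_pfun (f : ℝ → ℝ) (hf : ContDiffOn ℝ ∞ f {0}ᶜ) (a : Unit) :
    Sm.der (Sum.inl a) (pfun f hf) = pfun (deriv f) (contDiffOn_deriv_punc hf) := by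
  refine Sm.ext fun x => ?_
  rw [pfun, Sm.der_inl_real_val, pfun, Sm.real_val]
  congr 1
  have h1 : DifferentiableAt ℝ f (x.1 ()) :=
    (hf.contDiffAt (isOpen_compl_singleton.mem_nhds x.2)).differentiableAt (by simp)
  have h2 := h1.hasDerivAt.comp_hasFDerivAt x.1
    (ContinuousLinearMap.proj (R := ℝ) (φ := fun _ : Unit => ℝ) ()).hasFDerivAt
  have h3 : fderiv ℝ (fun u : Unit → ℝ => f (u ())) x.1 = _ := h2.fderiv
  rw [h3]
  simp

/-- The substitution of an even superfunction with nonvanishing body for the coordinate of the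
punctured line. -/
def unitSubst (g : Sm ο U) (hg : Hom 0 g) (hb : ∀ x, bodyHom (g.1 x) ≠ 0) :
    Subst Unit Empty ε ο U punc where
  Y _ := g
  hom a := by
    rcases a with _ | a
    · exact hg
    · exact a.elim
  mem := hb

variable {g : Sm ο U} {hg : Hom 0 g} {hb : ∀ x, bodyHom (g.1 x) ≠ 0}

/-- A function of one variable applied to an even superfunction is a pullback from the punctured
line. Its Taylor terms are those of the explicit sum in `absPow`, so the properties of pullbacks
apply to real powers. -/
theorem factorial_smul_E_pfun (k : ℕ) {f : ℝ → ℝ} (hf : ContDiffOn ℝ ∞ f {0}ᶜ) (x : U) :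
    ((k.factorial : ℝ) • (unitSubst g hg hb).E k (pfun f hf)).1 x =
      iteratedDeriv k f (bodyHom (g.1 x)) • soul (g.1 x) ^ k := by
  induction k generalizing f with
  | zero =>
    rw [Nat.factorial_zero, Nat.cast_one, one_smul, iteratedDeriv_zero, pow_zero,
      ← Algebra.algebraMap_eq_smul_one, Subst.E_zero, Subst.E₀_val]
    refine ((unitSubst g hg hb).osAt x).commutes _ |>.trans ?_
    exact congrArg (fun t => algebraMap ℝ (Gr ο) (f t)) ((unitSubst g hg hb).z_apply x ())
  | succ k ih =>
    rw [Nat.factorial_succ, mul_comm, Nat.cast_mul, ← smul_smul, Subst.E_succ]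
    rw [Fintype.sum_unique, der_pfun, ← mul_smul_comm, Sm.mul_val, ih, Subst.n_val,
      iteratedDeriv_succ', pow_succ', mul_smul_comm]
    rfl

theorem contDiffOn_abs_rpow (r : ℝ) : ContDiffOn ℝ ∞ (fun u : ℝ => |u| ^ r) {0}ᶜ :=
  fun _ hu => ((contDiffAt_abs hu).rpow_const_of_ne (abs_pos.2 hu).ne').contDiffWithinAt

/-- The function `|u|^r` of an even superfunction with nonvanishing body. -/
def absP (g : Sm ο U) (hg : Hom 0 g) (hb : ∀ x, bodyHom (g.1 x) ≠ 0) (r : ℝ) : Sm ο U :=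
  (unitSubst g hg hb).toHom (pfun (fun u => |u| ^ r) (contDiffOn_abs_rpow r))

theorem absP_val (r : ℝ) (x : U) : (absP g hg hb r).1 x = absPow (g.1 x) r := by
  rw [absP, Subst.toHom_apply _ (Nat.lt_succ_self _), Sm.sum_val, absPow]
  refine Finset.sum_congr rfl fun k _ => ?_
  have := factorial_smul_E_pfun (hg := hg) (hb := hb) k (contDiffOn_abs_rpow r) x
  rw [Sm.smul_val] at this
  rw [mul_smul, body_eq, ← this, smul_smul, inv_mul_cancel₀ (by positivity), one_smul]

/-- The sign of a nonzero real number. -/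
def rsgn (u : ℝ) : ℝ := if 0 < u then 1 else -1

theorem rsgn_mul_self (u : ℝ) : rsgn u * rsgn u = 1 := by
  unfold rsgn
  split_ifs <;> simp

theorem rsgn_mul (u : ℝ) : rsgn u * u = |u| := by
  unfold rsgn
  split_ifs with h
  · rw [one_mul, abs_of_pos h]
  · rw [abs_of_nonpos (not_lt.1 h), neg_one_mul]

theorem rsgn_eventuallyEq {u : ℝ} (hu : u ≠ 0) : rsgn =ᶠ[nhds u] fun _ => rsgn u := by
  rcases hu.lt_or_gt with h | h
  · filter_upwards [Iio_mem_nhds h] with v hv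
    simp [rsgn, not_lt.2 (le_of_lt (mem_Iio.1 hv)), not_lt.2 h.le]
  · filter_upwards [Ioi_mem_nhds h] with v hv
    simp only [mem_Ioi] at hv
    simp [rsgn, hv, h]

theorem contDiffOn_rsgn : ContDiffOn ℝ ∞ rsgn {0}ᶜ := fun _ hu =>
  (contDiffAt_const.congr_of_eventuallyEq (rsgn_eventuallyEq hu)).contDiffWithinAt

theorem der_pfun_rsgn (a : Unit) : Sm.der (Sum.inl a) (pfun rsgn contDiffOn_rsgn) = 0 := by
  rw [der_pfun]
  refine Sm.ext fun x => ?_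
  rw [pfun, Sm.real_val, (rsgn_eventuallyEq x.2).deriv_eq, deriv_const, map_zero]
  rfl

/-- The sign of an even superfunction with nonvanishing body. -/
def sgnP (g : Sm ο U) (hg : Hom 0 g) (hb : ∀ x, bodyHom (g.1 x) ≠ 0) : Sm ο U :=
  (unitSubst g hg hb).toHom (pfun rsgn contDiffOn_rsgn)

theorem sgnP_val (x : U) : (sgnP g hg hb).1 x = algebraMap ℝ _ (rsgn (bodyHom (g.1 x))) := by
  rw [sgnP, Subst.toHom_of_der_eq_zero _ fun _ => der_pfun_rsgn _, Subst.E₀_val]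
  refine ((unitSubst g hg hb).osAt x).commutes _ |>.trans ?_
  exact congrArg (fun t => algebraMap ℝ (Gr ο) (rsgn t)) ((unitSubst g hg hb).z_apply x ())

theorem hom_sgnP : Hom 0 (sgnP g hg hb) := Sm.hom_iff.2 fun x => by
  rw [sgnP_val]
  exact hom_algebraMap _

theorem sgnP_mul_self : sgnP g hg hb * sgnP g hg hb = 1 := Sm.ext fun x => by
  rw [Sm.mul_val, sgnP_val, ← map_mul, rsgn_mul_self, map_one]
  rfl

theorem der_sgnP (a : ε ⊕ ο) : Sm.der a (sgnP g hg hb) = 0 := by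
  rw [sgnP, Subst.der_toHom]
  refine Finset.sum_eq_zero fun b _ => ?_
  rcases b with b | b
  · rw [der_pfun_rsgn, map_zero, mul_zero]
  · exact b.elim

/-- The absolute value differs from the function by a sign that is locally constant, so absolute
values can be removed when differentiating. -/
theorem absP_one : absP g hg hb 1 = sgnP g hg hb * g := by
  have h : pfun (fun u => |u| ^ (1 : ℝ)) (contDiffOn_abs_rpow 1) =
      pfun rsgn contDiffOn_rsgn * Sm.crd (Sum.inl ()) := by
    refine Sm.ext fun x => ?_
    have e : (Sm.crd (U := punc) (ο := Empty) (Sum.inl ())).1 x =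
      algebraMap ℝ (Gr Empty) (x.1 ()) := rfl
    rw [Sm.mul_val, pfun, pfun, Sm.real_val, Sm.real_val, e, ← map_mul, rsgn_mul, Real.rpow_one]
  rw [absP, h, map_mul, Subst.toHom_crd]
  rfl

/-- The homogeneity of `|u|^r`, differentiated k times. -/
theorem iteratedDeriv_abs_rpow_mul {c : ℝ} (r : ℝ) (k : ℕ) (u : ℝ) :
    c ^ k * iteratedDeriv k (fun u : ℝ => |u| ^ r) (c * u) =
      |c| ^ r * iteratedDeriv k (fun u : ℝ => |u| ^ r) u := by
  have h1 : ∀ (k : ℕ) (f : ℝ → ℝ) (u : ℝ),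
      iteratedDeriv k (fun u => f (c * u)) u = c ^ k * iteratedDeriv k f (c * u) := by
    intro k
    induction k with
    | zero => simp
    | succ k ih =>
      intro f u
      have h : deriv (fun u => f (c * u)) = fun u => c * deriv f (c * u) := by
        funext v
        simpa using deriv_comp_mul_left c f v
      rw [iteratedDeriv_succ', h, iteratedDeriv_const_mul_field, ih, iteratedDeriv_succ']
      ring
  rw [← h1, ← iteratedDeriv_const_mul_field]
  simp only [abs_mul, Real.mul_rpow (abs_nonneg _) (abs_nonneg _)]

theorem absPow_smul (c r : ℝ) (b : Gr ο) : absPow (c • b) r = |c| ^ r • absPow b r := by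
  rw [absPow, absPow, Finset.smul_sum]
  refine Finset.sum_congr rfl fun k _ => ?_
  have h1 : soul (c • b) = c • soul b := by
    rw [soul_eq, soul_eq, map_smul, smul_sub, Algebra.algebraMap_eq_smul_one,
      Algebra.algebraMap_eq_smul_one, smul_eq_mul, mul_smul]
  rw [h1, smul_pow, body_eq, body_eq, map_smul, smul_eq_mul, smul_smul, smul_smul]
  congr 1
  linear_combination (k.factorial : ℝ)⁻¹ * iteratedDeriv_abs_rpow_mul (c := c) r k (bodyHom b)

end Power

/-! ### The absolute value of the Jacobian -/

namespace Change

variable {p q : ℕ} {U V : Opens (Fin p → ℝ)} (C : Change (Fin p) (Fin q) U V)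

theorem body_ber_mul (x : U) :
    bodyHom (C.ber.1 x) * bodyHom (C.symm.ber.1 (C.S.pt x)) = 1 := by
  have := congrArg (fun g : Sm (Fin q) U => bodyHom (g.1 x)) C.ber_mul
  simp only [Sm.mul_val, map_mul, Sm.one_val, map_one] at this
  rwa [Φ, Subst.bodyHom_toHom] at this

theorem body_ber_ne_zero (x : U) : bodyHom (C.ber.1 x) ≠ 0 :=
  left_ne_zero_of_mul_eq_one (C.body_ber_mul x)

/-- The power of the absolute value of the Jacobian. -/
def absBer (r : ℝ) : Sm (Fin q) U := absP C.ber C.hom_ber C.body_ber_ne_zero r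

/-- The sign of the Jacobian. -/
def sgnBer : Sm (Fin q) U := sgnP C.ber C.hom_ber C.body_ber_ne_zero

theorem absBer_val (r : ℝ) (x : U) : (C.absBer r).1 x = absPow (C.ber.1 x) r := absP_val r x

theorem absBer_one : C.absBer 1 = C.sgnBer * C.ber := absP_one

theorem sgnBer_mul_self : C.sgnBer * C.sgnBer = 1 := sgnP_mul_self

theorem hom_sgnBer : Hom 0 C.sgnBer := hom_sgnP

theorem der_sgnBer (a : Fin p ⊕ Fin q) : Sm.der a C.sgnBer = 0 := der_sgnP a

/-- The bodies of the two Jacobians have product 1, so they have the same sign. -/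
theorem Φ_sgnBer : C.Φ C.symm.sgnBer = C.sgnBer := by
  refine Sm.ext fun x => ?_
  rw [Φ, Subst.toHom_of_der_eq_zero _ fun _ => C.symm.der_sgnBer _, Subst.E₀_val, sgnBer, sgnBer,
    sgnP_val, sgnP_val]
  have h : 0 < bodyHom (C.ber.1 x) * bodyHom (C.symm.ber.1 (C.S.pt x)) := by
    rw [C.body_ber_mul x]
    exact one_pos
  have h2 : rsgn (bodyHom (C.symm.ber.1 (C.S.pt x))) = rsgn (bodyHom (C.ber.1 x)) :=
    if_congr (pos_iff_pos_of_mul_pos h).symm rfl rfl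
  rw [AlgHom.commutes, h2]

theorem hom_absBer_one : Hom 0 (C.absBer 1) := by
  rw [absBer_one]
  exact (C.hom_sgnBer.mul C.hom_ber).cast (by simp)

theorem absBer_mul : C.absBer 1 * C.Φ (C.symm.absBer 1) = 1 := by
  rw [absBer_one, absBer_one, map_mul, Φ_sgnBer,
    SuperRing.even_comm (hom_zero_iff.1 C.hom_sgnBer) C.ber, mul_assoc, ← mul_assoc C.sgnBer,
    sgnBer_mul_self, one_mul, ber_mul]

theorem body_absBer_one (x : U) : 0 < bodyHom ((C.absBer 1).1 x) := by
  rw [absBer_one, Sm.mul_val, sgnBer, sgnP_val, map_mul, AlgHom.commutes]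
  exact (rsgn_mul _).symm ▸ abs_pos.2 (C.body_ber_ne_zero x)

/-- The sign of the Jacobian has zero derivatives and square 1, so it cancels from the logarithmic
derivative. -/
theorem sum_der_G_abs (b : Fin p ⊕ Fin q) :
    ∑ a, sg (gpar b * gpar a + gpar a) • Sm.der a (C.G b a) =
      C.absBer 1 * C.Φ (Sm.der b (C.symm.absBer 1)) := by
  rw [sum_der_G, absBer_one, absBer_one, (Sm.isSDer_der b).leib C.symm.hom_sgnBer,
    C.symm.der_sgnBer, zero_mul, zero_add, mul_zero, sg_zero, one_smul, map_mul, Φ_sgnBer,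
    SuperRing.even_comm (hom_zero_iff.1 C.hom_sgnBer) C.ber, mul_assoc, ← mul_assoc C.sgnBer,
    sgnBer_mul_self, one_mul]

theorem absPow_smul_absBer {c : ℝ} (w : ℝ) (x : U) :
    absPow (c • (C.absBer 1).1 x) w = |c| ^ w • (C.absBer w).1 x := by
  have h : (C.absBer 1).1 x = rsgn (bodyHom (C.ber.1 x)) • C.ber.1 x := by
    rw [absBer_one, Sm.mul_val, sgnBer, sgnP_val, Algebra.smul_def]
  have h2 : |rsgn (bodyHom (C.ber.1 x))| = 1 := by
    unfold rsgn
    split_ifs <;> simp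
  rw [h, absPow_smul, absPow_smul, h2, Real.one_rpow, one_smul, absBer_val]

end Change

/-- The new fibre coordinate is linear in the old ones with coefficients from the base. Its
Laplacian is therefore a divergence of the coefficients. -/
theorem Change.lap_star {ε ο : Type*} [Fintype ε] [Fintype ο] [DecidableEq ε] [DecidableEq ο]
    {U V : Opens (ε → ℝ)} (C : Change ε ο U V) (b : ε ⊕ ο) :
    lap gpar bder sder (C.star b) =
      sg (gpar b) • bas (∑ a, sg (gpar b * gpar a + gpar a) • Sm.der a (C.G b a)) := by
  rw [lap_apply, map_sum, Finset.smul_sum]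
  refine Finset.sum_congr rfl fun a _ => ?_
  rw [C.sder_star, map_smul, bder_bas, map_smul, smul_smul, smul_smul, ← sg_add, ← sg_add]
  congr 2
  generalize gpar a = x
  generalize gpar b = y
  revert x y
  decide

/-! ## Changes of coordinates of the space of the algebra of densities -/

section Hat

variable {p q : ℕ} {U V : Opens (Fin p → ℝ)}

/-- The open subset `t > 0` over an open set of the base. -/
def hatO (U : Opens (Fin p → ℝ)) : Opens (Option (Fin p) → ℝ) :=
  ⟨Supermanifold.hatSet U, Supermanifold.isOpen_hatSet U.2⟩

/-- The inclusion of the coordinates of the base. -/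
def emb : Fin p ⊕ Fin q → Option (Fin p) ⊕ Fin q := Sum.map some id

/-- The index of the coordinate `t`. -/
def tix : Option (Fin p) ⊕ Fin q := Sum.inl none

theorem emb_ne (b : Fin p ⊕ Fin q) : emb b ≠ tix := by rcases b with i | α <;> simp [emb, tix]

theorem gpar_emb (b : Fin p ⊕ Fin q) : gpar (emb b) = gpar b := by rcases b with i | α <;> rfl

theorem gpar_tix : gpar (tix : Option (Fin p) ⊕ Fin q) = 0 := rfl

theorem hat_cases {C : Option (Fin p) ⊕ Fin q → Prop} (h0 : C tix) (h1 : ∀ b, C (emb b))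
    (a : Option (Fin p) ⊕ Fin q) : C a := by
  rcases a with (_ | i) | α
  · exact h0
  · exact h1 (Sum.inl i)
  · exact h1 (Sum.inr α)

theorem sum_hat {M : Type*} [AddCommMonoid M] (f : Option (Fin p) ⊕ Fin q → M) :
    ∑ a, f a = f tix + ∑ b, f (emb b) := by
  simp only [Fintype.sum_sum_type, Fintype.sum_option, emb, tix, Sum.map_inl, Sum.map_inr, id]
  rw [add_assoc]

/-- The superfunctions on the base as superfunctions of weight zero. -/
def up : Sm (Fin q) U →ₐ[ℝ] Sm (Fin q) (hatO U) :=
  (Subst.incl some id (hatO U) U fun _ h => h.1).toHom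

theorem up_val (g : Sm (Fin q) U) (z : hatO U) :
    (up g).1 z = g.1 ⟨fun i => z.1 (some i), z.2.1⟩ :=
  (Subst.toHom_incl_val Function.injective_id g z).trans (relabel_id _)

theorem hom_up {d : ZMod 2} {g : Sm (Fin q) U} (hg : Hom d g) : Hom d (up g) :=
  (Subst.isSHom_toHom _).hom hg

theorem up_crd (b : Fin p ⊕ Fin q) : up (Sm.crd (U := U) b) = Sm.crd (emb b) :=
  Subst.toHom_crd _ b

theorem der_emb_up (b : Fin p ⊕ Fin q) (g : Sm (Fin q) U) :
    Sm.der (emb b) (up g) = up (Sm.der b g) :=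
  Subst.der_toHom_incl (ε := Fin p) (ο := Fin q) (ε' := Option (Fin p)) (ο' := Fin q)
    (U := hatO U) (V := U) (hUV := fun _ h => h.1) (Option.some_injective _)
    Function.injective_id b g

theorem der_tix_up (g : Sm (Fin q) U) : Sm.der tix (up g) = 0 :=
  Subst.der_toHom_incl_of_ne (ε := Fin p) (ο := Fin q) (ε' := Option (Fin p)) (ο' := Fin q)
    (U := hatO U) (V := U) (hUV := fun _ h => h.1) emb_ne g

/-- The coordinate `t`. -/
def tc : Sm (Fin q) (hatO U) := Sm.crd tix

theorem hom_tc : Hom 0 (tc (q := q) (U := U)) :=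
  Sm.hom_crd (ε := Option (Fin p)) (ο := Fin q) (U := hatO U) tix

theorem tc_val (z : hatO U) : (tc (q := q)).1 z = algebraMap ℝ _ (z.1 none) := rfl

theorem der_tix_tc : Sm.der tix (tc (q := q) (U := U)) = 1 := by
  rw [tc, Sm.der_crd, if_pos rfl]

theorem der_emb_tc (b : Fin p ⊕ Fin q) : Sm.der (emb b) (tc (q := q) (U := U)) = 0 := by
  rw [tc, Sm.der_crd, if_neg (emb_ne b)]

namespace Change

variable (C : Change (Fin p) (Fin q) U V)

/-- The new coordinates of the space of the algebra of densities. -/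
def hatY : Option (Fin p) ⊕ Fin q → Sm (Fin q) (hatO U) :=
  Sum.elim (fun b => b.elim (tc * up (C.absBer 1)) fun b => up (C.S.Y (Sum.inl b)))
    fun β => up (C.S.Y (Sum.inr β))

theorem hatY_emb (b : Fin p ⊕ Fin q) : C.hatY (emb b) = up (C.S.Y b) := by
  rcases b with i | α <;> rfl

theorem hatY_tix : C.hatY tix = tc * up (C.absBer 1) := rfl

theorem hom_hatY (a : Option (Fin p) ⊕ Fin q) : Hom (gpar a) (C.hatY a) := by
  induction a using hat_cases with
  | h0 => exact (hom_tc.mul (hom_up C.hom_absBer_one)).cast (by simp [gpar_tix])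
  | h1 b =>
    rw [hatY_emb, gpar_emb]
    exact hom_up (C.S.hom b)

theorem bodyHom_hatY_tix (z : hatO U) : 0 < bodyHom ((C.hatY tix).1 z) := by
  rw [hatY_tix, Sm.mul_val, map_mul, up_val, tc_val, AlgHom.commutes]
  exact mul_pos z.2.2 (C.body_absBer_one _)

theorem hatY_mem (z : hatO U) : (fun i => bodyHom ((C.hatY (Sum.inl i)).1 z)) ∈ hatO V := by
  refine ⟨?_, C.bodyHom_hatY_tix z⟩
  have h := C.S.mem ⟨fun i => z.1 (some i), z.2.1⟩
  simp only [← up_val] at h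
  exact h

/-- The change of coordinates of the space of the algebra of densities, as a substitution. -/
def hatS : Subst (Option (Fin p)) (Fin q) (Option (Fin p)) (Fin q) (hatO U) (hatO V) :=
  ⟨C.hatY, C.hom_hatY, C.hatY_mem⟩

theorem hatS_up (g : Sm (Fin q) V) : C.hatS.toHom (up g) = up (C.Φ g) := by
  refine (C.hatS.toHom_toHom_incl _ (Option.some_injective _) Function.injective_id g).trans
    (Sm.ext fun z => ?_)
  rw [up_val]
  exact C.S.toHom_val_eq (C.hatS.comp some id fun _ h => h.1) (χ := AlgHom.id ℝ _)
    (fun _ => rfl) (x := ⟨fun i => z.1 (some i), z.2.1⟩) (x' := z) (fun b => by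
      rw [AlgHom.id_apply, ← up_val, ← hatY_emb]
      rfl) g

theorem hatS_tc : C.hatS.toHom tc = tc * up (C.absBer 1) := Subst.toHom_crd _ _

theorem hatS_hatY (b : Option (Fin p) ⊕ Fin q) : C.hatS.toHom (C.symm.hatY b) = Sm.crd b := by
  induction b using hat_cases with
  | h0 =>
    rw [hatY_tix, map_mul, hatS_tc, hatS_up, mul_assoc, ← map_mul, absBer_mul, map_one, mul_one]
    rfl
  | h1 b =>
    rw [hatY_emb, hatS_up, ← up_crd]
    exact congrArg up (C.l b)

/-- The change of coordinates of the space of the algebra of densities. -/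
def hat : Change (Option (Fin p)) (Fin q) (hatO U) (hatO V) :=
  ⟨C.hatS, C.symm.hatS, C.hatS_hatY, C.symm.hatS_hatY⟩

/-- The logarithmic derivative of the Jacobian of the inverse change of coordinates. -/
def logDer (b : Fin p ⊕ Fin q) : Sm (Fin q) U :=
  C.absBer 1 * C.Φ (Sm.der b (C.symm.absBer 1))

theorem hom_logDer (b : Fin p ⊕ Fin q) : Hom (gpar b) (C.logDer b) :=
  (C.hom_absBer_one.mul (C.isSHom_Φ.hom ((Sm.isSDer_der b).hom C.symm.hom_absBer_one))).cast
    (by simp)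

theorem hat_Φ_up (g : Sm (Fin q) V) : C.hat.Φ (up g) = up (C.Φ g) := C.hatS_up g

theorem hat_Φ_tc : C.hat.Φ tc = tc * up (C.absBer 1) := C.hatS_tc

theorem hat_G_apply (a b : Option (Fin p) ⊕ Fin q) :
    C.hat.G a b = C.hat.Φ (Sm.der a (C.symm.hatY b)) := rfl

theorem hat_G_emb_emb (b a : Fin p ⊕ Fin q) : C.hat.G (emb b) (emb a) = up (C.G b a) := by
  rw [hat_G_apply, hatY_emb, der_emb_up, hat_Φ_up]
  rfl

/-- The old `t` is the new one times the Jacobian of the inverse change. Its derivative along a new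
base coordinate, rewritten in old coordinates, is `t` times a logarithmic derivative. -/
theorem hat_G_emb_tix (b : Fin p ⊕ Fin q) : C.hat.G (emb b) tix = tc * up (C.logDer b) := by
  rw [hat_G_apply, hatY_tix, (Sm.isSDer_der _).leib hom_tc, der_emb_tc, zero_mul, zero_add,
    mul_zero, sg_zero, one_smul, der_emb_up, map_mul, hat_Φ_tc, hat_Φ_up, mul_assoc, ← map_mul]
  rfl

theorem hat_G_tix_emb (a : Fin p ⊕ Fin q) : C.hat.G tix (emb a) = 0 := by
  rw [hat_G_apply, hatY_emb, der_tix_up, map_zero]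

theorem hat_G_tix_tix :
    C.hat.G tix tix = up (C.Φ (C.symm.absBer 1)) := by
  rw [hat_G_apply, hatY_tix, (Sm.isSDer_der _).leib hom_tc, der_tix_tc, one_mul,
    der_tix_up, mul_zero, mul_zero, smul_zero, add_zero, hat_Φ_up]

end Change

/-! ### Invariance of δ and of the weight on the odd cotangent bundle of the space of densities -/

/-- The superfunctions on the odd cotangent bundle of the space of the algebra of densities. -/
abbrev SmHat (q : ℕ) (U : Opens (Fin p → ℝ)) : Type :=
  Sm (Fin q ⊕ Option (Fin p)) (cot (Fin q) (hatO U))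

theorem contDiffOn_tpw (m : ℝ) :
    ContDiffOn ℝ ∞ (fun y : Option (Fin p) ⊕ Fin q → ℝ => y (Sum.inl none) ^ m)
      (cot (Fin q) (hatO U)) :=
  fun _ hy => ((contDiff_apply ℝ ℝ (Sum.inl none)).contDiffAt.rpow_const_of_ne
    (ne_of_gt hy.2)).contDiffWithinAt

/-- The power `t^m`. -/
def tpw (m : ℝ) : SmHat q U := Sm.real _ (contDiffOn_tpw m)

theorem tpw_val (m : ℝ) (y : cot (Fin q) (hatO U)) :
    (tpw m).1 y = algebraMap ℝ _ (y.1 (Sum.inl none) ^ m) := rfl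

theorem hom_tpw (m : ℝ) : Hom 0 (tpw (q := q) (U := U) m) := Sm.hom_real _ _

theorem tpw_add (l m : ℝ) : tpw (q := q) (U := U) (l + m) = tpw l * tpw m := Sm.ext fun y => by
  rw [Sm.mul_val, tpw_val, tpw_val, tpw_val, ← map_mul, Real.rpow_add y.2.2]

/-- The coordinate `t` on the odd cotangent bundle. -/
def tv : SmHat q U := bas tc

theorem hom_tv : Hom 0 (tv (q := q) (U := U)) := hom_bas hom_tc

theorem tv_val (y : cot (Fin q) (hatO U)) :
    (tv (q := q)).1 y = algebraMap ℝ _ (y.1 (Sum.inl none)) := by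
  rw [tv, bas_val, tc_val, AlgHom.commutes]

theorem tv_eq : tv (q := q) (U := U) = tpw 1 := Sm.ext fun y => by
  rw [tv_val, tpw_val, Real.rpow_one]

theorem tv_mul_tpw : tv (q := q) (U := U) * tpw (-1) = 1 := by
  rw [tv_eq, ← tpw_add, add_neg_cancel]
  refine Sm.ext fun y => ?_
  rw [tpw_val, Real.rpow_zero, map_one]
  rfl

/-- The fibre coordinate `t*`. -/
def tst : SmHat q U := fib tix

theorem hom_tst : Hom 1 (tst (q := q) (U := U)) := (hom_fib tix).cast (by simp [gpar_tix])

/-- The coordinate expression on the odd cotangent bundle of the space of the algebra of densities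
of a superfunction on the odd cotangent bundle of the base. -/
def sub : Sm (Fin q ⊕ Fin p) (cot (Fin q) U) →ₐ[ℝ] SmHat q U :=
  (Subst.incl (Sum.map some id) (Sum.map id some) (cot (Fin q) (hatO U)) (cot (Fin q) U)
    fun _ h => h.1).toHom

theorem sub_val (g : Sm (Fin q ⊕ Fin p) (cot (Fin q) U)) (y : cot (Fin q) (hatO U)) :
    (sub g).1 y = relabel (Sum.map id some)
      (g.1 ⟨fun i => y.1 (Sum.map some id i), y.2.1⟩) :=
  Subst.toHom_incl_val (φe := Sum.map some id) (φo := Sum.map id some)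
    (U := cot (Fin q) (hatO U)) (V := cot (Fin q) U) (hUV := fun _ h => h.1)
    (Sum.map_injective.2 ⟨Function.injective_id, Option.some_injective _⟩) g y

theorem isSHom_sub : IsSHom (sub (q := q) (U := U)) := Subst.isSHom_toHom _

theorem map_baseIdx (b : Fin p ⊕ Fin q) :
    Sum.map (Sum.map some id) (Sum.map id some) (baseIdx b) = baseIdx (emb b) := by
  rcases b with i | α <;> rfl

theorem map_starIdx (b : Fin p ⊕ Fin q) :
    Sum.map (Sum.map some id) (Sum.map id some) (starIdx b) = starIdx (emb b) := by
  rcases b with i | α <;> rfl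

theorem cot_cases {ε ο : Type*} {C : (ε ⊕ ο) ⊕ (ο ⊕ ε) → Prop} (h0 : ∀ a, C (baseIdx a))
    (h1 : ∀ a, C (starIdx a)) (a : (ε ⊕ ο) ⊕ (ο ⊕ ε)) : C a := by
  rcases a with (i | α) | (α | i)
  · exact h0 (Sum.inl i)
  · exact h1 (Sum.inr α)
  · exact h0 (Sum.inr α)
  · exact h1 (Sum.inl i)

theorem der_sub (a : (Fin p ⊕ Fin q) ⊕ (Fin q ⊕ Fin p))
    (g : Sm (Fin q ⊕ Fin p) (cot (Fin q) U)) :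
    Sm.der (Sum.map (Sum.map some id) (Sum.map id some) a) (sub g) = sub (Sm.der a g) :=
  Subst.der_toHom_incl (ε := Fin p ⊕ Fin q) (ο := Fin q ⊕ Fin p) (ε' := Option (Fin p) ⊕ Fin q)
    (ο' := Fin q ⊕ Option (Fin p)) (φe := Sum.map some id) (φo := Sum.map id some)
    (U := cot (Fin q) (hatO U)) (V := cot (Fin q) U)
    (hUV := fun _ h => h.1) (Sum.map_injective.2 ⟨Option.some_injective _, Function.injective_id⟩)
    (Sum.map_injective.2 ⟨Function.injective_id, Option.some_injective _⟩) a g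

theorem der_sub_of_ne {a : (Option (Fin p) ⊕ Fin q) ⊕ (Fin q ⊕ Option (Fin p))}
    (ha : ∀ b : Fin p ⊕ Fin q, baseIdx (emb b) ≠ a) (ha' : ∀ b : Fin p ⊕ Fin q, starIdx (emb b) ≠ a)
    (g : Sm (Fin q ⊕ Fin p) (cot (Fin q) U)) : Sm.der a (sub g) = 0 :=
  Subst.der_toHom_incl_of_ne (ε := Fin p ⊕ Fin q) (ο := Fin q ⊕ Fin p)
    (ε' := Option (Fin p) ⊕ Fin q) (ο' := Fin q ⊕ Option (Fin p)) (φe := Sum.map some id)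
    (φo := Sum.map id some) (U := cot (Fin q) (hatO U)) (V := cot (Fin q) U)
    (hUV := fun _ h => h.1) (fun b => by
      induction b using cot_cases with
      | h0 b => rw [map_baseIdx]; exact ha b
      | h1 b => rw [map_starIdx]; exact ha' b) g

theorem der_real_ne {ε ο : Type*} [Fintype ε] [Fintype ο] [DecidableEq ε] [DecidableEq ο]
    {U : Opens (ε → ℝ)} {i : ε} {f : ℝ → ℝ} (hf : ContDiffOn ℝ ∞ (fun x : ε → ℝ => f (x i)) U)
    (hf' : ∀ x ∈ U, DifferentiableAt ℝ f (x i)) (a : ε ⊕ ο) (x : U) :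
    (Sm.der a (Sm.real _ hf)).1 x =
      if a = Sum.inl i then algebraMap ℝ _ (deriv f (x.1 i)) else 0 := by
  rcases a with j | α
  · rw [Sm.der_inl_real_val]
    have h2 := (hf' x x.2).hasDerivAt.comp_hasFDerivAt x.1
      (ContinuousLinearMap.proj (R := ℝ) (φ := fun _ : ε => ℝ) i).hasFDerivAt
    have h3 : fderiv ℝ (fun u : ε → ℝ => f (u i)) x.1 = _ := h2.fderiv
    rw [h3]
    by_cases h : j = i
    · subst h
      simp
    · simp [h, Ne.symm h]
  · rw [Sm.der_inr_real]
    simp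

theorem der_tpw (m : ℝ) (a : (Option (Fin p) ⊕ Fin q) ⊕ (Fin q ⊕ Option (Fin p))) :
    Sm.der a (tpw (U := U) m) =
      if a = baseIdx tix then m • (tpw (-1) * tpw m) else 0 := by
  refine Sm.ext fun y => ?_
  have hy : y.1 (Sum.inl none) ≠ 0 := ne_of_gt y.2.2
  have h0 : (Sm.der a (tpw (q := q) (U := U) m)).1 y = _ :=
    der_real_ne (f := fun t => t ^ m) (contDiffOn_tpw m)
      (fun x hx => (Real.hasDerivAt_rpow_const (Or.inl (ne_of_gt hx.2))).differentiableAt) a y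
  have h1 : (baseIdx (tix : Option (Fin p) ⊕ Fin q)) = Sum.inl (Sum.inl none) := rfl
  rw [h0, h1]
  split_ifs with h
  · rw [Sm.smul_val, ← tpw_add, tpw_val, (Real.hasDerivAt_rpow_const (Or.inl hy)).deriv,
      Algebra.smul_def, ← map_mul, neg_add_eq_sub]
  · rfl

/-- Connects the concrete coordinates with the algebraic relations from which the formulas for δ and
the weight were derived. -/
theorem isHatForm : IsHatForm (gpar (ε := Option (Fin p)) (ο := Fin q)) (bder (U := hatO U)) sder
    (gpar (ε := Fin p) (ο := Fin q)) (bder (U := U)) sder tix (tpw (-1)) tv tst sub tpw emb where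
  cot := isCotDer
  cotc := isCotDer
  par_n := gpar_tix
  par_emb := gpar_emb
  emb_ne := emb_ne
  sum_eq := sum_hat
  hti := hom_tpw _
  htv := hom_tv
  htt := tv_mul_tpw
  hτ := hom_tst
  hJ := isSHom_sub
  htp := hom_tpw
  tp_add := tpw_add
  D_τ a := bder_fib _ _
  Ds_τ := by rw [tst, sder_fib, if_pos rfl]
  Ds_τ' a ha := by rw [tst, sder_fib, if_neg ha]
  Ds_ti := by rw [sder, der_tpw, if_neg (baseIdx_ne_starIdx _ _).symm]
  Dn_tv := by rw [tv, bder_bas, der_tix_tc, map_one]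
  D_tv b := by rw [tv, bder_bas, der_emb_tc, map_zero]
  Ds_tv a := sder_bas _ _
  Dn_tp m := by rw [bder, der_tpw, if_pos rfl]
  D_tp b m := by rw [bder, der_tpw, if_neg fun h => emb_ne b (baseIdx_injective h)]
  Ds_tp a m := by rw [sder, der_tpw, if_neg (baseIdx_ne_starIdx _ _).symm]
  Dn_J x := der_sub_of_ne (fun b h => emb_ne b (baseIdx_injective h))
    (fun b => (baseIdx_ne_starIdx _ _).symm) x
  Dsn_J x := der_sub_of_ne (fun b => baseIdx_ne_starIdx _ _)
    (fun b h => emb_ne b (starIdx_injective h)) x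
  D_J b x := by rw [bder, ← map_baseIdx, der_sub]; rfl
  Ds_J b x := by rw [sder, ← map_starIdx, der_sub]; rfl

/-- The operator `δ`. -/
def del (F : SmHat q U) : SmHat q U := dlt gpar bder sder tix (tpw (-1)) F

/-- The weight operator. -/
def wt (F : SmHat q U) : SmHat q U := tv * bder tix F - tst * sder tix F

namespace Change

variable (C : Change (Fin p) (Fin q) U V)

theorem hat_star_tix : C.hat.star tix = bas (up (C.Φ (C.symm.absBer 1))) * tst := by
  rw [star, sum_hat, hat_G_tix_tix]
  simp only [hat_G_tix_emb, map_zero, zero_mul, Finset.sum_const_zero, add_zero]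
  rfl

theorem hat_star_emb (b : Fin p ⊕ Fin q) : C.hat.star (emb b) =
    tv * bas (up (C.logDer b)) * tst + ∑ a, bas (up (C.G b a)) * fib (emb a) := by
  rw [star, sum_hat, hat_G_emb_tix, map_mul]
  simp only [hat_G_emb_emb]
  rfl

theorem hat_Ψ_tv : C.hat.Ψ tv = tv * bas (up (C.absBer 1)) := by
  rw [tv, Ψ_bas, hat_Φ_tc, map_mul]
  rfl

theorem hat_Ψ_tpw_neg_one : C.hat.Ψ (tpw (-1)) = tpw (-1) * bas (up (C.Φ (C.symm.absBer 1))) := by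
  have h1 : C.hat.Ψ (tpw (-1)) * (tv * bas (up (C.absBer 1))) = 1 := by
    rw [← hat_Ψ_tv, ← map_mul, ← SuperRing.even_comm (hom_zero_iff.1 hom_tv), tv_mul_tpw, map_one]
  have h2 : (tv * bas (up (C.absBer 1))) * (tpw (-1) * bas (up (C.Φ (C.symm.absBer 1)))) = 1 := by
    have h3 := SuperRing.even_comm (hom_zero_iff.1 (hom_tpw (q := q) (U := U) (-1)))
    rw [mul_assoc, ← mul_assoc (bas _), ← h3, mul_assoc, ← mul_assoc, tv_mul_tpw, one_mul,
      ← map_mul, ← map_mul, absBer_mul, map_one, map_one]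
  exact left_inv_eq_right_inv h1 h2

/-- The decisive cancellation. The divergence of this row contains the logarithmic derivative once
from the base and once from the `t`-derivative of `t` times it. The term -2t⁻¹∂/∂t* subtracts it
twice, which is the reason for the exponent -2 in the volume form. -/
theorem del_star_emb (b : Fin p ⊕ Fin q) : del (C.hat.star (emb b)) = 0 := by
  have h1 : ∑ a, sg (gpar (emb b) * gpar a + gpar a) • Sm.der a (C.hat.G (emb b) a) =
      (2 : ℝ) • up (C.logDer b) := by
    rw [sum_hat, gpar_tix, mul_zero, add_zero, sg_zero, one_smul, hat_G_emb_tix,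
      (Sm.isSDer_der _).leib hom_tc, der_tix_tc, one_mul, der_tix_up, mul_zero, mul_zero, smul_zero,
      add_zero]
    have h3 : ∑ a, sg (gpar b * gpar a + gpar a) • up (Sm.der a (C.G b a)) = up (C.logDer b) := by
      have h4 := congrArg up (C.sum_der_G_abs b)
      rw [map_sum] at h4
      simp only [map_smul up] at h4
      exact h4
    simp only [hat_G_emb_emb, der_emb_up, gpar_emb]
    rw [h3, two_smul ℝ (up _)]
  rw [del, dlt, lap_star, h1, sder_star, hat_G_emb_tix, gpar_tix, gpar_emb, map_mul, mul_smul_comm,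
    ← mul_assoc]
  have h2 : tpw (-1) * bas tc = (1 : SmHat q U) := by
    rw [SuperRing.even_comm (hom_zero_iff.1 (hom_tpw (q := q) (U := U) (-1)))]
    exact tv_mul_tpw
  rw [h2, one_mul, map_smul, smul_comm, zero_add, one_mul, add_zero, sub_self]

/-- The new `t*` is a `t`-independent multiple of the old one and has zero divergence, so only
-2t⁻¹∂/∂t* acts and yields -2 times the inverse of the new `t`. -/
theorem del_star_tix : del (C.hat.star tix) = -(2 : ℝ) • C.hat.Ψ (tpw (-1)) := by
  have h1 : ∑ a : Option (Fin p) ⊕ Fin q,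
      sg (gpar (tix : Option (Fin p) ⊕ Fin q) * gpar a + gpar a) •
      Sm.der a (C.hat.G tix a) = 0 := by
    rw [sum_hat, hat_G_tix_tix, der_tix_up, smul_zero, zero_add]
    simp only [hat_G_tix_emb, map_zero, smul_zero, Finset.sum_const_zero]
  rw [del, dlt, lap_star, h1, sder_star, hat_G_tix_tix, hat_Ψ_tpw_neg_one, map_zero, smul_zero,
    gpar_tix]
  simp

theorem del_Ψ (F : SmHat q V) : del (C.hat.Ψ F) = C.hat.Ψ (del F) :=
  dlt_comp (R := SmHat q U) (R' := SmHat q V) (par := gpar) (D := bder) (Ds := sder) (n := tix)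
    (ti := tpw (-1)) (D' := bder) (Ds' := sder) (Φ := C.hat.Ψ) (ti' := tpw (-1))
    (T := fun b => bas (C.hat.S.Y b)) (Ys := C.hat.star) (fun _ _ => sder_bas _ _) C.hat.sder_Ψ
    C.hat.lap_Ψ (fun b hb => by
      induction b using hat_cases with
      | h0 => exact absurd rfl hb
      | h1 b => exact C.del_star_emb b) C.del_star_tix F

theorem wt_Ψ (F : SmHat q V) : wt (C.hat.Ψ F) = C.hat.Ψ (wt F) := by
  refine weight_comp (R := SmHat q U) (R' := SmHat q V) (D := bder) (Ds := sder) (n := tix)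
    (tv := tv) (τ := tst) (D' := bder) (Ds' := sder) (Φ := C.hat.Ψ) (tv' := tv) (τ' := tst)
    (T := fun b => bas (C.hat.S.Y b)) (Ys := C.hat.star) (C.hat.bder_Ψ tix) (C.hat.sder_Ψ tix)
    (fun b => ?_) (fun b => ?_) F
  · have h0 : C.hat.S.Y b = C.hatY b := rfl
    rw [sder_bas, mul_zero, sub_zero, bder_bas, h0]
    induction b using hat_cases with
    | h0 =>
      rw [if_pos rfl, hatY_tix, (Sm.isSDer_der _).leib hom_tc, der_tix_tc, one_mul, der_tix_up,
        mul_zero, mul_zero, smul_zero, add_zero, hat_Ψ_tv]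
    | h1 b => rw [if_neg (emb_ne b), hatY_emb, der_tix_up, map_zero, mul_zero]
  · rw [C.hat.sder_star, star, map_sum]
    have h1 : ∀ a, bder tix (bas (C.hat.G b a) * fib a) =
        bas (Sm.der tix (C.hat.G b a)) * fib a := by
      intro a
      rw [(isCotDer.base _).leib (hom_bas (C.hat.hom_G b a)), bder_fib, mul_zero, smul_zero,
        add_zero, bder_bas]
    simp only [h1]
    rw [sum_hat, gpar_tix]
    induction b using hat_cases with
    | h0 =>
      rw [if_pos rfl, hat_G_tix_tix, der_tix_up]
      have h2 : C.hat.Ψ tst = C.hat.star tix := C.hat.Ψ_fib tix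
      have h3 := (C.isSHom_Φ.hom C.symm.hom_absBer_one)
      rw [h2, hat_star_tix, SuperRing.even_comm (hom_zero_iff.1 (hom_bas (hom_up h3)))]
      simp [hat_G_tix_emb, gpar_tix]
    | h1 b =>
      rw [if_neg (emb_ne b), hat_G_emb_tix, (Sm.isSDer_der _).leib hom_tc, der_tix_tc, one_mul,
        der_tix_up, mul_zero, mul_zero, smul_zero, add_zero]
      simp only [hat_G_emb_emb, der_tix_up, map_zero, zero_mul, Finset.sum_const_zero, add_zero,
        zero_add, one_mul, gpar_emb, map_mul]
      -- The inhomogeneous part of the new fibre coordinate contains `t t*`, of weight 0; the two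
      -- contributions to its weight cancel once the sign of commuting with `t*` is restored.
      have h2 : bas (up (C.logDer b)) * fib tix =
          sg (gpar b) • (tst * bas (up (C.logDer b))) := by
        have h3 := (hom_bas (hom_up (C.hom_logDer b))).comm (hom_tst (q := q) (U := U))
        rwa [mul_one] at h3
      have h4 := SuperRing.even_comm (hom_zero_iff.1 (hom_tv (q := q) (U := U)))
      have h5 : bas tc = tv (q := q) (U := U) := rfl
      rw [h2, h5]
      simp only [mul_smul_comm, ← mul_assoc, h4 tst, sub_self]

end Change

end Hat

/-! ## The lift in coordinates -/

section Lift

variable {p q : ℕ} {U V : Opens (Fin p → ℝ)}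

theorem bas_up (g : Sm (Fin q) U) : bas (up g) = sub (bas g) := by
  refine ((Subst.incl Sum.inl Sum.inl (cot (Fin q) (hatO U)) (hatO U)
    fun _ h => h).toHom_toHom_incl _ (Option.some_injective _) Function.injective_id g).trans
    (Eq.trans (Sm.ext fun y => ?_) ((Subst.incl (Sum.map some id) (Sum.map id some)
      (cot (Fin q) (hatO U)) (cot (Fin q) U) fun _ h => h.1).toHom_toHom_incl _ Sum.inl_injective
      Sum.inl_injective g).symm)
  refine Subst.toHom_val_congr _ _ (fun b => ?_) g
  rcases b with i | α <;> rfl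

theorem sub_fib (b : Fin p ⊕ Fin q) : sub (fib (U := U) b) = fib (emb b) := by
  rw [sub, fib, Subst.toHom_crd, fib, ← map_starIdx]
  rfl

theorem contDiffOn_tbw (m : ℝ) :
    ContDiffOn ℝ ∞ (fun z : Option (Fin p) → ℝ => z none ^ m) (hatO U) :=
  fun _ hz => ((contDiff_apply ℝ ℝ none).contDiffAt.rpow_const_of_ne
    (ne_of_gt hz.2)).contDiffWithinAt

/-- The power `t^m` on the base. -/
def tbw (m : ℝ) : Sm (Fin q) (hatO U) := Sm.real _ (contDiffOn_tbw m)

theorem bas_tbw (m : ℝ) : bas (tbw m) = tpw (q := q) (U := U) m := Sm.ext fun y => by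
  rw [bas_val, tbw, Sm.real_val, AlgHom.commutes]
  rfl

/-- The projection to the superfunctions on the odd cotangent bundle of the base, at a point. -/
def proj (y : cot (Fin q) (hatO U)) : SmHat q U →ₐ[ℝ] Gr (Fin q ⊕ Fin p) :=
  (killRest (Sum.map id some)).comp (Sm.ev y)

/-- The point of the odd cotangent bundle of the base below a point. -/
def bel (y : cot (Fin q) (hatO U)) : cot (Fin q) U := ⟨fun i => y.1 (Sum.map some id i), y.2.1⟩

theorem proj_apply (y : cot (Fin q) (hatO U)) (F : SmHat q U) :
    proj y F = killRest (Sum.map id some) (F.1 y) := rfl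

theorem map_id_some_injective : (Sum.map id some : Fin q ⊕ Fin p → _).Injective :=
  Sum.map_injective.2 ⟨Function.injective_id, Option.some_injective _⟩

theorem proj_sub (y : cot (Fin q) (hatO U)) (g : Sm (Fin q ⊕ Fin p) (cot (Fin q) U)) :
    proj y (sub g) = g.1 (bel y) := by
  rw [proj_apply, sub_val, killRest_relabel map_id_some_injective]
  rfl

theorem proj_tst (y : cot (Fin q) (hatO U)) : proj y tst = 0 :=
  killRest_gen (β := Sum.inr none) (by rintro (α | i) <;> simp)

theorem proj_tpw (y : cot (Fin q) (hatO U)) (m : ℝ) :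
    proj y (tpw m) = algebraMap ℝ _ (y.1 (Sum.inl none) ^ m) := by
  rw [proj_apply, tpw_val, AlgHom.commutes]

/-- Elements of weight `w ≠ 1` that are annihilated by `δ` are determined by their projections. -/
theorem eq_of_proj_eq {w : ℝ} (hw : w ≠ 1) {F G : SmHat q U} (hF : del F = 0) (hG : del G = 0)
    (hF' : wt F = w • F) (hG' : wt G = w • G) (h : ∀ y, proj y F = proj y G) : F = G := by
  rw [← sub_eq_zero]
  have h1 : del (F - G) = del F - del G := by
    simp only [del, dlt, map_sub, mul_sub, smul_sub]
    abel
  have h2 : wt (F - G) = wt F - wt G := by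
    simp only [wt, map_sub, mul_sub]
    abel
  -- Equal projections mean that the difference vanishes at `t* = 0`, so Taylor's formula in `t*`
  -- makes it divisible by `t*`.
  have hx : F - G = tst * sder tix (F - G) := Sm.ext fun y => by
    have h3 := relabel_killRest_add (β := Sum.inr none)
      (map_id_some_injective (p := p) (q := q)) (by rintro (α | _ | i) <;> simp) ((F - G).1 y)
    rw [← proj_apply, map_sub, h y, sub_self, map_zero, zero_add] at h3
    have h4 : (sder tix (F - G)).1 y = oddD (Sum.inr none) ((F - G).1 y) := Sm.der_inr_val _ _ _
    rw [Sm.mul_val, h4]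
    exact h3.symm
  have hi := isHatForm (U := U) (q := q)
  refine eq_zero_of_dlt_eq_zero hi.cot hi.par_n hi.hti hi.htv hi.htt hi.hτ hi.D_τ hi.Ds_τ hi.Ds_τ'
    hi.Ds_ti hw hx ?_ ?_
  · rw [hF, hG, sub_self] at h1
    exact h1
  · rw [hF', hG', ← smul_sub] at h2
    exact h2

namespace Change

variable (C : Change (Fin p) (Fin q) U V)

theorem hom_absBer (r : ℝ) : Hom 0 (C.absBer r) :=
  (Subst.isSHom_toHom _).hom (Sm.hom_real _ _)

/-- Since `t > 0`, the power `t^m` is the pullback of `|u|^m` along the coordinate `t`. The claim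
then is the homogeneity of `absPow`. -/
theorem hat_Φ_tbw (m : ℝ) : C.hat.Φ (tbw m) = tbw m * up (C.absBer m) := by
  have h1 : tbw (q := q) (U := V) m = (Subst.incl (fun _ : Unit => none) (fun a : Empty => a.elim)
      (hatO V) punc fun z hz => ne_of_gt hz.2).toHom
      (pfun (fun u => |u| ^ m) (contDiffOn_abs_rpow m)) := Sm.ext fun z => by
    refine Eq.trans ?_ (Subst.toHom_incl_val (φe := fun _ : Unit => none)
      (φo := fun a : Empty => a.elim) (U := hatO V) (V := punc) (hUV := fun z hz => ne_of_gt hz.2)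
      (fun a => a.elim) _ z).symm
    rw [tbw, pfun, Sm.real_val, Sm.real_val, AlgHom.commutes, abs_of_pos z.2.2]
  have hg : Hom 0 (tc * up (C.absBer 1)) := C.hom_hatY tix
  have hb : ∀ z, bodyHom ((tc * up (C.absBer 1)).1 z) ≠ 0 := fun z => (C.bodyHom_hatY_tix z).ne'
  have h2 : C.hat.Φ (tbw m) = absP (tc * up (C.absBer 1)) hg hb m := by
    rw [h1]
    refine (C.hatS.toHom_toHom_incl _ (fun _ _ _ => rfl) (fun a => a.elim) _).trans
      (Sm.ext fun z => ?_)
    refine Subst.toHom_val_congr _ _ (fun b => ?_) _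
    rcases b with b | b
    · rfl
    · exact b.elim
  rw [h2]
  refine Sm.ext fun z => ?_
  rw [absP_val, Sm.mul_val, Sm.mul_val, tc_val, up_val, up_val, ← Algebra.smul_def,
    absPow_smul_absBer, abs_of_pos z.2.2, Algebra.smul_def]
  rfl

theorem hat_Ψ_tpw (m : ℝ) : C.hat.Ψ (tpw m) = tpw m * sub (bas (C.absBer m)) := by
  rw [← bas_tbw, Ψ_bas, hat_Φ_tbw, map_mul, bas_up, bas_tbw]

theorem proj_hat_Ψ_tst (y : cot (Fin q) (hatO U)) : proj y (C.hat.Ψ tst) = 0 := by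
  have h : C.hat.Ψ tst = C.hat.star tix := C.hat.Ψ_fib tix
  rw [h, hat_star_tix, map_mul, proj_tst, mul_zero]

/-- The projection is independent of coordinates: the new fibre coordinates upstairs differ from
those of the base only by multiples of `t*`. -/
theorem proj_hat_Ψ_sub (y : cot (Fin q) (hatO U)) (g : Sm (Fin q ⊕ Fin p) (cot (Fin q) V)) :
    proj y (C.hat.Ψ (sub g)) = (C.Ψ g).1 (bel y) := by
  have h1 : C.hat.Ψ (sub g) = _ := C.hat.cotS.toHom_toHom_incl (φe := Sum.map some id)
    (φo := Sum.map id some) (V := cot (Fin q) (hatO V)) (W := cot (Fin q) V) (fun _ h => h.1)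
    (Sum.map_injective.2 ⟨Option.some_injective _, Function.injective_id⟩) map_id_some_injective g
  rw [h1, proj_apply]
  refine (Subst.toHom_val_eq _ C.cotS (isSHom_killRest _) (fun b => ?_) g).symm
  change _ = proj y (C.hat.cotS.Y (Sum.map (Sum.map some id) (Sum.map id some) b))
  induction b using cot_cases with
  | h0 b =>
    have h2 : C.hat.S.Y (emb b) = up (C.S.Y b) := C.hatY_emb b
    rw [map_baseIdx, cotS_baseIdx, cotS_baseIdx, h2, bas_up, proj_sub]
  | h1 b =>
    rw [map_starIdx, cotS_starIdx, cotS_starIdx, hat_star_emb, map_add, map_mul, proj_tst, mul_zero,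
      zero_add]
    simp only [bas_up, ← sub_fib, ← map_mul, ← map_sum]
    rw [proj_sub]
    rfl

end Change

/-- The local expression of the lift. -/
def lft (w : ℝ) (s : Sm (Fin q ⊕ Fin p) (cot (Fin q) U)) : SmHat q U :=
  hatForm sub tv tst tpw w s ((1 / (1 - w)) • lap gpar bder sder s)

theorem lft_add (w : ℝ) (s u : Sm (Fin q ⊕ Fin p) (cot (Fin q) U)) :
    lft w (s + u) = lft w s + lft w u := by
  simp only [lft, hatForm, map_add, smul_add, add_mul, mul_add]
  abel

theorem lft_smul (w c : ℝ) (s : Sm (Fin q ⊕ Fin p) (cot (Fin q) U)) :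
    lft w (c • s) = c • lft w s := by
  simp only [lft, hatForm, map_smul, smul_add, smul_mul_assoc, mul_smul_comm]
  rw [smul_comm c]

theorem hatForm_zero (w : ℝ) : hatForm sub tv tst tpw w (0 : Sm (Fin q ⊕ Fin p) (cot (Fin q) U))
    0 = (0 : SmHat q U) := by
  simp [hatForm]

/-- The factor 1/(1-w) cancels w - 1 in the first component, and the second vanishes because Δ² = 0.
-/
theorem del_lft {w : ℝ} (hw : w ≠ 1) (s : Sm (Fin q ⊕ Fin p) (cot (Fin q) U)) :
    del (lft w s) = 0 := by
  have h1 : 1 - w ≠ 0 := sub_ne_zero.2 hw.symm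
  have h2 : (w - 1) * (1 / (1 - w)) = -1 := by
    field_simp
    ring
  refine (isHatForm.dlt_hatForm w s _).trans ?_
  rw [map_smul, lap_lap isCotDer, smul_zero, neg_zero, smul_smul, h2, neg_one_smul, add_neg_cancel,
    hatForm_zero]

theorem wt_lft (w : ℝ) (s : Sm (Fin q ⊕ Fin p) (cot (Fin q) U)) : wt (lft w s) = w • lft w s :=
  isHatForm.weight_hatForm w s _

theorem proj_lft (w : ℝ) (s : Sm (Fin q ⊕ Fin p) (cot (Fin q) U)) (y : cot (Fin q) (hatO U)) :
    proj y (lft w s) = y.1 (Sum.inl none) ^ w • s.1 (bel y) := by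
  rw [lft, hatForm, map_add, map_mul, proj_sub, proj_tpw]
  simp only [map_mul, proj_tst, mul_zero, zero_mul, add_zero]
  rw [← Algebra.commutes, Algebra.smul_def]

theorem Change.proj_hat_Ψ_lft (C : Change (Fin p) (Fin q) U V) (w : ℝ)
    (s : Sm (Fin q ⊕ Fin p) (cot (Fin q) V)) (y : cot (Fin q) (hatO U)) :
    proj y (C.hat.Ψ (lft w s)) =
      y.1 (Sum.inl none) ^ w • (bas (C.absBer w) * C.Ψ s).1 (bel y) := by
  rw [lft, hatForm, map_add, map_add]
  simp only [map_mul, proj_hat_Ψ_tst, mul_zero, zero_mul, add_zero]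
  rw [C.hat_Ψ_tpw, map_mul, proj_hat_Ψ_sub, proj_tpw, proj_sub, ← mul_assoc,
    ← Algebra.commutes, mul_assoc, ← Algebra.smul_def, ← Sm.mul_val,
    SuperRing.even_comm (hom_zero_iff.1 (hom_bas (C.hom_absBer w)))]

/-- The lift does not depend on coordinates. -/
theorem Change.hat_Ψ_lft (C : Change (Fin p) (Fin q) U V) {w : ℝ} (hw : w ≠ 1)
    (s : Sm (Fin q ⊕ Fin p) (cot (Fin q) V)) :
    lft w (bas (C.absBer w) * C.Ψ s) = C.hat.Ψ (lft w s) := by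
  -- Both sides are δ-closed of weight `w`, so comparing their projections suffices.
  refine eq_of_proj_eq hw (del_lft hw _) ?_ (wt_lft _ _) ?_ fun y => ?_
  · rw [del_Ψ, del_lft hw, map_zero]
  · rw [wt_Ψ, wt_lft, map_smul]
  · rw [proj_lft, proj_hat_Ψ_lft]

theorem lft_injective (w : ℝ) {s u : Sm (Fin q ⊕ Fin p) (cot (Fin q) U)} (h : lft w s = lft w u) :
    s = u := by
  refine Sm.ext fun x => ?_
  -- A point above `x` with `t = 1`, where `t^w` is 1 and the projection of the lift is the value of
  -- `s`.
  set y : cot (Fin q) (hatO U) :=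
    ⟨Sum.elim (fun i => i.elim 1 fun i => x.1 (Sum.inl i)) fun α => x.1 (Sum.inr α),
      x.2, one_pos⟩ with hy
  have h1 : bel y = x := Subtype.ext (funext fun a => by rcases a with i | α <;> rfl)
  have h2 := congrArg (proj y) h
  have h3 : y.1 (Sum.inl none) = 1 := rfl
  rwa [proj_lft, proj_lft, h1, h3, Real.one_rpow, one_smul, one_smul] at h2

/-- The bracket of two lifts is the lift of `lftBrk`. -/
def lftBrk (w v : ℝ) (s u : Sm (Fin q ⊕ Fin p) (cot (Fin q) U)) :
    Sm (Fin q ⊕ Fin p) (cot (Fin q) U) :=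
  lap gpar bder sder (s * u) + (w + v - 1) •
    ((1 / (1 - w)) • lap gpar bder sder s * u +
      SuperRing.inv s * (1 / (1 - v)) • lap gpar bder sder u)

/-- Let g be the product of `s` and `u`, and h the `w*`-coefficient of the product of the lifts. The
components of δ are Δg + (w+v-1)h and -Δh. As Δ² = 0, the second is Δ of the first divided by
1-(w+v), as in a lift. -/
theorem del_lft_mul {w v : ℝ} (hwv : w + v ≠ 1) (s u : Sm (Fin q ⊕ Fin p) (cot (Fin q) U)) :
    del (lft w s * lft v u) = lft (w + v) (lftBrk w v s u) := by
  have h1 : 1 - (w + v) ≠ 0 := sub_ne_zero.2 hwv.symm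
  have h2 : (1 / (1 - (w + v))) * (w + v - 1) = -1 := by
    field_simp
    ring
  rw [lft, lft, isHatForm.hatForm_mul]
  refine (isHatForm.dlt_hatForm (w + v) _ _).trans ?_
  have h3 : ∀ x y : Sm (Fin q ⊕ Fin p) (cot (Fin q) U),
      (1 / (1 - (w + v))) • lap gpar bder sder (lap gpar bder sder x + (w + v - 1) • y) =
        -lap gpar bder sder y := by
    intro x y
    rw [map_add, lap_lap isCotDer, zero_add, map_smul, smul_smul, h2, neg_one_smul]
  rw [lft, lftBrk, h3]

/-- The transformation law is read off upstairs, where lifts, products and δ are compatible with the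
change of coordinates, and it descends because lifting is injective. -/
theorem Change.lftBrk_Ψ (C : Change (Fin p) (Fin q) U V) {w v : ℝ} (hw : w ≠ 1) (hv : v ≠ 1)
    (hwv : w + v ≠ 1) (s u : Sm (Fin q ⊕ Fin p) (cot (Fin q) V)) :
    lftBrk w v (bas (C.absBer w) * C.Ψ s) (bas (C.absBer v) * C.Ψ u) =
      bas (C.absBer (w + v)) * C.Ψ (lftBrk w v s u) := by
  refine lft_injective (w + v) ?_
  rw [← del_lft_mul hwv, C.hat_Ψ_lft hw, C.hat_Ψ_lft hv, C.hat_Ψ_lft hwv, ← del_lft_mul hwv,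
    ← map_mul, C.del_Ψ]

end Lift

/-! ## Coordinate expressions -/

section Expressions

variable {ε ο : Type*} [Fintype ε] [Fintype ο] [DecidableEq ε] [DecidableEq ο]
  {U V : Opens (ε → ℝ)}

theorem Sm.smoothOn_of_val (g : Sm ο U) {f : SFun ε ο} (h : ∀ x : U, g.1 x = f x) :
    SmoothOn f U :=
  (Sm.smooth_out g).congr fun x hx => (h ⟨x, hx⟩).symm.trans (Sm.out_apply g ⟨x, hx⟩).symm

theorem lap_mk_val {f : SFun (ε ⊕ ο) (ο ⊕ ε)} (hf : SmoothOn f (cot ο U)) (y : cot ο U) :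
    (lap gpar bder sder (Sm.mk f hf)).1 y = oddLaplacian f y := by
  have h : ∀ a, (bder a (sder a (Sm.mk f hf))).1 y =
      pderiv (baseIdx a) (pderiv (starIdx a) f) y := by
    intro a
    rw [bder, sder, Sm.der_mk, Sm.der_mk]
    rfl
  rw [lap_apply, Sm.sum_val, Fintype.sum_sum_type, oddLaplacian, Pi.sub_apply, Finset.sum_apply,
    Finset.sum_apply, sub_eq_add_neg, ← Finset.sum_neg_distrib]
  simp only [Sm.neg_val, h, gpar, Sum.elim_inl, Sum.elim_inr, sg_zero, sg_one, one_smul,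
    neg_one_smul]

/-- The product rule of the Laplacian for elements without definite parity; the involution takes
over the sign of the first factor. -/
theorem lap_mul_sub (f g : Sm (ο ⊕ ε) (cot ο U)) :
    lap gpar bder sder (f * g) - lap gpar bder sder f * g -
      SuperRing.inv f * lap gpar bder sder g =
    (∑ i : ε, (sder (Sum.inl i) f * bder (Sum.inl i) g +
      bder (Sum.inl i) (SuperRing.inv f) * sder (Sum.inl i) g)) -
    ∑ α : ο, (sder (Sum.inr α) (SuperRing.inv f) * bder (Sum.inr α) g +
      bder (Sum.inr α) f * sder (Sum.inr α) g) := by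
  induction f using hom_induction with
  | hadd f f' h h' =>
    have e : lap gpar bder sder ((f + f') * g) - lap gpar bder sder (f + f') * g -
        SuperRing.inv (f + f') * lap gpar bder sder g =
        (lap gpar bder sder (f * g) - lap gpar bder sder f * g -
          SuperRing.inv f * lap gpar bder sder g) +
        (lap gpar bder sder (f' * g) - lap gpar bder sder f' * g -
          SuperRing.inv f' * lap gpar bder sder g) := by
      simp only [map_add, add_mul]
      abel
    rw [e, h, h']
    simp only [map_add, add_mul, Finset.sum_add_distrib]
    abel
  | hhom d f hf =>
    have h1 : SuperRing.inv f = sg d • f := hf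
    rw [lap_mul isCotDer hf, h1, smul_mul_assoc, brk, Fintype.sum_sum_type, add_sub_right_comm,
      add_sub_right_comm, add_sub_cancel_left, sub_self, zero_add, sub_eq_add_neg,
      ← Finset.sum_neg_distrib]
    simp only [gpar, Sum.elim_inl, Sum.elim_inr, zero_mul, sg_zero, one_smul, one_mul, map_smul,
      smul_mul_assoc]
    refine congrArg₂ _ rfl (Finset.sum_congr rfl fun α _ => ?_)
    rw [sg_add, sg_one, smul_add, smul_smul, mul_neg_one, neg_mul, sg_mul_self, neg_smul, neg_smul,
      one_smul, neg_add]

theorem oddBracket_val {f g : SFun (ε ⊕ ο) (ο ⊕ ε)} (hf : SmoothOn f (cot ο U))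
    (hg : SmoothOn g (cot ο U)) (y : cot ο U) {F G : Sm (ο ⊕ ε) (cot ο U)}
    (hF : F = Sm.mk f hf) (hG : G = Sm.mk g hg) :
    (lap gpar bder sder (F * G) - lap gpar bder sder F * G -
      SuperRing.inv F * lap gpar bder sder G).1 y = oddBracket f g y := by
  rw [lap_mul_sub]
  have hf' : SmoothOn (fun y => parityAut (f y)) (cot ο U) :=
    hf.map (grInv (ο := ο ⊕ ε)).toLinearMap
  have h1 : SuperRing.inv F = Sm.mk (fun y => parityAut (f y)) hf' := by
    rw [hF]
    rfl
  rw [h1, hF, hG]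
  simp only [bder, sder, Sm.der_mk]
  rw [Sm.sub_val, Sm.sum_val, Sm.sum_val, oddBracket, Pi.sub_apply, Finset.sum_apply,
    Finset.sum_apply]
  simp only [Sm.add_val, Sm.mul_val, Sm.mk_apply, Pi.add_apply, Pi.mul_apply]

namespace Change

variable (C : Change ε ο U V) {T S : ε ⊕ ο → SFun ε ο}

theorem cotY_val (hT : ∀ b (x : U), (C.S.Y b).1 x = T b x)
    (hS : ∀ b (x : V), (C.S'.Y b).1 x = S b x) (a : (ε ⊕ ο) ⊕ (ο ⊕ ε)) (y : cot ο U) :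
    (C.cotS.Y a).1 y = cotLift T S a y := by
  have h1 : ∀ b, (bas (C.S.Y b)).1 y = fromBase (T b) y := by
    intro b
    rw [bas_val, hT]
    rfl
  have h2 : ∀ b, (C.star b).1 y =
      (∑ a, fromBase (pull T (pderiv b (S a))) * coord (starIdx a) :
        SFun (ε ⊕ ο) (ο ⊕ ε)) y := by
    intro b
    rw [star, Sm.sum_val, Finset.sum_apply]
    refine Finset.sum_congr rfl fun a _ => ?_
    have h3 : C.S'.Y a = Sm.mk (S a) (Sm.smoothOn_of_val _ (hS a)) := Sm.ext (hS a)
    rw [Sm.mul_val, bas_val, G_apply, h3, Sm.der_mk, Φ, C.S.toHom_mk_val _ _ fun b => hT b _]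
    rfl
  rcases a with (i | α) | (α | i)
  · exact h1 (Sum.inl i)
  · exact h2 (Sum.inr α)
  · exact h1 (Sum.inr α)
  · exact h2 (Sum.inl i)

/-- The gluing condition for functions on the odd cotangent bundle. -/
theorem glue_iff (hT : ∀ b (x : U), (C.S.Y b).1 x = T b x)
    (hS : ∀ b (x : V), (C.S'.Y b).1 x = S b x) {γ : Sm ο U} {g : SFun ε ο}
    (hg : ∀ x : U, γ.1 x = g x) {f f' : SFun (ε ⊕ ο) (ο ⊕ ε)} (hf : SmoothOn f (cot ο U))
    (hf' : SmoothOn f' (cot ο V)) {B : Set (ε → ℝ)} (hB : (V : Set (ε → ℝ)) ⊆ B) :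
    (∀ y ∈ cotDomain U, bodyPoint (cotLift T S) y ∈ cotDomain B →
      f y = fromBase g y * pull (cotLift T S) f' y) ↔
    Sm.mk f hf = bas γ * C.Ψ (Sm.mk f' hf') := by
  -- The proviso in the gluing condition holds automatically for an actual change of coordinates.
  have h1 : ∀ y : cot ο U, bodyPoint (cotLift T S) y ∈ cotDomain B := by
    intro y
    have h2 := C.cotS.mem y
    simp only [C.cotY_val hT hS] at h2
    exact hB h2
  have h2 : ∀ y : cot ο U, (bas γ * C.Ψ (Sm.mk f' hf')).1 y =
      fromBase g y * pull (cotLift T S) f' y := by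
    intro y
    rw [Sm.mul_val, bas_val, hg, Ψ, C.cotS.toHom_mk_val _ _ fun b => C.cotY_val hT hS b y]
    rfl
  constructor
  · intro h
    refine Sm.ext fun y => ?_
    rw [h2]
    exact h y y.2 (h1 y)
  · intro h y hy _
    rw [← h2 ⟨y, hy⟩, ← h]
    rfl

end Change

end Expressions

/-! ### Coordinate expressions of δ, the weight and the lift -/

section HatExpressions

open Supermanifold

variable {p q : ℕ} {U : Opens (Fin p → ℝ)}

theorem wt_mk_val {F : SFun (Option (Fin p) ⊕ Fin q) (Fin q ⊕ Option (Fin p))}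
    (hF : SmoothOn F (cot (Fin q) (hatO U))) (y : cot (Fin q) (hatO U)) :
    (wt (Sm.mk F hF)).1 y = weightOp F y := by
  rw [wt, bder, sder, Sm.der_mk, Sm.der_mk, Sm.sub_val, Sm.mul_val, Sm.mul_val, tv_val]
  rfl

/-- Conjugating Δ by t⁻² adds the logarithmic derivative of t⁻² times ∂/∂t*; this is the first order
term in `dlt`. -/
theorem tpw_mul_lap (F : SmHat q U) : tpw 2 * lap gpar bder sder (tpw (-2) * F) = del F := by
  have hi := isHatForm (U := U) (q := q)
  have h2 : tpw (q := q) (U := U) 2 * tpw (-2) = 1 := by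
    rw [← tpw_add, add_neg_cancel]
    refine Sm.ext fun y => ?_
    rw [tpw_val, Real.rpow_zero, map_one]
    rfl
  have h3 := SuperRing.even_comm (hom_zero_iff.1 (hom_tpw (q := q) (U := U) (-1)))
  rw [hi.lap_mul_of_base (hi.htp _) (hi.D_tp · _) (hi.Ds_tp · _), hi.Dn_tp, mul_add, ← mul_assoc,
    h2, one_mul, h3, smul_mul_assoc, mul_smul_comm, ← mul_assoc, ← mul_assoc, h2, one_mul, neg_smul,
    ← sub_eq_add_neg]
  rfl

theorem del_mk_val {F : SFun (Option (Fin p) ⊕ Fin q) (Fin q ⊕ Option (Fin p))}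
    (hF : SmoothOn F (cot (Fin q) (hatO U))) (y : cot (Fin q) (hatO U)) :
    (del (Sm.mk F hF)).1 y = delta F y := by
  have h1 : SmoothOn (tPow (-2) * F) (cot (Fin q) (hatO U)) :=
    Sm.smoothOn_of_val (U := cot (Fin q) (hatO U))
      (tpw (-2) * Sm.mk F hF) fun _ => rfl
  have h2 := lap_mk_val (U := hatO U) h1 y
  rw [← tpw_mul_lap, delta, Pi.mul_apply, ← h2]
  rfl

theorem lft_mk_val (w : ℝ) {s : SFun (Fin p ⊕ Fin q) (Fin q ⊕ Fin p)}
    (hs : SmoothOn s (cot (Fin q) U)) (y : cot (Fin q) (hatO U)) :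
    (lft w (Sm.mk s hs)).1 y = localLift w s y := by
  have h1 := lap_mk_val hs (bel y)
  have h2 : (sub (Sm.mk s hs)).1 y = hatSubst s y := by
    rw [sub_val]
    rfl
  have h3 : (sub (lap gpar bder sder (Sm.mk s hs))).1 y =
      hatSubst (oddLaplacian s) y := by
    rw [sub_val]
    exact congrArg _ h1
  rw [lft, hatForm, map_smul, mul_smul_comm, Sm.add_val, Sm.mul_val, Sm.smul_val, Sm.mul_val,
    Sm.mul_val, Sm.mul_val, h2, h3, tv_val]
  rfl

/-- δ and Δ differ by a first order operator that obeys the Leibniz rule, so both generate the same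
bracket. -/
theorem del_mul_sub (F G : SmHat q U) :
    lap gpar bder sder (F * G) - lap gpar bder sder F * G -
      SuperRing.inv F * lap gpar bder sder G =
    del (F * G) - del F * G - SuperRing.inv F * del G := by
  have h : sder tix (F * G) = sder tix F * G + SuperRing.inv F * sder tix G := by
    induction F using hom_induction with
    | hadd F F' h h' =>
      rw [add_mul, map_add, h, h', map_add, map_add, add_mul, add_mul]
      abel
    | hhom d F hF =>
      have h1 : SuperRing.inv F = sg d • F := hF
      rw [(isCotDer.star tix).leib hF, h1, gpar_tix, zero_add, one_mul, smul_mul_assoc]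
  have h3 := SuperRing.even_comm (hom_zero_iff.1 (hom_tpw (q := q) (U := U) (-1)))
  simp only [del, dlt]
  rw [h, mul_add, ← mul_assoc (tpw (-1)) (SuperRing.inv F), h3 (SuperRing.inv F)]
  simp only [sub_mul, mul_sub, smul_add, smul_mul_assoc, mul_smul_comm, mul_assoc]
  abel

end HatExpressions

/-! ### From the atlas to changes of coordinates and gluing conditions -/

namespace Supermanifold

variable {p q : ℕ} {X : Type*} [TopologicalSpace X] {I : Type*} (M : Supermanifold p q X I)

/-- The coordinate domain of a chart. -/
def dom (i : I) : Opens (Fin p → ℝ) := ⟨(M.chart i).target, (M.chart i).open_target⟩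

/-- The overlap of two charts. -/
def ovl (i j : I) : Opens (Fin p → ℝ) :=
  ⟨M.overlap i j, ((M.chart i).symm.trans (M.chart j)).open_source⟩

theorem ovl_le (i j : I) : M.ovl i j ≤ M.dom i := fun x hx => by
  have h : x ∈ ((M.chart i).symm.trans (M.chart j)).source := hx
  rw [OpenPartialHomeomorph.trans_source] at h
  exact h.1

theorem smoothOn_trans (i j : I) (b : Fin p ⊕ Fin q) : SmoothOn (M.trans i j b) (M.ovl i j) :=
  M.trans_smooth i j b

/-- The change of coordinates between two charts, as a substitution. -/
def transSubst (i j : I) : Subst (Fin p) (Fin q) (Fin p) (Fin q) (M.ovl i j) (M.ovl j i) where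
  Y b := Sm.mk (M.trans i j b) (M.smoothOn_trans i j b)
  hom b := Sm.hom_iff.2 fun x => mem_parityPart_iff.1 (by
    rcases b with i' | α
    · exact M.trans_even i j i' x x.2
    · exact M.trans_odd i j α x x.2)
  mem x := by
    have h : bodyPoint (M.trans i j) x ∈ M.ovl j i := by
      rw [M.trans_body i j x x.2]
      have h2 := ((M.chart i).symm.trans (M.chart j)).map_source x.2
      rw [← OpenPartialHomeomorph.symm_source, OpenPartialHomeomorph.trans_symm_eq_symm_trans_symm,
        OpenPartialHomeomorph.symm_symm] at h2
      exact h2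
    exact h

/-- The cocycle condition for the charts i, j, i, together with the triviality of the change from a
chart to itself. -/
theorem transSubst_toHom (i j : I) (b : Fin p ⊕ Fin q) :
    (M.transSubst i j).toHom ((M.transSubst j i).Y b) = Sm.crd b := Sm.ext fun x => by
  have h1 := (M.transSubst i j).toHom_mk_val (M.smoothOn_trans j i b) x (Y := M.trans i j)
    fun _ => rfl
  refine h1.trans ?_
  have hx : x.1 ∈ (M.chart i).target := M.ovl_le i j x.2
  rw [← M.trans_comp i j i b x x.2 (by
    rw [OpenPartialHomeomorph.trans_source]
    exact ⟨hx, (M.chart i).map_target hx⟩), M.trans_self i b x hx]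
  rfl

/-- The change of coordinates between two charts. -/
def chg (i j : I) : Change (Fin p) (Fin q) (M.ovl i j) (M.ovl j i) :=
  ⟨M.transSubst i j, M.transSubst j i, M.transSubst_toHom i j, M.transSubst_toHom j i⟩

theorem ber_val (i j : I) (x : M.ovl i j) : (M.chg i j).ber.1 x = M.jacobian i j x := by
  have h := (M.chg i j).isInvPair.map_berezinian (Sm.isSHom_ev x)
  refine h.trans ?_
  rw [jacobian]
  congr 1
  refine Matrix.ext fun a b => ?_
  have h2 : (M.chg i j).jac a b = Sm.der a (Sm.mk (M.trans i j b) (M.smoothOn_trans i j b)) := rfl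
  rw [Matrix.map_apply, h2, Sm.der_mk]
  rfl

theorem absBer_val (i j : I) (w : ℝ) (x : M.ovl i j) :
    ((M.chg i j).absBer w).1 x = absPow (M.jacobian i j x) w := by
  rw [Change.absBer_val, ber_val]

theorem hatY_val (i j : I) (b : Option (Fin p) ⊕ Fin q) (z : hatO (M.ovl i j)) :
    ((M.chg i j).hat.S.Y b).1 z = M.hatTrans i j b z := by
  have h : (M.chg i j).hat.S.Y b = (M.chg i j).hatY b := rfl
  rw [h]
  induction b using hat_cases with
  | h0 =>
    rw [Change.hatY_tix, Sm.mul_val, tc_val, up_val, absBer_val, ← Algebra.smul_def]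
    rfl
  | h1 b =>
    rw [Change.hatY_emb, up_val]
    rcases b with b | b <;> rfl

theorem densFun_iff (w : ℝ) {s : I → SFun (Fin p ⊕ Fin q) (Fin q ⊕ Fin p)}
    (h : ∀ i, SmoothOn (s i) (cot (Fin q) (M.dom i))) :
    s ∈ M.densFun w ↔ (∀ i, ∀ y ∉ cotDomain (M.dom i : Set (Fin p → ℝ)), s i y = 0) ∧
      ∀ i j, Sm.mk (U := cot (Fin q) (M.ovl i j)) (s i)
        ((h i).mono fun _ hy => M.ovl_le i j hy) =
        bas ((M.chg i j).absBer w) * (M.chg i j).Ψ (Sm.mk (U := cot (Fin q) (M.ovl j i)) (s j)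
          ((h j).mono fun _ hy => M.ovl_le j i hy)) := by
  have h1 := fun i j => (M.chg i j).glue_iff (T := M.trans i j) (S := M.trans j i)
    (fun _ _ => rfl) (fun _ _ => rfl) (γ := (M.chg i j).absBer w)
    (g := fun x => absPow (M.jacobian i j x) w) (M.absBer_val i j w)
    ((h i).mono fun _ hy => M.ovl_le i j hy) ((h j).mono fun _ hy => M.ovl_le j i hy) (M.ovl_le j i)
  constructor
  · exact fun hs => ⟨hs.1, fun i j => (h1 i j).1 (hs.2.2 i j)⟩
  · exact fun hs => ⟨hs.1, h, fun i j => (h1 i j).2 (hs.2 i j)⟩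

theorem hatSmooth_iff {F : I → SFun (Option (Fin p) ⊕ Fin q) (Fin q ⊕ Option (Fin p))}
    (h : ∀ i, SmoothOn (F i) (cot (Fin q) (hatO (M.dom i)))) :
    F ∈ M.hatSmooth ↔ (∀ i, ∀ y ∉ cotDomain (hatSet (M.dom i : Set (Fin p → ℝ))), F i y = 0) ∧
      ∀ i j, Sm.mk (U := cot (Fin q) (hatO (M.ovl i j))) (F i)
        ((h i).mono fun _ hy => ⟨M.ovl_le i j hy.1, hy.2⟩) =
        (M.chg i j).hat.Ψ (Sm.mk (U := cot (Fin q) (hatO (M.ovl j i))) (F j)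
          ((h j).mono fun _ hy => ⟨M.ovl_le j i hy.1, hy.2⟩)) := by
  have h1 := fun i j => (M.chg i j).hat.glue_iff (T := M.hatTrans i j)
    (S := M.hatTrans j i) (M.hatY_val i j) (M.hatY_val j i) (γ := 1) (g := 1) (fun _ => rfl)
    (B := hatSet (M.dom j))
    ((h i).mono fun _ hy => ⟨M.ovl_le i j hy.1, hy.2⟩)
    ((h j).mono fun _ hy => ⟨M.ovl_le j i hy.1, hy.2⟩) fun _ hy => ⟨M.ovl_le j i hy.1, hy.2⟩
  simp only [map_one, one_mul] at h1
  constructor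
  · exact fun hs => ⟨hs.1, fun i j => (h1 i j).1 (hs.2.2 i j)⟩
  · exact fun hs => ⟨hs.1, h, fun i j => (h1 i j).2 (hs.2 i j)⟩

end Supermanifold

/-! ## Polynomials in the fibre coordinates -/

section Poly

variable {ε ο : Type*} [Fintype ε] [Fintype ο] [DecidableEq ε] [DecidableEq ο]
  {U : Opens (ε → ℝ)}

/-- Polynomials of degree `r` in the fibre coordinates. -/
def IsPolyDeg : ℕ → Sm (ο ⊕ ε) (cot ο U) → Prop
  | 0, F => ∃ c, F = bas c
  | r + 1, F => ∃ g : ε ⊕ ο → Sm (ο ⊕ ε) (cot ο U), (∀ b, IsPolyDeg r (g b)) ∧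
      F = ∑ b, g b * fib b

/-- The recursive form splits off the last fibre coordinate of each monomial, which suits the
inductions on the degree. -/
theorem isPolyDeg_iff_exists {r : ℕ} {F : Sm (ο ⊕ ε) (cot ο U)} :
    IsPolyDeg r F ↔ ∃ c : (Fin r → ε ⊕ ο) → Sm ο U,
      F = ∑ a, bas (c a) * (List.ofFn fun j => fib (a j)).prod := by
  induction r generalizing F with
  | zero =>
    constructor
    · rintro ⟨c, rfl⟩
      exact ⟨fun _ => c, by simp⟩
    · rintro ⟨c, rfl⟩
      exact ⟨c default, by simp⟩
  | succ r ih =>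
    have key : ∀ c : (Fin (r + 1) → ε ⊕ ο) → Sm ο U,
        ∑ a, bas (c a) * (List.ofFn fun j => fib (a j)).prod =
        ∑ b, (∑ a : Fin r → ε ⊕ ο, bas (c (Fin.snoc (α := fun _ => ε ⊕ ο) a b)) *
          (List.ofFn fun j => fib (a j)).prod) * fib b := by
      intro c
      rw [← (Fin.snocEquiv fun _ => ε ⊕ ο).sum_comp, Fintype.sum_prod_type]
      refine Finset.sum_congr rfl fun b _ => ?_
      rw [Finset.sum_mul]
      refine Finset.sum_congr rfl fun a _ => ?_
      rw [List.ofFn_succ', List.prod_concat, mul_assoc]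
      simp [Fin.snocEquiv]
    constructor
    · rintro ⟨g, hg, rfl⟩
      choose c hc using fun b => ih.1 (hg b)
      refine ⟨fun a => c (a (Fin.last r)) (Fin.init a), ?_⟩
      rw [key]
      refine Finset.sum_congr rfl fun b _ => ?_
      rw [hc]
      simp
    · rintro ⟨c, rfl⟩
      exact ⟨_, fun b => ih.2 ⟨_, rfl⟩, key c⟩

theorem isPolyOfDegree_iff {r : ℕ} {f : SFun (ε ⊕ ο) (ο ⊕ ε)} (hf : SmoothOn f (cot ο U)) :
    IsPolyOfDegree U r f ↔ IsPolyDeg r (Sm.mk f hf) := by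
  have key : ∀ (c : (Fin r → ε ⊕ ο) → Sm ο U) (y : cot ο U),
      (∑ a, bas (c a) * (List.ofFn fun j => fib (a j)).prod).1 y =
      ∑ a : Fin r → ε ⊕ ο, relabel Sum.inl ((c a).1 ⟨fun i => y.1 (Sum.inl i), y.2⟩) *
        (List.ofFn fun j => coord (starIdx (a j)) y.1).prod := by
    intro c y
    rw [Sm.sum_val]
    refine Finset.sum_congr rfl fun a _ => ?_
    rw [Sm.mul_val, bas_val]
    refine congrArg _ ((map_list_prod (Sm.ev y) _).trans ?_)
    rw [List.map_ofFn]
    rfl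
  rw [isPolyDeg_iff_exists]
  constructor
  · rintro ⟨c, hc, h⟩
    refine ⟨fun a => Sm.mk (c a) (hc a), Sm.ext fun y => ?_⟩
    rw [key]
    exact h y y.2
  · rintro ⟨c, hc⟩
    refine ⟨fun a => Sm.out (c a), fun a => Sm.smooth_out _, fun y hy => ?_⟩
    have h1 := congrArg (fun g : Sm (ο ⊕ ε) (cot ο U) => g.1 ⟨y, hy⟩) hc
    refine (h1.trans (key c ⟨y, hy⟩)).trans (Finset.sum_congr rfl fun a _ => ?_)
    rw [← Sm.out_apply]
    rfl

namespace IsPolyDeg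

theorem zero (r : ℕ) : IsPolyDeg r (0 : Sm (ο ⊕ ε) (cot ο U)) := by
  induction r with
  | zero => exact ⟨0, (map_zero _).symm⟩
  | succ r ih => exact ⟨fun _ => 0, fun _ => ih, by simp⟩

variable {r : ℕ} {F G : Sm (ο ⊕ ε) (cot ο U)}

theorem add (hF : IsPolyDeg r F) (hG : IsPolyDeg r G) : IsPolyDeg r (F + G) := by
  induction r generalizing F G with
  | zero =>
    obtain ⟨c, rfl⟩ := hF
    obtain ⟨d, rfl⟩ := hG
    exact ⟨c + d, (map_add _ _ _).symm⟩
  | succ r ih =>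
    obtain ⟨f, hf, rfl⟩ := hF
    obtain ⟨g, hg, rfl⟩ := hG
    exact ⟨fun b => f b + g b, fun b => ih (hf b) (hg b), by
      simp only [add_mul, Finset.sum_add_distrib]⟩

theorem bas_mul (c : Sm ο U) (hF : IsPolyDeg r F) : IsPolyDeg r (bas c * F) := by
  induction r generalizing F with
  | zero =>
    obtain ⟨d, rfl⟩ := hF
    exact ⟨c * d, (map_mul _ _ _).symm⟩
  | succ r ih =>
    obtain ⟨f, hf, rfl⟩ := hF
    exact ⟨fun b => bas c * f b, fun b => ih (hf b), by simp only [Finset.mul_sum, mul_assoc]⟩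

theorem smul (t : ℝ) (hF : IsPolyDeg r F) : IsPolyDeg r (t • F) := by
  have h := hF.bas_mul (algebraMap ℝ _ t)
  rwa [AlgHom.commutes, ← Algebra.smul_def] at h

theorem sum {ι : Type*} (s : Finset ι) {f : ι → Sm (ο ⊕ ε) (cot ο U)}
    (h : ∀ i ∈ s, IsPolyDeg r (f i)) : IsPolyDeg r (∑ i ∈ s, f i) :=
  Finset.sum_induction f (IsPolyDeg r) (fun _ _ => add) (zero r) h

theorem mul_fib (hF : IsPolyDeg r F) (b : ε ⊕ ο) : IsPolyDeg (r + 1) (F * fib b) :=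
  ⟨fun c => if c = b then F else 0, fun c => by
    dsimp only
    split_ifs
    · exact hF
    · exact zero r, by simp⟩

theorem inv (hF : IsPolyDeg r F) : IsPolyDeg r (SuperRing.inv F) := by
  induction r generalizing F with
  | zero =>
    obtain ⟨c, rfl⟩ := hF
    exact ⟨SuperRing.inv c, isSHom_bas c⟩
  | succ r ih =>
    obtain ⟨f, hf, rfl⟩ := hF
    refine ⟨fun b => sg (gpar b + 1) • SuperRing.inv (f b), fun b => (ih (hf b)).smul _, ?_⟩
    rw [map_sum]
    refine Finset.sum_congr rfl fun b _ => ?_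
    have h : SuperRing.inv (fib (U := U) b) = sg (gpar b + 1) • fib b := hom_fib b
    rw [map_mul, h, mul_smul_comm, smul_mul_assoc]

theorem bder_mul_fib (a b : ε ⊕ ο) (F : Sm (ο ⊕ ε) (cot ο U)) :
    bder a (F * fib b) = bder a F * fib b := by
  induction F using hom_induction with
  | hadd F F' h h' => rw [add_mul, map_add, h, h', map_add, add_mul]
  | hhom d F hF => rw [(isCotDer.base a).leib hF, bder_fib, mul_zero, smul_zero, add_zero]

theorem bder (hF : IsPolyDeg r F) (a : ε ⊕ ο) : IsPolyDeg r (bder a F) := by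
  induction r generalizing F with
  | zero =>
    obtain ⟨c, rfl⟩ := hF
    exact ⟨_, bder_bas a c⟩
  | succ r ih =>
    obtain ⟨f, hf, rfl⟩ := hF
    refine ⟨_, fun b => ih (hf b), ?_⟩
    rw [map_sum]
    exact Finset.sum_congr rfl fun b _ => bder_mul_fib a b _

theorem lap_bas (c : Sm ο U) : lap gpar SuperGeom.bder sder (bas c) = 0 := by
  simp [lap_apply, sder_bas]

theorem lap_fib (b : ε ⊕ ο) : lap gpar SuperGeom.bder sder (fib (U := U) b) = 0 := by
  have h : ∀ a c : ε ⊕ ο,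
      SuperGeom.bder a (if c = b then (1 : Sm (ο ⊕ ε) (cot ο U)) else 0) = 0 := by
    intro a c
    split_ifs
    · exact (isCotDer.base a).one
    · exact map_zero _
  simp [lap_apply, sder_fib, h]

/-- The defect is the bracket with a fibre coordinate, up to sign and involution a derivative along
the base; so it keeps the degree. -/
theorem lap_mul_fib (hF : IsPolyDeg r F) (b : ε ⊕ ο) :
    IsPolyDeg r (lap gpar SuperGeom.bder sder (F * fib b) -
      lap gpar SuperGeom.bder sder F * fib b) := by
  have h := lap_mul_sub F (fib b)
  rw [lap_fib, mul_zero, sub_zero] at h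
  rw [h]
  simp only [bder_fib, mul_zero, zero_add, sder_fib, mul_ite, mul_one]
  rcases b with i | α
  · simp only [Sum.inl.injEq, Finset.sum_ite_eq', Finset.mem_univ, if_true, reduceCtorEq, if_false,
      Finset.sum_const_zero, sub_zero]
    exact hF.inv.bder _
  · simp only [Sum.inr.injEq, Finset.sum_ite_eq', Finset.mem_univ, if_true, reduceCtorEq, if_false,
      Finset.sum_const_zero, zero_sub]
    rw [← neg_one_smul ℝ]
    exact (hF.bder _).smul _

theorem lap (hF : IsPolyDeg (r + 1) F) : IsPolyDeg r (lap gpar SuperGeom.bder sder F) := by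
  induction r generalizing F with
  | zero =>
    obtain ⟨f, hf, rfl⟩ := hF
    rw [map_sum]
    refine sum _ fun b _ => ?_
    have h := (hf b).lap_mul_fib b
    obtain ⟨c, hc⟩ := hf b
    rwa [hc, lap_bas, zero_mul, sub_zero, ← hc] at h
  | succ r ih =>
    obtain ⟨f, hf, rfl⟩ := hF
    rw [map_sum]
    refine sum _ fun b _ => ?_
    have h := ((hf b).lap_mul_fib b).add ((ih (hf b)).mul_fib b)
    rwa [sub_add_cancel] at h

theorem sub {p q : ℕ} {U : Opens (Fin p → ℝ)} {F : Sm (Fin q ⊕ Fin p) (cot (Fin q) U)}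
    (hF : IsPolyDeg r F) : IsPolyDeg r (sub F) := by
  induction r generalizing F with
  | zero =>
    obtain ⟨c, rfl⟩ := hF
    exact ⟨_, (bas_up c).symm⟩
  | succ r ih =>
    obtain ⟨f, hf, rfl⟩ := hF
    rw [map_sum]
    refine sum _ fun b _ => ?_
    rw [map_mul, sub_fib]
    exact (ih (hf b)).mul_fib _

theorem lft {p q : ℕ} {U : Opens (Fin p → ℝ)} {F : Sm (Fin q ⊕ Fin p) (cot (Fin q) U)}
    (hF : IsPolyDeg r F) (w : ℝ) : IsPolyDeg r (lft w F) := by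
  have h1 := SuperRing.even_comm (hom_zero_iff.1 (hom_tpw (q := q) (U := U) w))
  have h2 : ∀ G : SmHat q U, tst * G = SuperRing.inv G * tst := by
    intro G
    rw [SuperRing.odd_comm (hom_one_iff.1 (hom_tst (q := q) (U := U))), SuperRing.inv_inv]
  -- The factor `t*` is moved to the right end, where it raises the degree by one and makes up for
  -- the degree lost under Δ. In degree 0 there is nothing to make up for, as Δ vanishes.
  rw [SuperGeom.lft, hatForm, mul_assoc tv, ← h1 tst, mul_assoc, mul_assoc, h2, ← h1, ← bas_tbw]
  refine (hF.sub.bas_mul _).add (bas_mul tc (bas_mul _ ?_))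
  cases r with
  | zero =>
    obtain ⟨c, rfl⟩ := hF
    rw [lap_bas]
    simpa using zero 0
  | succ r => exact ((hF.lap.smul _).sub.inv).mul_fib _

end IsPolyDeg

end Poly

/-! ## The lift -/

theorem hom_lft {p q : ℕ} {U : Opens (Fin p → ℝ)} {d : ZMod 2}
    {s : Sm (Fin q ⊕ Fin p) (cot (Fin q) U)} (hs : Hom d s) (w : ℝ) : Hom d (lft w s) := by
  refine (((isSHom_sub.hom hs).mul (hom_tpw w)).cast (by simp)).add
    ((((hom_tv.mul hom_tst).mul (hom_tpw w)).mul
      (isSHom_sub.hom ((lap_hom isCotDer hs).smul _))).cast ?_)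
  clear hs
  revert d
  decide

namespace Supermanifold

variable {p q : ℕ} {X : Type*} [TopologicalSpace X] {I : Type*} (M : Supermanifold p q X I)

/-- The lift of a family of superfunctions on the odd cotangent bundle. -/
def liftFun (w : ℝ) (s : I → SFun (Fin p ⊕ Fin q) (Fin q ⊕ Fin p)) :
    I → SFun (Option (Fin p) ⊕ Fin q) (Fin q ⊕ Option (Fin p)) := fun i =>
  (M.hatDomain i).indicator (localLift w (s i))

variable {M}

theorem liftFun_of_mem (w : ℝ) (s : I → SFun (Fin p ⊕ Fin q) (Fin q ⊕ Fin p)) {i : I}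
    {y : Option (Fin p) ⊕ Fin q → ℝ} (hy : y ∈ M.hatDomain i) :
    M.liftFun w s i y = localLift w (s i) y := indicator_of_mem hy _

section Section

variable {w : ℝ} {s : I → SFun (Fin p ⊕ Fin q) (Fin q ⊕ Fin p)}

theorem lft_val {U : Opens (Fin p → ℝ)} {i : I} (hU : U ≤ M.dom i)
    (hs : SmoothOn (s i) (cot (Fin q) U)) (y : cot (Fin q) (hatO U)) :
    (lft w (Sm.mk (s i) hs)).1 y = M.liftFun w s i y := by
  rw [lft_mk_val, liftFun_of_mem (M := M)]
  exact ⟨hU y.2.1, y.2.2⟩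

theorem smoothOn_liftFun {i : I} (hs : SmoothOn (s i) (cot (Fin q) (M.dom i))) :
    SmoothOn (M.liftFun w s i) (cot (Fin q) (hatO (M.dom i))) :=
  Sm.smoothOn_of_val _ (lft_val le_rfl hs)

theorem mk_liftFun {U : Opens (Fin p → ℝ)} {i : I} (hU : U ≤ M.dom i)
    (hs : SmoothOn (s i) (cot (Fin q) U))
    (h : SmoothOn (M.liftFun w s i) (cot (Fin q) (hatO U))) :
    Sm.mk (M.liftFun w s i) h = lft w (Sm.mk (s i) hs) :=
  Sm.ext fun y => (lft_val hU hs y).symm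

theorem smoothOn_of_mem (hs : s ∈ M.densFun w) (i : I) :
    SmoothOn (s i) (cot (Fin q) (M.dom i)) := hs.2.1 i

theorem liftFun_mem_hatSmooth (hw : w ≠ 1) (hs : s ∈ M.densFun w) :
    M.liftFun w s ∈ M.hatSmooth := by
  have h := smoothOn_of_mem hs
  refine (M.hatSmooth_iff fun i => smoothOn_liftFun (h i)).2
    ⟨fun i y hy => indicator_of_notMem hy _, fun i j => ?_⟩
  have h2 := ((M.densFun_iff w h).1 hs).2 i j
  rw [mk_liftFun (M.ovl_le i j) ((h i).mono fun _ hy => M.ovl_le i j hy),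
    mk_liftFun (M.ovl_le j i) ((h j).mono fun _ hy => M.ovl_le j i hy), h2, Change.hat_Ψ_lft _ hw]

theorem liftFun_mem_hatWeight (hw : w ≠ 1) (hs : s ∈ M.densFun w) :
    M.liftFun w s ∈ M.hatWeight w := by
  refine ⟨liftFun_mem_hatSmooth hw hs, fun i y hy => ?_⟩
  have h := smoothOn_of_mem hs i
  have h2 := wt_mk_val (smoothOn_liftFun (w := w) h) ⟨y, hy⟩
  rw [mk_liftFun le_rfl h, wt_lft, Sm.smul_val, lft_val le_rfl h] at h2
  exact h2.symm

theorem liesOver_liftFun (hs : s ∈ M.densFun w) : M.LiesOver w (M.liftFun w s) s := by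
  intro i y hy
  have h := smoothOn_of_mem hs i
  have h2 := proj_lft w (Sm.mk (s i) h) ⟨y, hy⟩
  rw [proj_apply, lft_val le_rfl h] at h2
  exact h2

theorem delta_liftFun (hw : w ≠ 1) (hs : s ∈ M.densFun w) (i : I)
    {y : Option (Fin p) ⊕ Fin q → ℝ} (hy : y ∈ M.hatDomain i) :
    delta (M.liftFun w s i) y = 0 := by
  have h := smoothOn_of_mem hs i
  have h2 := del_mk_val (smoothOn_liftFun (w := w) h) ⟨y, hy⟩
  rw [mk_liftFun le_rfl h, del_lft hw] at h2
  exact h2.symm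

/-- Uniqueness is local: the comparison is made in each chart, and outside the coordinate domain
both families are zero. -/
theorem eq_liftFun (hw : w ≠ 1) (hs : s ∈ M.densFun w)
    {F : I → SFun (Option (Fin p) ⊕ Fin q) (Fin q ⊕ Option (Fin p))} (hF : F ∈ M.hatWeight w)
    (hF' : M.LiesOver w F s) (hδ : ∀ i, ∀ y ∈ M.hatDomain i, delta (F i) y = 0) :
    F = M.liftFun w s := by
  funext i y
  by_cases hy : y ∈ M.hatDomain i
  · have h := smoothOn_of_mem hs i
    have h1 : SmoothOn (F i) (cot (Fin q) (hatO (M.dom i))) := hF.1.2.1 i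
    have h2 : Sm.mk (F i) h1 = lft w (Sm.mk (s i) h) := by
      refine eq_of_proj_eq hw (Sm.ext fun y => ?_) (del_lft hw _) (Sm.ext fun y => ?_) (wt_lft _ _)
        fun y => ?_
      · rw [del_mk_val]
        exact hδ i y y.2
      · rw [wt_mk_val]
        exact hF.2 i y y.2
      · rw [proj_lft]
        exact hF' i y y.2
    rw [← lft_val le_rfl h ⟨y, hy⟩, ← h2]
    rfl
  · rw [hF.1.1 i y hy]
    exact (indicator_of_notMem hy _).symm

theorem liftFun_mem_parityPart (hs : s ∈ M.densFun w) {d : ZMod 2}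
    (hd : ∀ i y, s i y ∈ parityPart (Fin q ⊕ Fin p) d) (i : I) (y : Option (Fin p) ⊕ Fin q → ℝ) :
    M.liftFun w s i y ∈ parityPart (Fin q ⊕ Option (Fin p)) d := by
  by_cases hy : y ∈ M.hatDomain i
  · have h := smoothOn_of_mem hs i
    rw [← lft_val le_rfl h ⟨y, hy⟩]
    have h1 : Hom d (Sm.mk (s i) h) := Sm.hom_iff.2 fun x => mem_parityPart_iff.1 (hd i x)
    exact mem_parityPart_iff.2 (Sm.hom_iff.1 (hom_lft h1 w) ⟨y, hy⟩)
  · rw [liftFun, indicator_of_notMem hy]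
    exact Submodule.zero_mem _

theorem isPolyOfDegree_liftFun (hs : s ∈ M.densFun w) {r : ℕ} {i : I}
    (hr : IsPolyOfDegree (M.chart i).target r (s i)) :
    IsPolyOfDegree (hatSet (M.chart i).target) r (M.liftFun w s i) := by
  have h := smoothOn_of_mem hs i
  refine (isPolyOfDegree_iff (smoothOn_liftFun h)).2 ?_
  rw [mk_liftFun le_rfl h]
  exact ((isPolyOfDegree_iff h).1 hr).lft w

end Section

theorem liftFun_add {w : ℝ} {s u : I → SFun (Fin p ⊕ Fin q) (Fin q ⊕ Fin p)}
    (hs : s ∈ M.densFun w) (hu : u ∈ M.densFun w) :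
    M.liftFun w (s + u) = M.liftFun w s + M.liftFun w u := by
  funext i y
  rw [Pi.add_apply, Pi.add_apply]
  by_cases hy : y ∈ M.hatDomain i
  · have h := smoothOn_of_mem hs i
    have h' := smoothOn_of_mem hu i
    have h0 : SmoothOn ((s + u) i) (cot (Fin q) (M.dom i)) := h.add h'
    have e0 : Sm.mk ((s + u) i) h0 = Sm.mk (s i) h + Sm.mk (u i) h' := rfl
    have e1 := lft_val (w := w) le_rfl h ⟨y, hy⟩
    have e2 := lft_val (w := w) le_rfl h' ⟨y, hy⟩
    have e3 := lft_val (w := w) le_rfl h0 ⟨y, hy⟩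
    rw [e0, lft_add, Sm.add_val, e1, e2] at e3
    exact e3.symm
  · simp [liftFun, indicator_of_notMem hy]

theorem liftFun_smul {w : ℝ} (c : ℝ) {s : I → SFun (Fin p ⊕ Fin q) (Fin q ⊕ Fin p)}
    (hs : s ∈ M.densFun w) : M.liftFun w (c • s) = c • M.liftFun w s := by
  funext i y
  rw [Pi.smul_apply, Pi.smul_apply]
  by_cases hy : y ∈ M.hatDomain i
  · have h := smoothOn_of_mem hs i
    have h0 : SmoothOn ((c • s) i) (cot (Fin q) (M.dom i)) := h.smul c
    have e0 : Sm.mk ((c • s) i) h0 = c • Sm.mk (s i) h := rfl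
    have e1 := lft_val (w := w) le_rfl h ⟨y, hy⟩
    have e3 := lft_val (w := w) le_rfl h0 ⟨y, hy⟩
    rw [e0, lft_smul, Sm.smul_val, e1] at e3
    exact e3.symm
  · simp [liftFun, indicator_of_notMem hy]

variable (M) in
/-- The lift as a linear map. -/
def lift (w : ℝ) (hw : w ≠ 1) : M.densFun w →ₗ[ℝ] M.hatFun where
  toFun s := ⟨M.liftFun w s.1, (le_iSup M.hatWeight w) (liftFun_mem_hatWeight hw s.2)⟩
  map_add' s u := Subtype.ext (liftFun_add s.2 u.2)
  map_smul' c s := Subtype.ext (liftFun_smul c s.2)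

/-! ## The bracket of lifts -/

/-- The projection of the bracket of the lifts of `s` and `u`, in coordinates. -/
def brkExpr (w v : ℝ) (s u : SFun (Fin p ⊕ Fin q) (Fin q ⊕ Fin p)) :
    SFun (Fin p ⊕ Fin q) (Fin q ⊕ Fin p) :=
  oddLaplacian (s * u) + (w + v - 1) • ((1 / (1 - w)) • oddLaplacian s * u +
    (fun y => parityAut (s y)) * (1 / (1 - v)) • oddLaplacian u)

variable (M) in
/-- The projection of the bracket of the lifts of `s` and `u`. -/
def brkFun (w v : ℝ) (s u : I → SFun (Fin p ⊕ Fin q) (Fin q ⊕ Fin p)) :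
    I → SFun (Fin p ⊕ Fin q) (Fin q ⊕ Fin p) := fun i =>
  (cotDomain (M.chart i).target).indicator (brkExpr w v (s i) (u i))

section Bracket

variable {w v : ℝ} {s u : I → SFun (Fin p ⊕ Fin q) (Fin q ⊕ Fin p)}

theorem lftBrk_val {U : Opens (Fin p → ℝ)} {i : I} (hU : U ≤ M.dom i)
    (hs : SmoothOn (s i) (cot (Fin q) U)) (hu : SmoothOn (u i) (cot (Fin q) U))
    (y : cot (Fin q) U) :
    (lftBrk w v (Sm.mk (s i) hs) (Sm.mk (u i) hu)).1 y = M.brkFun w v s u i y := by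
  have h1 : y.1 ∈ cotDomain (M.chart i).target := hU y.2
  have h2 : Sm.mk (s i) hs * Sm.mk (u i) hu = Sm.mk (s i * u i) (hs.mul hu) := rfl
  rw [brkFun, indicator_of_mem h1, lftBrk, brkExpr, h2]
  simp only [Sm.add_val, Sm.smul_val, Sm.mul_val, lap_mk_val]
  rfl

theorem smoothOn_brkFun {i : I} (hs : SmoothOn (s i) (cot (Fin q) (M.dom i)))
    (hu : SmoothOn (u i) (cot (Fin q) (M.dom i))) :
    SmoothOn (M.brkFun w v s u i) (cot (Fin q) (M.dom i)) :=
  Sm.smoothOn_of_val _ (lftBrk_val le_rfl hs hu)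

theorem mk_brkFun {U : Opens (Fin p → ℝ)} {i : I} (hU : U ≤ M.dom i)
    (hs : SmoothOn (s i) (cot (Fin q) U)) (hu : SmoothOn (u i) (cot (Fin q) U))
    (h : SmoothOn (M.brkFun w v s u i) (cot (Fin q) U)) :
    Sm.mk (M.brkFun w v s u i) h = lftBrk w v (Sm.mk (s i) hs) (Sm.mk (u i) hu) :=
  Sm.ext fun y => (lftBrk_val hU hs hu y).symm

theorem brkFun_mem (hw : w ≠ 1) (hv : v ≠ 1) (hwv : w + v ≠ 1) (hs : s ∈ M.densFun w)
    (hu : u ∈ M.densFun v) : M.brkFun w v s u ∈ M.densFun (w + v) := by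
  have h := smoothOn_of_mem hs
  have h' := smoothOn_of_mem hu
  refine (M.densFun_iff (w + v) fun i => smoothOn_brkFun (h i) (h' i)).2
    ⟨fun i y hy => indicator_of_notMem hy _, fun i j => ?_⟩
  have h2 := ((M.densFun_iff w h).1 hs).2 i j
  have h3 := ((M.densFun_iff v h').1 hu).2 i j
  rw [mk_brkFun (M.ovl_le i j) ((h i).mono fun _ hy => M.ovl_le i j hy)
    ((h' i).mono fun _ hy => M.ovl_le i j hy), mk_brkFun (M.ovl_le j i)
    ((h j).mono fun _ hy => M.ovl_le j i hy) ((h' j).mono fun _ hy => M.ovl_le j i hy), h2, h3,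
    Change.lftBrk_Ψ _ hw hv hwv]

/-- The bracket is the Leibniz defect of δ; for two δ-closed factors only δ of their product
remains. -/
theorem liftFun_brkFun (hw : w ≠ 1) (hv : v ≠ 1) (hwv : w + v ≠ 1) (hs : s ∈ M.densFun w)
    (hu : u ∈ M.densFun v) :
    M.liftFun (w + v) (M.brkFun w v s u) = M.hatBracket (M.liftFun w s) (M.liftFun v u) := by
  funext i y
  by_cases hy : y ∈ M.hatDomain i
  · have h := smoothOn_of_mem hs i
    have h' := smoothOn_of_mem hu i
    have h1 := oddBracket_val (smoothOn_liftFun (w := w) h) (smoothOn_liftFun (w := v) h') ⟨y, hy⟩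
      (mk_liftFun le_rfl h _).symm (mk_liftFun le_rfl h' _).symm
    rw [del_mul_sub, del_lft hw, del_lft hv, zero_mul, mul_zero, sub_zero, sub_zero,
      del_lft_mul hwv] at h1
    rw [← lft_val le_rfl (smoothOn_brkFun h h') ⟨y, hy⟩, mk_brkFun le_rfl h h', h1, hatBracket,
      indicator_of_mem hy]
  · rw [liftFun, hatBracket, indicator_of_notMem hy, indicator_of_notMem hy]

/-- In weight 0 the coefficient w + v - 1 is -1, and the projected expression is exactly the Leibniz
defect of Δ on the base. -/
theorem brkFun_zero (hs : s ∈ M.densFun 0) (hu : u ∈ M.densFun 0) :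
    M.brkFun 0 0 s u = M.bracket s u := by
  funext i y
  by_cases hy : y ∈ cotDomain (M.chart i).target
  · have h := smoothOn_of_mem hs i
    have h' := smoothOn_of_mem hu i
    have h1 := oddBracket_val h h' ⟨y, hy⟩ rfl rfl
    have h2 := lftBrk_val (w := 0) (v := 0) (M := M) le_rfl h h' ⟨y, hy⟩
    rw [← h2, bracket, indicator_of_mem hy, ← h1, lftBrk, add_zero, zero_sub, sub_zero, div_one,
      one_smul, one_smul, neg_one_smul, neg_add, ← sub_eq_add_neg, ← add_sub_assoc,
      ← sub_eq_add_neg]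
  · rw [brkFun, bracket, indicator_of_notMem hy, indicator_of_notMem hy]

end Bracket

end Supermanifold

end SuperGeom

end

/-! ### The theorem -/

theorem mainTheorem1 {p q : ℕ} {X : Type*} [TopologicalSpace X] [T2Space X]
    [SecondCountableTopology X] {I : Type*} (M : SuperGeom.Supermanifold p q X I) :
    ∃ lift : ∀ w : ℝ, w ≠ 1 → (M.densFun w →ₗ[ℝ] M.hatFun),
      (∀ (w : ℝ) (hw : w ≠ 1) (s : M.densFun w),
        -- the lift preserves the weight
        (lift w hw s).1 ∈ M.hatWeight w ∧
        -- the lift is a section of the canonical projection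
        M.LiesOver w (lift w hw s).1 s.1 ∧
        -- the local form of the lift
        (∀ i, ∀ y ∈ M.hatDomain i, (lift w hw s).1 i y =
          SuperGeom.Supermanifold.localLift w (s.1 i) y) ∧
        -- the lift preserves the parity
        (∀ ε : ZMod 2, (∀ i y, s.1 i y ∈ SuperGeom.parityPart (Fin q ⊕ Fin p) ε) →
          ∀ i y, (lift w hw s).1 i y ∈
            SuperGeom.parityPart (Fin q ⊕ Option (Fin p)) ε) ∧
        -- the lift preserves the degree of polynomial functions
        (∀ r : ℕ, (∀ i, SuperGeom.IsPolyOfDegree (M.chart i).target r (s.1 i)) →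
          ∀ i, SuperGeom.IsPolyOfDegree (SuperGeom.Supermanifold.hatSet (M.chart i).target) r
            ((lift w hw s).1 i)) ∧
        -- the lift is annihilated by `δ`
        (∀ i, ∀ y ∈ M.hatDomain i,
          SuperGeom.Supermanifold.delta ((lift w hw s).1 i) y = 0) ∧
        -- and it is the only element of the same weight over `s` with this property
        (∀ F ∈ M.hatWeight w, M.LiesOver w F s.1 →
          (∀ i, ∀ y ∈ M.hatDomain i, SuperGeom.Supermanifold.delta (F i) y = 0) →
          F = (lift w hw s).1)) ∧
      -- the lift of functions commutes with the canonical odd bracket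
      (∀ s u : M.densFun 0, ∃ h : M.bracket s.1 u.1 ∈ M.densFun 0,
        (lift 0 zero_ne_one ⟨M.bracket s.1 u.1, h⟩).1 =
          M.hatBracket (lift 0 zero_ne_one s).1 (lift 0 zero_ne_one u).1) ∧
      -- and so does the lift in arbitrary weights, where the bracket of `s` and `u` is the
      -- projection of the bracket of their lifts
      (∀ (w v : ℝ) (hw : w ≠ 1) (hv : v ≠ 1) (hwv : w + v ≠ 1)
        (s : M.densFun w) (u : M.densFun v),
        ∃ r : M.densFun (w + v),
          M.LiesOver (w + v) (M.hatBracket (lift w hw s).1 (lift v hv u).1) r.1 ∧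
          (lift (w + v) hwv r).1 = M.hatBracket (lift w hw s).1 (lift v hv u).1) := by
  open SuperGeom Supermanifold in
  refine ⟨M.lift, fun w hw s => ⟨liftFun_mem_hatWeight hw s.2, liesOver_liftFun s.2,
    fun i y hy => liftFun_of_mem w s.1 hy, fun d hd => liftFun_mem_parityPart s.2 hd,
    fun r hr i => isPolyOfDegree_liftFun s.2 (hr i), fun i y hy => delta_liftFun hw s.2 i hy,
    fun F hF hF' hδ => eq_liftFun hw s.2 hF hF' hδ⟩, fun s u => ?_, fun w v hw hv hwv s u => ?_⟩
  · have h0 : (0 : ℝ) + 0 ≠ 1 := by simp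
    have h1 := SuperGeom.Supermanifold.brkFun_mem zero_ne_one zero_ne_one h0 s.2 u.2
    have h2 := SuperGeom.Supermanifold.liftFun_brkFun zero_ne_one zero_ne_one h0 s.2 u.2
    rw [SuperGeom.Supermanifold.brkFun_zero s.2 u.2, add_zero] at h1 h2
    exact ⟨h1, h2⟩
  · have h1 := SuperGeom.Supermanifold.brkFun_mem hw hv hwv s.2 u.2
    have h2 := SuperGeom.Supermanifold.liftFun_brkFun hw hv hwv s.2 u.2
    -- The element `r` is the projection of the bracket. That the bracket lies over it follows
    -- because a lift lies over what it lifts.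
    refine ⟨⟨_, h1⟩, ?_, h2⟩
    have h3 := SuperGeom.Supermanifold.liesOver_liftFun h1
    rw [h2] at h3
    exact h3
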